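/- Let $\mathbf{k}$ be a field of characteristic $p>0$, let $n\ge 1$, let $C_{p^n}$ be the cyclic group of order $p^n$ with generator $\sigma$, and let $\mathsf{C}_n=\mathsf{Rep}_{\mathbf{k}}C_{p^n}$ be its tensor category of finite-dimensional representations. Definitions. A tensor category over $\mathbf{k}$ is an essentially small $\mathbf{k}$-linear abelian rigid monoidal category (with bilinear tensor product) in which all objects have finite length and $\mathbf{k}\to\mathrm{End}(\mathbf{1})$ is an isomorphism; a tensor functor is a $\mathbf{k}$-linear monoidal functor. A tensor ideal $\mathcal{I}$ in $\mathsf{C}_n$ is a system of subspaces $\mathcal{I}(X,Y)\subset\mathrm{Hom}(X,Y)$ closed under composition, and under tensoring on either side, with arbitrary morphisms. It is of abelian type if it is the kernel of a tensor functor to a tensor category over $\mathbf{k}$. It is prime if $\mathrm{id}_{\mathbf 1}\notin\mathcal{I}$ and $f\otimes g\in\mathcal{I}$ implies $f\in\mathcal{I}$ or $g\in\mathcal{I}$. It is faithfully prime if $\mathrm{id}_{\mathbf 1}\notin\mathcal{I}$ and, for all $X,Y,U,V$, the preimage of $\mathcal{I}(X\otimes U,Y\otimes V)$ in $\mathrm{Hom}(X,Y)\otimes_{\mathbf{k}}\mathrm{Hom}(U,V)$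 is $\mathcal{I}(X,Y)\otimes\mathrm{Hom}(U,V)+\mathrm{Hom}(X,Y)\otimes\mathcal{I}(U,V)$. A thick tensor ideal $\mathbf{I}$ is an isomorphism-closed class of objects containing $0$, closed under tensoring with arbitrary objects, such that $X\oplus Y\in\mathbf{I}$ if and only if $X,Y\in\mathbf{I}$; it is prime if $\mathbf{1}\notin\mathbf{I}$ and $X\otimes Y\in\mathbf{I}$ implies $X\in\mathbf{I}$ or $Y\in\mathbf{I}$. Put $\mathrm{Ob}(\mathcal{I})=\{X\mid \mathrm{id}_X\in\mathcal{I}\}$. For $1\le i\le p^n$ let $J_i=\mathbf{k}C_{p^n}/((\sigma-1)^i)$, the indecomposable representation of dimension $i$. For $1\le j<p^n$ let $\mathcal{I}_j$ be the tensor ideal generated by a monomorphism $\mathbf{1}\hookrightarrow J_{j+1}$ (unique up to scalar), and let $\mathcal{I}_{p^n}=0$. The semisimplification $\overline{\mathsf{C}_l}$ of $\mathsf{C}_l=\mathsf{Rep}_{\mathbf{k}}C_{p^l}$ is its quotient by the tensor ideal of negligible morphisms, i.e. the $f:X\to Y$ with $\mathrm{tr}(g\circ f)=0$ for all $g:Y\to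 X$. An abelian envelope of a $\mathbf{k}$-linear monoidal category $\mathsf{A}$ is a faithful tensor functor $F:\mathsf{A}\to\mathsf{C}$ to a tensor category over $\mathbf{k}$ such that, for every tensor category $\mathsf{D}$ over $\mathbf{k}$, composition with $F$ is an equivalence from the category of exact tensor functors $\mathsf{C}\to\mathsf{D}$ to the category of faithful tensor functors $\mathsf{A}\to\mathsf{D}$ (with monoidal natural transformations as morphisms). The symbol $\boxtimes$ denotes Deligne's tensor product: the universal $\mathbf{k}$-bilinear bifunctor, right exact in each variable, to $\mathbf{k}$-linear abelian categories, with the monoidal structure on its target for which this bifunctor is monoidal. Theorem. (1) In $\mathsf{C}_n$, the classes of tensor ideals of abelian type, of faithfully prime tensor ideals and of prime tensor ideals coincide, and $\mathrm{Ob}$ restricts to a bijection from this class to the set of prime thick tensor ideals. In other words, all maps in the diagram $$\begin{array}{ccc}\{\text{tensor ideals of abelian type}\}&\xrightarrow{\ \mathrm{Ob}\ }&\{\text{prime thick tensor ideals}\}\\ \downarrow&\nearrow&\uparrow\\ \{\text{faithfully prime tensor ideals}\}&\hookrightarrow&\{\text{prime tensor ideals}\}\end{array}$$ (inclusions on the left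 and at the bottom, $\mathrm{Ob}$ elsewhere) are well defined and bijective. (2) A tensor ideal in $\mathsf{C}_n$ is prime, equivalently of abelian type, if and only if it equals $\mathcal{I}_{p^m}$ for some $0\le m\le n$. (3) For every tensor ideal $\mathcal{I}$ of abelian type in $\mathsf{C}_n$, the quotient $\mathsf{C}_n/\mathcal{I}$ admits an abelian envelope. For $0\le m\le n$, the quotient $\mathsf{C}_n/\mathcal{I}_{p^m}$ has an abelian envelope with target the tensor category $\mathsf{Rep}_{\mathbf{k}}C_{p^m}\boxtimes\overline{\mathsf{Rep}_{\mathbf{k}}C_{p^{n-m}}}$. -/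

import Mathlib

open CategoryTheory MonoidalCategory Limits

universe u v w v₁ u₁ v₂ u₂ v₃ u₃

noncomputable section

/-! ### Tensor ideals and thick tensor ideals -/

/-- A tensor ideal in a `k`-linear monoidal category: a system of subspaces of the morphism spaces,
closed under composition with, and tensoring by, arbitrary morphisms and objects on both sides. -/
structure TensorIdeal (k : Type u) [Field k] (A : Type u₁) [Category.{v₁} A] [Preadditive A]
    [Linear k A] [MonoidalCategory A] where
  hom : ∀ X Y : A, Submodule k (X ⟶ Y)
  comp_left_mem : ∀ {X Y Z : A} (f : X ⟶ Y) {g : Y ⟶ Z}, g ∈ hom Y Z → f ≫ g ∈ hom X Z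
  comp_right_mem : ∀ {X Y Z : A} {f : X ⟶ Y} (g : Y ⟶ Z), f ∈ hom X Y → f ≫ g ∈ hom X Z
  whiskerLeft_mem : ∀ (Z : A) {X Y : A} {f : X ⟶ Y}, f ∈ hom X Y → Z ◁ f ∈ hom (Z ⊗ X) (Z ⊗ Y)
  whiskerRight_mem : ∀ {X Y : A} {f : X ⟶ Y} (Z : A), f ∈ hom X Y → f ▷ Z ∈ hom (X ⊗ Z) (Y ⊗ Z)

/-- A thick tensor ideal: a class of objects closed under isomorphism, containing the zero objects,
closed under tensoring with arbitrary objects, and such that `X ⊞ Y` belongs to it if and only if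
both `X` and `Y` do. -/
@[ext]
structure ThickTensorIdeal (A : Type u₁) [Category.{v₁} A] [Preadditive A]
    [HasBinaryBiproducts A] [MonoidalCategory A] where
  carrier : Set A
  mem_of_iso : ∀ {X Y : A}, (X ≅ Y) → X ∈ carrier → Y ∈ carrier
  zero_mem : ∀ {X : A}, IsZero X → X ∈ carrier
  tensor_left_mem : ∀ (Y : A) {X : A}, X ∈ carrier → Y ⊗ X ∈ carrier
  tensor_right_mem : ∀ {X : A} (Y : A), X ∈ carrier → X ⊗ Y ∈ carrier
  biprod_mem_iff : ∀ X Y : A, (X ⊞ Y) ∈ carrier ↔ X ∈ carrier ∧ Y ∈ carrier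

/-- A thick tensor ideal is prime if it does not contain the unit and `X ⊗ Y ∈ 𝐈` implies
`X ∈ 𝐈` or `Y ∈ 𝐈`. -/
def ThickTensorIdeal.IsPrime {A : Type u₁} [Category.{v₁} A] [Preadditive A]
    [HasBinaryBiproducts A] [MonoidalCategory A] (I : ThickTensorIdeal A) : Prop :=
  𝟙_ A ∉ I.carrier ∧ ∀ X Y : A, X ⊗ Y ∈ I.carrier → X ∈ I.carrier ∨ Y ∈ I.carrier

/-! ### Tensor categories -/

/-- A tensor category over `k`: an essentially small `k`-linear abelian category in which all
objects have finite length, with a `k`-bilinear rigid monoidal structure such that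
`k → End 𝟙` is an isomorphism. -/
structure TensorCat (k : Type u) [Field k] where
  carrier : Type w
  [category : Category.{v} carrier]
  [abelian : Abelian carrier]
  [linear : Linear k carrier]
  [monoidal : MonoidalCategory carrier]
  [monoidalPreadditive : MonoidalPreadditive carrier]
  [monoidalLinear : MonoidalLinear k carrier]
  [rigid : RigidCategory carrier]
  [essentiallySmall : EssentiallySmall.{v} carrier]
  isArtinian : ∀ X : carrier, IsArtinianObject X
  isNoetherian : ∀ X : carrier, IsNoetherianObject X
  unit_bijective : Function.Bijective (fun a : k => a • 𝟙 (𝟙_ carrier))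

attribute [instance] TensorCat.category TensorCat.abelian TensorCat.linear TensorCat.monoidal
  TensorCat.monoidalPreadditive TensorCat.monoidalLinear TensorCat.rigid
  TensorCat.essentiallySmall

/-! ### Properties of tensor ideals -/

namespace TensorIdeal

section General

variable {k : Type u} [Field k] {A : Type u₁} [Category.{v₁} A] [Preadditive A] [Linear k A]
  [MonoidalCategory A]

/-- A (proper) tensor ideal is prime if `f ⊗ g ∈ 𝓘` implies `f ∈ 𝓘` or `g ∈ 𝓘`. -/
def IsPrime (I : TensorIdeal k A) : Prop :=
  𝟙 (𝟙_ A) ∉ I.hom (𝟙_ A) (𝟙_ A) ∧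
    ∀ {X Y U V : A} (f : X ⟶ Y) (g : U ⟶ V),
      f ⊗ₘ g ∈ I.hom (X ⊗ U) (Y ⊗ V) → f ∈ I.hom X Y ∨ g ∈ I.hom U V

/-- The linear map `Hom(X, Y) ⊗ Hom(U, V) → Hom(X ⊗ U, Y ⊗ V)` given by the tensor product. -/
def tensorHomMap (k : Type u) [Field k] {A : Type u₁} [Category.{v₁} A] [Preadditive A]
    [Linear k A] [MonoidalCategory A] [MonoidalPreadditive A] [MonoidalLinear k A]
    (X Y U V : A) :
    TensorProduct k (X ⟶ Y) (U ⟶ V) →ₗ[k] (X ⊗ U ⟶ Y ⊗ V) :=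
  TensorProduct.lift (LinearMap.mk₂ k (fun f g => f ⊗ₘ g)
    (by intros; simp [MonoidalCategory.tensorHom_def])
    (by intros; simp [MonoidalCategory.tensorHom_def])
    (by intros; simp [MonoidalCategory.tensorHom_def])
    (by intros; simp [MonoidalCategory.tensorHom_def]))

/-- A (proper) tensor ideal is faithfully prime if the preimage of `𝓘(X ⊗ U, Y ⊗ V)` under
`Hom(X, Y) ⊗ Hom(U, V) → Hom(X ⊗ U, Y ⊗ V)` is
`𝓘(X, Y) ⊗ Hom(U, V) + Hom(X, Y) ⊗ 𝓘(U, V)`. -/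
def IsFaithfullyPrime [MonoidalPreadditive A] [MonoidalLinear k A] (I : TensorIdeal k A) : Prop :=
  𝟙 (𝟙_ A) ∉ I.hom (𝟙_ A) (𝟙_ A) ∧
    ∀ X Y U V : A, (I.hom (X ⊗ U) (Y ⊗ V)).comap (tensorHomMap k X Y U V) =
      LinearMap.range (TensorProduct.map (I.hom X Y).subtype
        (LinearMap.id : (U ⟶ V) →ₗ[k] (U ⟶ V))) ⊔
      LinearMap.range (TensorProduct.map
        (LinearMap.id : (X ⟶ Y) →ₗ[k] (X ⟶ Y)) (I.hom U V).subtype)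

/-- A tensor ideal is of abelian type if it is the kernel of a tensor functor (a `k`-linear
monoidal functor) to a tensor category over `k`. -/
def IsAbelianType (I : TensorIdeal k A) : Prop :=
  ∃ (D : TensorCat.{u, u, u + 1} k) (F : A ⥤ D.carrier) (_ : F.Monoidal),
    F.Additive ∧ F.Linear k ∧ ∀ {X Y : A} (f : X ⟶ Y), f ∈ I.hom X Y ↔ F.map f = 0

/-- The thick tensor ideal `Ob(𝓘)` of all objects `X` with `𝟙 X ∈ 𝓘`. -/
def ob [HasBinaryBiproducts A] (I : TensorIdeal k A) : ThickTensorIdeal A where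
  carrier := {X | 𝟙 X ∈ I.hom X X}
  mem_of_iso {X Y} e h := by
    have := I.comp_left_mem e.inv (I.comp_right_mem e.hom h)
    simpa using this
  zero_mem {X} h := by
    have : 𝟙 X = 0 := h.eq_of_src _ _
    simp [this]
  tensor_left_mem Y X h := by
    have := I.whiskerLeft_mem Y h
    simpa using this
  tensor_right_mem {X} Y h := by
    have := I.whiskerRight_mem Y h
    simpa using this
  biprod_mem_iff X Y := by
    constructor
    · intro h
      constructor
      · have := I.comp_left_mem biprod.inl (I.comp_right_mem biprod.fst h)
        simpa using this
      · have := I.comp_left_mem biprod.inr (I.comp_right_mem biprod.snd h)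
        simpa using this
    · rintro ⟨hX, hY⟩
      have h₁ := I.comp_left_mem (biprod.fst : X ⊞ Y ⟶ X) (I.comp_right_mem (biprod.inl : X ⟶ X ⊞ Y) hX)
      have h₂ := I.comp_left_mem (biprod.snd : X ⊞ Y ⟶ Y) (I.comp_right_mem (biprod.inr : Y ⟶ X ⊞ Y) hY)
      have := (I.hom _ _).add_mem h₁ h₂
      simpa using this

/-- The tensor ideal generated by a class of morphisms. -/
def span (k : Type u) [Field k] {A : Type u₁} [Category.{v₁} A] [Preadditive A]
    [Linear k A] [MonoidalCategory A] (S : MorphismProperty A) : TensorIdeal k A where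
  hom X Y := ⨅ (I : TensorIdeal k A) (_ : ∀ (U V : A) (f : U ⟶ V), S f → f ∈ I.hom U V), I.hom X Y
  comp_left_mem f g h := by
    simp only [Submodule.mem_iInf] at h ⊢
    exact fun I hI => I.comp_left_mem f (h I hI)
  comp_right_mem g h := by
    simp only [Submodule.mem_iInf] at h ⊢
    exact fun I hI => I.comp_right_mem g (h I hI)
  whiskerLeft_mem Z X Y f h := by
    simp only [Submodule.mem_iInf] at h ⊢
    exact fun I hI => I.whiskerLeft_mem Z (h I hI)
  whiskerRight_mem Z h := by
    simp only [Submodule.mem_iInf] at h ⊢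
    exact fun I hI => I.whiskerRight_mem Z (h I hI)

/-! ### The quotient by a tensor ideal -/

/-- Congruence modulo a tensor ideal. -/
def rel (I : TensorIdeal k A) : HomRel A := fun X Y f g => f - g ∈ I.hom X Y

instance (I : TensorIdeal k A) : Congruence I.rel where
  comp_left f g g' h := by
    have := I.comp_left_mem f h
    simpa [rel, Preadditive.comp_sub] using this
  comp_right g h := by
    have := I.comp_right_mem g h
    simpa [rel, Preadditive.sub_comp] using this
  equivalence :=
    { refl := fun f => by simp [rel]
      symm := fun {f g} h => by
        have := (I.hom _ _).neg_mem h
        simpa [rel] using this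
      trans := fun {f g h} h₁ h₂ => by
        have := (I.hom _ _).add_mem h₁ h₂
        simpa [rel] using this }

/-- The quotient category `A/𝓘`: it has the objects of `A`, and morphism spaces
`Hom(X, Y)/𝓘(X, Y)`. -/
abbrev Quot (I : TensorIdeal k A) : Type u₁ := CategoryTheory.Quotient I.rel

instance (I : TensorIdeal k A) : Preadditive I.Quot :=
  CategoryTheory.Quotient.preadditive I.rel (fun _ _ f₁ f₂ g₁ g₂ h₁ h₂ => by
    have := (I.hom _ _).add_mem h₁ h₂
    simpa [rel, add_sub_add_comm] using this)

instance (I : TensorIdeal k A) : (CategoryTheory.Quotient.functor I.rel).Additive :=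
  CategoryTheory.Quotient.functor_additive I.rel _

instance (I : TensorIdeal k A) : Linear k I.Quot :=
  CategoryTheory.Quotient.linear k I.rel (fun a _ _ f₁ f₂ h => by
    have := (I.hom _ _).smul_mem a h
    simpa [rel, smul_sub] using this)

variable [MonoidalPreadditive A]

/-- Tensoring on the left with an object, as an endofunctor of the quotient category. -/
def quotTensorLeft (I : TensorIdeal k A) (X : A) : I.Quot ⥤ I.Quot :=
  CategoryTheory.Quotient.lift I.rel (tensorLeft X ⋙ CategoryTheory.Quotient.functor I.rel)
    (fun _ _ f g h => CategoryTheory.Quotient.sound I.rel (by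
      have := I.whiskerLeft_mem X h
      rwa [show X ◁ (f - g) = X ◁ f - X ◁ g from (tensorLeft X).map_sub] at this))

/-- Tensoring on the right with an object, as an endofunctor of the quotient category. -/
def quotTensorRight (I : TensorIdeal k A) (X : A) : I.Quot ⥤ I.Quot :=
  CategoryTheory.Quotient.lift I.rel (tensorRight X ⋙ CategoryTheory.Quotient.functor I.rel)
    (fun _ _ f g h => CategoryTheory.Quotient.sound I.rel (by
      have := I.whiskerRight_mem X h
      rwa [show (f - g) ▷ X = f ▷ X - g ▷ X from (tensorRight X).map_sub] at this))

instance (I : TensorIdeal k A) : MonoidalCategoryStruct I.Quot where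
  tensorObj X Y := ⟨X.as ⊗ Y.as⟩
  whiskerLeft X _ _ f := (I.quotTensorLeft X.as).map f
  whiskerRight f X := (I.quotTensorRight X.as).map f
  tensorUnit := ⟨𝟙_ A⟩
  associator X Y Z := (CategoryTheory.Quotient.functor I.rel).mapIso (α_ X.as Y.as Z.as)
  leftUnitor X := (CategoryTheory.Quotient.functor I.rel).mapIso (λ_ X.as)
  rightUnitor X := (CategoryTheory.Quotient.functor I.rel).mapIso (ρ_ X.as)

instance (I : TensorIdeal k A) : MonoidalCategory I.Quot := by
  let Q := CategoryTheory.Quotient.functor I.rel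
  refine
    { tensorHom_def := fun _ _ => rfl
      id_tensorHom_id := ?_
      tensorHom_comp_tensorHom := ?_
      whiskerLeft_id := ?_
      id_whiskerRight := ?_
      associator_naturality := ?_
      leftUnitor_naturality := ?_
      rightUnitor_naturality := ?_
      pentagon := ?_
      triangle := ?_ }
  · rintro ⟨X⟩ ⟨Y⟩
    exact congrArg Q.map
      ((MonoidalCategory.tensorHom_def (𝟙 X) (𝟙 Y)).symm.trans (id_tensorHom_id X Y))
  · rintro ⟨_⟩ ⟨_⟩ ⟨_⟩ ⟨_⟩ ⟨_⟩ ⟨_⟩ ⟨f₁⟩ ⟨f₂⟩ ⟨g₁⟩ ⟨g₂⟩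
    have := tensorHom_comp_tensorHom f₁ f₂ g₁ g₂
    simp only [MonoidalCategory.tensorHom_def] at this
    exact congrArg Q.map this
  · rintro ⟨X⟩ ⟨Y⟩
    exact congrArg Q.map (whiskerLeft_id X Y)
  · rintro ⟨X⟩ ⟨Y⟩
    exact congrArg Q.map (id_whiskerRight X Y)
  · rintro ⟨_⟩ ⟨_⟩ ⟨_⟩ ⟨_⟩ ⟨_⟩ ⟨_⟩ ⟨f₁⟩ ⟨f₂⟩ ⟨f₃⟩
    have := associator_naturality f₁ f₂ f₃
    simp only [MonoidalCategory.tensorHom_def] at this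
    exact congrArg Q.map this
  · rintro ⟨_⟩ ⟨_⟩ ⟨f⟩
    exact congrArg Q.map (leftUnitor_naturality f)
  · rintro ⟨_⟩ ⟨_⟩ ⟨f⟩
    exact congrArg Q.map (rightUnitor_naturality f)
  · rintro ⟨W⟩ ⟨X⟩ ⟨Y⟩ ⟨Z⟩
    exact congrArg Q.map (pentagon W X Y Z)
  · rintro ⟨X⟩ ⟨Y⟩
    exact congrArg Q.map (triangle X Y)

end General

end TensorIdeal

/-! ### Abelian envelopes -/

section Envelope

variable (k : Type u) [Field k]

/-- An exact `k`-linear functor. -/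
structure IsExactLinear {C : Type u₁} [Category.{v₁} C] [Preadditive C] [Linear k C]
    {D : Type u₂} [Category.{v₂} D] [Preadditive D] [Linear k D] (H : C ⥤ D) : Prop where
  additive : H.Additive
  linear : H.Linear k
  preservesFiniteLimits : PreservesFiniteLimits H
  preservesFiniteColimits : PreservesFiniteColimits H

/-- A right exact `k`-linear functor. -/
structure IsRightExactLinear {C : Type u₁} [Category.{v₁} C] [Preadditive C] [Linear k C]
    {D : Type u₂} [Category.{v₂} D] [Preadditive D] [Linear k D] (H : C ⥤ D) : Prop where
  additive : H.Additive
  linear : H.Linear k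
  preservesFiniteColimits : PreservesFiniteColimits H

/-- A tensor functor `F : A ⥤ C` to a tensor category `C` is an abelian envelope of `A` if it is
faithful and every faithful tensor functor from `A` to a tensor category `D` factors through `F` as
an exact tensor functor `C ⥤ D`, which is unique up to unique isomorphism. That is, composition
with `F` is an equivalence from the category of exact tensor functors `C ⥤ D` to that of faithful
tensor functors `A ⥤ D` (with monoidal natural transformations as morphisms): `factors` is
essential surjectivity and `unique` is full faithfulness. -/
structure IsAbelianEnvelope {A : Type u₁} [Category.{v₁} A] [Preadditive A] [Linear k A]
    [MonoidalCategory A] {C : TensorCat.{u, v₂, u₂} k} (F : A ⥤ C.carrier) [F.Monoidal] :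
    Prop where
  additive : F.Additive
  linear : F.Linear k
  faithful : F.Faithful
  factors : ∀ (D : TensorCat.{u, v, w} k) (G : A ⥤ D.carrier) [G.Monoidal],
    G.Additive → G.Linear k → G.Faithful →
      ∃ (H : C.carrier ⥤ D.carrier) (_ : H.Monoidal) (e : F ⋙ H ≅ G),
        IsExactLinear k H ∧ NatTrans.IsMonoidal e.hom
  unique : ∀ (D : TensorCat.{u, v, w} k) (H H' : C.carrier ⥤ D.carrier) [H.Monoidal] [H'.Monoidal],
    IsExactLinear k H → IsExactLinear k H' →
      ∀ α : F ⋙ H ⟶ F ⋙ H', NatTrans.IsMonoidal α →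
        ∃! β : H ⟶ H', NatTrans.IsMonoidal β ∧ Functor.whiskerLeft F β = α

/-! ### The Deligne tensor product -/

/-- A bifunctor which is `k`-bilinear and right exact in each variable. -/
structure IsBilinearRightExact {A : Type u₁} [Category.{v₁} A] [Preadditive A] [Linear k A]
    {B : Type u₂} [Category.{v₂} B] [Preadditive B] [Linear k B]
    {E : Type u₃} [Category.{v₃} E] [Preadditive E] [Linear k E] (S : A × B ⥤ E) : Prop where
  left : ∀ Y : B, IsRightExactLinear k (Prod.sectL A Y ⋙ S)
  right : ∀ X : A, IsRightExactLinear k (Prod.sectR X B ⋙ S)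

/-- A bifunctor `T : A × B ⥤ P` exhibits the abelian category `P` as the Deligne tensor product
`A ⊠ B`: it is the universal `k`-bilinear bifunctor, right exact in each variable, to
`k`-linear abelian categories. That is, composition with `T` is an equivalence from the category of
right exact `k`-linear functors `P ⥤ E` to the category of such bifunctors `A × B ⥤ E`. -/
structure IsDeligneProduct {A : Type u₁} [Category.{v₁} A] [Preadditive A] [Linear k A]
    {B : Type u₂} [Category.{v₂} B] [Preadditive B] [Linear k B]
    {P : Type u₃} [Category.{v₃} P] [Abelian P] [Linear k P] (T : A × B ⥤ P) : Prop where
  isBilinearRightExact : IsBilinearRightExact k T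
  factors : ∀ (E : Type w) [Category.{v} E] [Abelian E] [Linear k E] (S : A × B ⥤ E),
    IsBilinearRightExact k S → ∃ H : P ⥤ E, IsRightExactLinear k H ∧ Nonempty (T ⋙ H ≅ S)
  unique : ∀ (E : Type w) [Category.{v} E] [Abelian E] [Linear k E] (H H' : P ⥤ E),
    IsRightExactLinear k H → IsRightExactLinear k H' →
      Function.Bijective (fun β : H ⟶ H' => Functor.whiskerLeft T β)

end Envelope

/-! ### The semisimplification of a category of representations -/

section Negligible

variable {k : Type u} [Field k] {G : Type v} [Group G]

/-- The linear map underlying a morphism of finite-dimensional representations. -/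
def FDRep.toLin {X Y : FDRep k G} (f : X ⟶ Y) : X →ₗ[k] Y := f.hom.hom.hom

lemma FDRep.toLin_comm {X Y : FDRep k G} (f : X ⟶ Y) (g : G) :
    FDRep.toLin f ∘ₗ X.ρ g = Y.ρ g ∘ₗ FDRep.toLin f := by
  have := f.comm g
  exact congrArg (fun h => h.hom.hom) this

/-- The partial trace `Hom(Y ⊗ Z, X ⊗ Z) → Hom(Y, X)` over `Z`. -/
def partialTrace (X Y Z : Type u) [AddCommGroup X] [Module k X] [AddCommGroup Y] [Module k Y]
    [AddCommGroup Z] [Module k Z] [FiniteDimensional k Y] [FiniteDimensional k Z] :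
    (TensorProduct k Y Z →ₗ[k] TensorProduct k X Z) →ₗ[k] (Y →ₗ[k] X) :=
  (TensorProduct.rid k (Y →ₗ[k] X)).toLinearMap ∘ₗ
    TensorProduct.map LinearMap.id (LinearMap.trace k Z) ∘ₗ
      (homTensorHomEquiv k Y Z X Z).symm.toLinearMap

lemma partialTrace_map {X Y Z : Type u} [AddCommGroup X] [Module k X] [AddCommGroup Y] [Module k Y]
    [AddCommGroup Z] [Module k Z] [FiniteDimensional k Y] [FiniteDimensional k Z]
    (a : Y →ₗ[k] X) (b : Z →ₗ[k] Z) :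
    partialTrace X Y Z (TensorProduct.map a b) = LinearMap.trace k Z b • a := by
  have : (homTensorHomEquiv k Y Z X Z).symm (TensorProduct.map a b) = TensorProduct.tmul k a b := by
    rw [LinearEquiv.symm_apply_eq]
    simp
  simp [partialTrace, this]

lemma tensorMap_induction {X Y Z : Type u} [AddCommGroup X] [Module k X] [AddCommGroup Y] [Module k Y]
    [AddCommGroup Z] [Module k Z] [FiniteDimensional k Y] [FiniteDimensional k Z]
    {P : (TensorProduct k Y Z →ₗ[k] TensorProduct k X Z) → Prop} (h0 : P 0)
    (hadd : ∀ a b, P a → P b → P (a + b))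
    (hmap : ∀ (a : Y →ₗ[k] X) (b : Z →ₗ[k] Z), P (TensorProduct.map a b)) (h) : P h := by
  obtain ⟨t, rfl⟩ := (homTensorHomEquiv k Y Z X Z).surjective h
  induction t using TensorProduct.induction_on with
  | zero => simpa using h0
  | tmul a b => simpa using hmap a b
  | add a b ha hb => rw [map_add]; exact hadd _ _ ha hb

lemma trace_partialTrace {X Y Z : Type u} [AddCommGroup X] [Module k X] [AddCommGroup Y]
    [Module k Y] [AddCommGroup Z] [Module k Z] [FiniteDimensional k X] [FiniteDimensional k Y]
    [FiniteDimensional k Z] (f : X →ₗ[k] Y) (h : TensorProduct k Y Z →ₗ[k] TensorProduct k X Z) :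
    LinearMap.trace k _ (h ∘ₗ TensorProduct.map f LinearMap.id) =
      LinearMap.trace k _ (partialTrace X Y Z h ∘ₗ f) := by
  induction h using tensorMap_induction with
  | h0 => simp
  | hadd a b ha hb => simp only [LinearMap.add_comp, map_add, ha, hb]
  | hmap a b =>
    rw [← TensorProduct.map_comp, partialTrace_map, LinearMap.trace_tensorProduct']
    simp [LinearMap.smul_comp, mul_comm]

lemma partialTrace_conj {X Y Z : Type u} [AddCommGroup X] [Module k X] [AddCommGroup Y]
    [Module k Y] [AddCommGroup Z] [Module k Z] [FiniteDimensional k X] [FiniteDimensional k Y]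
    [FiniteDimensional k Z] (x : X →ₗ[k] X) (y : Y →ₗ[k] Y) (z z' : Z →ₗ[k] Z)
    (hz : z' ∘ₗ z = LinearMap.id) (h : TensorProduct k Y Z →ₗ[k] TensorProduct k X Z) :
    partialTrace X Y Z (TensorProduct.map x z ∘ₗ h ∘ₗ TensorProduct.map y z') =
      x ∘ₗ partialTrace X Y Z h ∘ₗ y := by
  induction h using tensorMap_induction with
  | h0 => simp
  | hadd a b ha hb => simp only [LinearMap.add_comp, LinearMap.comp_add, map_add, ha, hb]
  | hmap a b =>
    rw [← TensorProduct.map_comp, ← TensorProduct.map_comp, partialTrace_map, partialTrace_map,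
      LinearMap.trace_comp_comm', LinearMap.comp_assoc, hz]
    simp [LinearMap.smul_comp, LinearMap.comp_smul]

/-- The partial trace of a morphism of representations. -/
def FDRep.partialTr (X Y Z : FDRep k G) (h : Y ⊗ Z ⟶ X ⊗ Z) : Y ⟶ X where
  hom := FGModuleCat.ofHom (partialTrace X Y Z (FDRep.toLin h))
  comm g := by
    have hZ : Z.ρ g⁻¹ ∘ₗ Z.ρ g = LinearMap.id := by
      rw [← Module.End.mul_eq_comp, ← map_mul, inv_mul_cancel, map_one]; rfl
    have hY : Y.ρ g⁻¹ ∘ₗ Y.ρ g = LinearMap.id := by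
      rw [← Module.End.mul_eq_comp, ← map_mul, inv_mul_cancel, map_one]; rfl
    have hYZ : (Y ⊗ Z).ρ g ∘ₗ (Y ⊗ Z).ρ g⁻¹ = LinearMap.id := by
      rw [← Module.End.mul_eq_comp, ← map_mul, mul_inv_cancel, map_one]; rfl
    have h₁ : (X ⊗ Z).ρ g ∘ₗ FDRep.toLin h ∘ₗ (Y ⊗ Z).ρ g⁻¹ = FDRep.toLin h := by
      rw [← LinearMap.comp_assoc, ← FDRep.toLin_comm, LinearMap.comp_assoc, hYZ]; rfl
    have h₂ := partialTrace_conj (X.ρ g) (Y.ρ g⁻¹) (Z.ρ g) (Z.ρ g⁻¹) hZ (FDRep.toLin h)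
    have h₃ : partialTrace X Y Z (FDRep.toLin h) =
        X.ρ g ∘ₗ partialTrace X Y Z (FDRep.toLin h) ∘ₗ Y.ρ g⁻¹ :=
      (congrArg (partialTrace X Y Z) h₁).symm.trans h₂
    have h₄ : partialTrace X Y Z (FDRep.toLin h) ∘ₗ Y.ρ g =
        X.ρ g ∘ₗ partialTrace X Y Z (FDRep.toLin h) := by
      conv_lhs => rw [h₃]
      rw [LinearMap.comp_assoc, LinearMap.comp_assoc, hY]; rfl
    ext x
    exact LinearMap.congr_fun h₄ x

lemma FDRep.trace_comm {X Y : FDRep k G} (f : X ⟶ Y) (g : Y ⟶ X) :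
    LinearMap.trace k X (FDRep.toLin (f ≫ g)) = LinearMap.trace k Y (FDRep.toLin (g ≫ f)) :=
  LinearMap.trace_comp_comm' (FDRep.toLin f) (FDRep.toLin g)

lemma FDRep.trace_whiskerRight {X Y : FDRep k G} (Z : FDRep k G) (f : X ⟶ Y)
    (h : Y ⊗ Z ⟶ X ⊗ Z) :
    LinearMap.trace k (X ⊗ Z : FDRep k G) (FDRep.toLin (f ▷ Z ≫ h)) =
      LinearMap.trace k X (FDRep.toLin (f ≫ FDRep.partialTr X Y Z h)) :=
  trace_partialTrace (FDRep.toLin f) (FDRep.toLin h)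

/-- The tensor ideal of negligible morphisms in the category of finite-dimensional representations
of a group: `f : X ⟶ Y` is negligible if `f ≫ g` has trace zero for every `g : Y ⟶ X`. -/
def negligible (k : Type u) [Field k] (G : Type v) [Group G] : TensorIdeal k (FDRep k G) where
  hom X Y :=
    { carrier := {f | ∀ g : Y ⟶ X, LinearMap.trace k X (FDRep.toLin (f ≫ g)) = 0}
      add_mem' := fun {a b} ha hb g => by
        have : FDRep.toLin ((a + b) ≫ g) = FDRep.toLin (a ≫ g) + FDRep.toLin (b ≫ g) := by
          rw [Preadditive.add_comp]; rfl
        rw [this, map_add, ha g, hb g, add_zero]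
      zero_mem' := fun g => by
        have : FDRep.toLin ((0 : X ⟶ Y) ≫ g) = 0 := by
          rw [zero_comp]; rfl
        rw [this, map_zero]
      smul_mem' := fun c a ha g => by
        have : FDRep.toLin ((c • a) ≫ g) = c • FDRep.toLin (a ≫ g) := by
          rw [Linear.smul_comp]; rfl
        rw [this, map_smul, ha g, smul_zero] }
  comp_left_mem f g hg h := by
    rw [Category.assoc, FDRep.trace_comm, Category.assoc]
    exact hg (h ≫ f)
  comp_right_mem g hf h := by
    rw [Category.assoc]
    exact hf (g ≫ h)
  whiskerLeft_mem Z X Y f hf h := by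
    have e : Z ◁ f ≫ h = (β_ Z X).hom ≫ f ▷ Z ≫ (β_ Z Y).inv ≫ h := by
      rw [← BraidedCategory.braiding_naturality_right_assoc]
      simp
    rw [e, FDRep.trace_comm, Category.assoc, FDRep.trace_whiskerRight]
    exact hf _
  whiskerRight_mem Z hf h := by
    rw [FDRep.trace_whiskerRight]
    exact hf _

end Negligible

/-! ### Representations of cyclic `p`-groups -/

section Cyclic

variable (k : Type u) [Field k] (p n : ℕ) [Fact p.Prime]

/-- The cyclic group of order `p ^ n`. -/
abbrev CyclicPGroup (p n : ℕ) : Type := Multiplicative (ZMod (p ^ n))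

/-- The category of finite-dimensional representations over `k` of the cyclic group of order
`p ^ n`. -/
abbrev RepCyclic (n : ℕ) : Type (u + 1) := FDRep k (CyclicPGroup p n)

/-- The semisimplification of the category of representations of the cyclic group of order `p ^ n`:
its quotient by the negligible morphisms. -/
abbrev SemisimpleRepCyclic (n : ℕ) : Type (u + 1) := (negligible k (CyclicPGroup p n)).Quot

/-- The element `x = σ - 1` of the group algebra, with `σ` the standard generator. -/
def cyclicX : MonoidAlgebra k (CyclicPGroup p n) :=
  MonoidAlgebra.of k (CyclicPGroup p n) (Multiplicative.ofAdd 1) - 1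

/-- The representation `J_i`: the quotient of the group algebra by the ideal generated by `x ^ i`,
where `x = σ - 1`. For `1 ≤ i ≤ p ^ n` and `k` of characteristic `p`, this is the indecomposable
representation of dimension `i`. -/
def cyclicJ (i : ℕ) : RepCyclic k p n :=
  FDRep.of (V := MonoidAlgebra k (CyclicPGroup p n) ⧸ Ideal.span {cyclicX k p n ^ i})
    ((Algebra.lmul k (MonoidAlgebra k (CyclicPGroup p n) ⧸
        Ideal.span {cyclicX k p n ^ i})).toMonoidHom.comp
      ((Ideal.Quotient.mk (Ideal.span {cyclicX k p n ^ i})).toMonoidHom.comp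
        (MonoidAlgebra.of k (CyclicPGroup p n))))

/-- The monomorphisms `𝟙 ⟶ J_{j+1}` if `j < p ^ n`, and no morphisms otherwise. -/
inductive SocleInclusion (j : ℕ) : MorphismProperty (RepCyclic k p n)
  | intro (hj : j < p ^ n) (f : 𝟙_ (RepCyclic k p n) ⟶ cyclicJ k p n (j + 1)) (hf : Mono f) :
      SocleInclusion j f

/-- The tensor ideal `𝓘_j` generated by a monomorphism `𝟙 ⟶ J_{j+1}` if `j < p ^ n`
(it is unique up to scalar), and the zero ideal if `j = p ^ n`. -/
def cyclicIdeal (j : ℕ) : TensorIdeal k (RepCyclic k p n) :=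
  TensorIdeal.span k (SocleInclusion k p n j)

end Cyclic

end

/-! ### Tensor categories: exactness, simplicity of the unit, tensor products of morphisms -/

noncomputable section

/-! Put `x = σ - 1`, so that representations are modules over `k[x]/(x^(p^n))`. By duality a tensor
ideal is determined by its morphisms `𝟙 ⟶ V` (`FDRep.hat_mem_iff`), that is, by vectors killed by
`x`. Maps from and to the modules `J_{d+1}` show that only the depth of such a vector matters, the
powers `x^d V` that contain it. Hence every tensor ideal is one step of a single filtration: for
some threshold `j ≤ p^n` it consists of the morphisms lying in `x^j Hom_k(X, Y)`
(`FDRep.exists_hasThreshold`).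

On a tensor product `x` acts as `x ⊗ 1 + 1 ⊗ x + x ⊗ x`. If `a ≥ 1` and `a + 1` is not a power of
`p`, some interior binomial coefficient of `a + 1` is nonzero in `k`, and then `f` of depth `a`
yields `f ⊗ f` of depth `a + 1` (`FDRep.isDeep_tensor_self`). A prime ideal therefore has a power of
`p` as threshold. Applied to identities, the same argument shows that a prime thick ideal `J` is
`Ob(𝓘_{p^m})`, with `p^m` the largest power of `p` below the threshold of the ideal of morphisms
factoring through `J`. The functions on the quotients `C_{p^m}` tell these thick ideals apart.

Conversely, for `H = C_{p^(n-m)}` inside `K = C_{p^n}` with quotient `G = C_{p^m}`, restrict to `H`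
and semisimplify. Elements of `H` act unipotently, hence trivially modulo negligible morphisms, so
the result carries an action of `G`. This is a tensor functor to `G`-equivariant objects of the
semisimplification, and its kernel has threshold `p^m`. So `𝓘_{p^m}` is of abelian type. In a tensor
category `Hom(X, Y) ⊗ Hom(U, V) → Hom(X ⊗ U, Y ⊗ V)` is injective (`tensorHomMap_injective`), so
abelian type implies faithfully prime, which implies prime, and the circle closes.

For the envelope, the representations projective relative to `H` have injective images in the
equivariant category, the functor is full on maps into them, and every equivariant object embeds in
such an image. A faithful tensor functor `G'` on the quotient then extends by sending the kernel of
`F(d)` to the kernel of `G'(d)` (`InjectiveCover.isAbelianEnvelope`). Finally an equivariant object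
is the cokernel of an endomorphism of the object induced from its underlying object, built from a
generator of `G`. This presentation forces and constructs factorizations of right exact bifunctors,
which is the universal property of the Deligne product (`isDeligneProduct_deligneTensor`). -/

lemma mem_or_mem_of_tmul_mem {k M N : Type*} [Field k] [AddCommGroup M] [Module k M]
    [AddCommGroup N] [Module k N] (I : Submodule k M) (J : Submodule k N) {f : M} {g : N}
    (h : TensorProduct.tmul k f g ∈
      LinearMap.range (TensorProduct.map I.subtype (LinearMap.id : N →ₗ[k] N)) ⊔
      LinearMap.range (TensorProduct.map (LinearMap.id : M →ₗ[k] M) J.subtype)) :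
    f ∈ I ∨ g ∈ J := by
  by_contra! hfg
  -- Functionals vanishing on `I` and `J` but not on `f` and `g`: their tensor product kills both
  -- summands and not `f ⊗ g`.
  obtain ⟨φ, hφ, hI⟩ := Submodule.exists_le_ker_of_notMem hfg.1
  obtain ⟨ψ, hψ, hJ⟩ := Submodule.exists_le_ker_of_notMem hfg.2
  let Φ := TensorProduct.map φ ψ
  have h1 : LinearMap.range (TensorProduct.map I.subtype (LinearMap.id : N →ₗ[k] N)) ⊔
      LinearMap.range (TensorProduct.map (LinearMap.id : M →ₗ[k] M) J.subtype) ≤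
      LinearMap.ker Φ := by
    rw [sup_le_iff, LinearMap.range_le_ker_iff, LinearMap.range_le_ker_iff]
    constructor
    · ext x y
      simp [Φ, LinearMap.mem_ker.1 (hI x.2)]
    · ext x y
      simp [Φ, LinearMap.mem_ker.1 (hJ y.2)]
  have h2 := congrArg (TensorProduct.lid k k) (LinearMap.mem_ker.1 (h1 h))
  simp [Φ, hφ, hψ] at h2

section RigidAbelian

variable {C : Type u₁} [Category.{v₁} C] [Abelian C] [MonoidalCategory C] [RigidCategory C]

instance (X : C) : (tensorLeft X).IsLeftAdjoint :=
  (tensorLeftAdjunction (ᘁX) X).isLeftAdjoint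

instance (X : C) : (tensorLeft X).IsRightAdjoint :=
  (tensorLeftAdjunction X (Xᘁ)).isRightAdjoint

instance (X : C) : (tensorRight X).IsLeftAdjoint :=
  (tensorRightAdjunction X (Xᘁ)).isLeftAdjoint

instance (X : C) : (tensorRight X).IsRightAdjoint :=
  (tensorRightAdjunction (ᘁX) X).isRightAdjoint

instance (X : C) : PreservesFiniteLimits (tensorLeft X) where
  preservesFiniteLimits _ := inferInstance

instance (X : C) : PreservesFiniteColimits (tensorLeft X) where
  preservesFiniteColimits _ := inferInstance

instance (X : C) : PreservesFiniteLimits (tensorRight X) where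
  preservesFiniteLimits _ := inferInstance

instance (X : C) : PreservesFiniteColimits (tensorRight X) where
  preservesFiniteColimits _ := inferInstance

instance mono_whiskerLeft (X : C) {Y Z : C} (f : Y ⟶ Z) [Mono f] : Mono (X ◁ f) :=
  inferInstanceAs (Mono ((tensorLeft X).map f))

instance epi_whiskerLeft (X : C) {Y Z : C} (f : Y ⟶ Z) [Epi f] : Epi (X ◁ f) :=
  inferInstanceAs (Epi ((tensorLeft X).map f))

instance mono_whiskerRight (X : C) {Y Z : C} (f : Y ⟶ Z) [Mono f] : Mono (f ▷ X) :=
  inferInstanceAs (Mono ((tensorRight X).map f))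

instance epi_whiskerRight (X : C) {Y Z : C} (f : Y ⟶ Z) [Epi f] : Epi (f ▷ X) :=
  inferInstanceAs (Epi ((tensorRight X).map f))

instance mono_tensorHom {X Y U V : C} (f : X ⟶ Y) (g : U ⟶ V) [Mono f] [Mono g] :
    Mono (f ⊗ₘ g) := by
  rw [MonoidalCategory.tensorHom_def]
  infer_instance

variable [MonoidalPreadditive C]

/-- If `K ⊗ K = 0`, exactness makes `K ⊗ 𝟙 ⟶ K ⊗ 𝟙/K` a monomorphism. Followed by the monomorphism
`i ⊗ 𝟙/K` it becomes `K ⟶ 𝟙 ⟶ 𝟙/K`, which is zero. -/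
lemma isZero_of_tensor_self {K : C} (i : K ⟶ 𝟙_ C) [Mono i] (h : IsZero (K ⊗ K)) : IsZero K := by
  let S : ShortComplex C := ShortComplex.mk i (cokernel.π i) (cokernel.condition i)
  have hS : S.Exact := ShortComplex.exact_cokernel i
  have hS' : (S.map (tensorLeft K)).Exact := hS.map (tensorLeft K)
  have : Mono (K ◁ cokernel.π i) := by
    have h0 : (S.map (tensorLeft K)).f = 0 := h.eq_of_src _ _
    exact (ShortComplex.exact_iff_mono _ h0).1 hS'
  have key : (ρ_ K).inv ≫ K ◁ cokernel.π i ≫ i ▷ cokernel i = 0 := by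
    rw [whisker_exchange, ← rightUnitor_inv_naturality_assoc, id_whiskerLeft,
      ← unitors_inv_equal]
    simp
  have hm : Mono ((ρ_ K).inv ≫ K ◁ cokernel.π i ≫ i ▷ cokernel i) := inferInstance
  exact IsZero.of_mono_eq_zero _ key

omit [RigidCategory C] in
lemma coevaluation_ne_zero {U U' : C} [ExactPairing U U'] (hU : ¬ IsZero U) :
    η_ U U' ≠ 0 := by
  intro h
  apply hU
  rw [IsZero.iff_id_eq_zero]
  have := ExactPairing.evaluation_coevaluation U U'
  rw [h, MonoidalPreadditive.zero_whiskerRight, zero_comp] at this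
  have h2 : (λ_ U).inv ≫ ((λ_ U).hom ≫ (ρ_ U).inv) ≫ (ρ_ U).hom = 𝟙 U := by simp
  rw [← h2, ← this]
  simp

/-- This is simplicity of the unit. If the kernel `U` of `a` were nonzero, dualizing `i : U ⟶ 𝟙`
gives an epimorphism `w : 𝟙 ⟶ Uᘁ`, and `U ⊗ w : U ⟶ U ⊗ Uᘁ` is an isomorphism: its kernel `K ⊆ U`
satisfies `K ⊗ w = 0`, hence `K ⊗ i = 0` and `K ⊗ K = 0`. Then coevaluation gives a nonzero
endomorphism of `𝟙` through `U`, which is invertible and killed by `a`. -/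
lemma mono_of_unit (hk : ∀ f : 𝟙_ C ⟶ 𝟙_ C, f ≠ 0 → IsIso f) {Y : C} (a : 𝟙_ C ⟶ Y) (ha : a ≠ 0) :
    Mono a := by
  apply Preadditive.mono_of_isZero_kernel
  by_contra hU
  set U := kernel a
  let i : U ⟶ 𝟙_ C := kernel.ι a
  let w : 𝟙_ C ⟶ Uᘁ := @rightAdjointMate C _ _ U (𝟙_ C) _ hasRightDualUnit i
  have hw₁ : (ρ_ (𝟙_ C)).inv ≫ 𝟙_ C ◁ w = η_ U Uᘁ ≫ i ▷ Uᘁ :=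
    @coevaluation_comp_rightAdjointMate C _ _ U (𝟙_ C) _ hasRightDualUnit i
  have hw₂ : w ▷ U ≫ ε_ U Uᘁ = 𝟙_ C ◁ i ≫ (ρ_ (𝟙_ C)).hom :=
    @rightAdjointMate_comp_evaluation C _ _ U (𝟙_ C) _ hasRightDualUnit i
  have hi : Mono i := inferInstance
  have hw : Epi w := by
    refine Preadditive.epi_of_cancel_zero _ fun {Z} g hg => ?_
    have h1 : (η_ U Uᘁ ≫ U ◁ g) ≫ i ▷ Z = 0 := by
      rw [Category.assoc, whisker_exchange, ← Category.assoc, ← hw₁, Category.assoc,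
        ← MonoidalCategory.whiskerLeft_comp, hg]
      simp
    have h2 : η_ U Uᘁ ≫ U ◁ g = 0 := by
      rwa [← cancel_mono (i ▷ Z), zero_comp]
    have h3 := (tensorLeftHomEquiv (𝟙_ C) U Uᘁ Z).injective (a₁ := (ρ_ _).hom ≫ g) (a₂ := 0)
      (by
        simp only [tensorLeftHomEquiv, Equiv.coe_fn_mk]
        have : (ρ_ (𝟙_ C)).inv ≫ η_ U Uᘁ ▷ 𝟙_ C ≫ (α_ _ _ _).hom ≫ U ◁ ((ρ_ Uᘁ).hom ≫ g) =
            η_ U Uᘁ ≫ U ◁ g := by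
          simp
        have h4 : η_ U Uᘁ ▷ 𝟙_ C ≫ (α_ _ _ _).hom ≫ U ◁ ((ρ_ Uᘁ).hom ≫ g) = 0 := by
          rw [← cancel_epi (ρ_ (𝟙_ C)).inv, this, h2, comp_zero]
        simp only [unitors_inv_equal] at *
        simp [h2])
    rwa [← cancel_epi (ρ_ Uᘁ).hom, comp_zero]
  let e : U ⟶ U ⊗ Uᘁ := (ρ_ U).inv ≫ U ◁ w
  have he₁ : Epi e := inferInstance
  have he₂ : Mono e := by
    apply Preadditive.mono_of_isZero_kernel
    set K := kernel e
    let κ : K ⟶ U := kernel.ι e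
    have hκ : Mono κ := inferInstance
    have h1 : κ ≫ (ρ_ U).inv ≫ U ◁ w = 0 := kernel.condition e
    have h2 : K ◁ w = 0 := by
      rw [rightUnitor_inv_naturality_assoc, ← whisker_exchange] at h1
      rw [← cancel_mono (κ ▷ Uᘁ), ← cancel_epi (ρ_ K).inv, h1]
      simp
    have h3 : K ◁ i = 0 := by
      have h4 : K ◁ (w ▷ U) = 0 := by
        rw [← cancel_epi (α_ _ _ _).hom, ← associator_naturality_middle, h2]
        simp
      have h5 : K ◁ (w ▷ U ≫ ε_ U Uᘁ) = 0 := by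
        rw [MonoidalCategory.whiskerLeft_comp, h4, zero_comp]
      rw [hw₂] at h5
      have h6 : K ◁ i = K ◁ (λ_ U).inv ≫ K ◁ (𝟙_ C ◁ i ≫ (ρ_ (𝟙_ C)).hom) := by
        rw [← MonoidalCategory.whiskerLeft_comp, id_whiskerLeft, ← unitors_equal]
        simp
      rw [h6, h5, comp_zero]
    have hKU : IsZero (K ⊗ U) := by
      have : Mono (K ◁ i) := inferInstance
      exact IsZero.of_mono_eq_zero _ h3
    have hKK : IsZero (K ⊗ K) := by
      have : Mono (K ◁ κ) := inferInstance
      exact IsZero.of_mono (K ◁ κ) hKU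
    exact isZero_of_tensor_self (κ ≫ i) hKK
  have he : IsIso e := isIso_of_mono_of_epi e
  -- The nonzero endomorphism `𝟙 ⟶ U ⊗ Uᘁ ≅ U ⟶ 𝟙`; the part after coevaluation is a monomorphism.
  have h7 : η_ U Uᘁ ≫ inv e ≫ i ≠ 0 := by
    intro h
    apply coevaluation_ne_zero (U := U) (U' := Uᘁ) hU
    rw [← cancel_mono (inv e ≫ i), zero_comp, h]
  have h8 := hk _ h7
  have h9 : (η_ U Uᘁ ≫ inv e ≫ i) ≫ a = 0 := by
    simp [i, U, kernel.condition]
  apply ha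
  rwa [← cancel_epi (η_ U Uᘁ ≫ inv e ≫ i), comp_zero]

variable {k : Type u} [Field k] [Linear k C] [MonoidalLinear k C]

-- Induction on the number of terms: divide `Z` by the image of one `a i₀`, a copy of the unit. The
-- other `a i` stay independent, because a combination that dies in the quotient factors through `a
-- i₀` and is a scalar multiple of it.
omit [MonoidalLinear k C] in
lemma eq_zero_of_sum_unit_tensor_eq_zero
    (hk : Function.Bijective (fun c : k => c • 𝟙 (𝟙_ C))) {ι : Type*} (s : Finset ι) {U V : C} :
    ∀ {Z : C} (a : ι → (𝟙_ C ⟶ Z)), LinearIndepOn k a s → ∀ g : ι → (U ⟶ V),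
      ∑ i ∈ s, (a i ⊗ₘ g i) = 0 → ∀ i ∈ s, g i = 0 := by
  classical
  have hiso : ∀ f : 𝟙_ C ⟶ 𝟙_ C, f ≠ 0 → IsIso f := by
    intro f hf
    obtain ⟨c, rfl⟩ := hk.2 f
    have hc : c ≠ 0 := by
      rintro rfl
      exact hf (by simp)
    exact ⟨c⁻¹ • 𝟙 _, by simp [smul_smul, hc], by simp [smul_smul, hc]⟩
  induction s using Finset.induction_on with
  | empty => simp
  | insert i₀ s hi₀ ih =>
    intro Z a ha g hg
    have ha₀ : a i₀ ≠ 0 := ha.ne_zero (by simp)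
    have hm := mono_of_unit hiso (a i₀) ha₀
    let c := cokernel.π (a i₀)
    have hc : a i₀ ≫ c = 0 := cokernel.condition _
    have hind : LinearIndepOn k (fun i => a i ≫ c) (s : Set ι) := by
      rw [linearIndepOn_finset_iff]
      intro l hl i hi
      have h0 : (∑ i ∈ s, l i • a i) ≫ c = 0 := by
        rw [Preadditive.sum_comp, ← hl]
        simp
      let S : ShortComplex C := ShortComplex.mk (a i₀) c hc
      have hS : S.Exact := ShortComplex.exact_cokernel (a i₀)
      have : Mono S.f := hm
      obtain ⟨μ, hμ⟩ := hk.2 (hS.lift _ h0)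
      have h1 : (∑ i ∈ s, l i • a i) = μ • a i₀ := by
        have h2 := hS.lift_f _ h0
        rw [← hμ] at h2
        rw [← h2]
        simp [S]
      rw [linearIndepOn_finset_iff] at ha
      have h3 := ha (fun j => if j = i₀ then -μ else l j) (by
        rw [Finset.sum_insert hi₀]
        have : ∑ j ∈ s, (if j = i₀ then -μ else l j) • a j = ∑ j ∈ s, l j • a j :=
          Finset.sum_congr rfl fun j hj => by
            rw [if_neg]
            rintro rfl
            exact hi₀ hj
        rw [this, h1]
        simp) i (Finset.mem_insert_of_mem hi)
      have h4 : i ≠ i₀ := by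
        rintro rfl
        exact hi₀ hi
      simpa [h4] using h3
    have hg' : ∑ i ∈ s, ((a i ≫ c) ⊗ₘ g i) = 0 := by
      have h5 : (∑ i ∈ insert i₀ s, (a i ⊗ₘ g i)) ≫ (c ▷ V) = 0 := by rw [hg, zero_comp]
      rw [Finset.sum_insert hi₀, Preadditive.add_comp, Preadditive.sum_comp] at h5
      have h6 : ∀ i, (a i ⊗ₘ g i) ≫ c ▷ V = (a i ≫ c) ⊗ₘ g i := by
        intro i
        rw [← tensorHom_id, tensorHom_comp_tensorHom, Category.comp_id]
      simp only [h6, hc] at h5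
      rw [← h5]
      simp [MonoidalCategory.tensorHom_def]
    have h7 := ih _ hind g hg'
    have h8 : g i₀ = 0 := by
      rw [Finset.sum_insert hi₀, Finset.sum_eq_zero (fun i hi => by
        simp [h7 i hi, MonoidalCategory.tensorHom_def]), add_zero,
        MonoidalCategory.tensorHom_def'] at hg
      have h9 : 𝟙_ C ◁ g i₀ = 0 := by rwa [← cancel_mono (a i₀ ▷ V), zero_comp]
      rw [id_whiskerLeft] at h9
      rw [← cancel_mono (λ_ V).inv, ← cancel_epi (λ_ U).hom, h9]
      simp
    intro i hi
    rcases Finset.mem_insert.1 hi with rfl | hi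
    · exact h8
    · exact h7 i hi

/-- Expand the first factor in a basis and move `X` across by duality. The basis of `Hom(X, Y)`
becomes an independent family of morphisms `𝟙 ⟶ ᘁX ⊗ Y`. -/
lemma tensorHomMap_injective (hk : Function.Bijective (fun c : k => c • 𝟙 (𝟙_ C)))
    (X Y U V : C) : Function.Injective (TensorIdeal.tensorHomMap k X Y U V) := by
  classical
  rw [injective_iff_map_eq_zero]
  intro t ht
  let b := Module.Basis.ofVectorSpace k (X ⟶ Y)
  let E := TensorProduct.equivFinsuppOfBasisLeft (N := (U ⟶ V)) b
  obtain ⟨n, rfl⟩ := E.symm.surjective t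
  have hn : E.symm n = n.sum fun i m => TensorProduct.tmul k (b i) m :=
    TensorProduct.equivFinsuppOfBasisLeft_symm_apply b n
  let h : (X ⟶ Y) →ₗ[k] (𝟙_ C ⟶ (ᘁX) ⊗ Y) :=
    { toFun f := η_ (ᘁX) X ≫ (ᘁX) ◁ f
      map_add' f g := by simp
      map_smul' c f := by simp }
  have hinj : Function.Injective h := by
    intro f g hfg
    have := (tensorLeftHomEquiv (𝟙_ C) (ᘁX) X Y).injective (a₁ := (ρ_ X).hom ≫ f)
      (a₂ := (ρ_ X).hom ≫ g) (by
        have hfg' : η_ (ᘁX) X ≫ (ᘁX) ◁ f = η_ (ᘁX) X ≫ (ᘁX) ◁ g := hfg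
        simp [tensorLeftHomEquiv, hfg'])
    rwa [cancel_epi] at this
  have hindep : LinearIndepOn k (fun i => h (b i)) (n.support : Set _) :=
    (b.linearIndependent.map' h (LinearMap.ker_eq_bot.2 hinj)).linearIndepOn _
  have hsum : ∑ i ∈ n.support, (h (b i) ⊗ₘ n i) = 0 := by
    rw [hn, Finsupp.sum, map_sum] at ht
    have ht' : ∑ i ∈ n.support, (b i ⊗ₘ n i) = 0 := ht
    have key : ∀ (f : X ⟶ Y) (g : U ⟶ V), h f ⊗ₘ g =
        η_ (ᘁX) X ▷ U ≫ (α_ _ _ _).hom ≫ (ᘁX) ◁ (f ⊗ₘ g) ≫ (α_ _ _ _).inv := by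
      intro f g
      change (η_ (ᘁX) X ≫ (ᘁX) ◁ f) ⊗ₘ g = _
      simp [MonoidalCategory.tensorHom_def]
    simp only [key]
    rw [← Preadditive.comp_sum, ← Preadditive.comp_sum, ← Preadditive.sum_comp,
      ← whiskerLeft_sum, ht']
    simp
  have hz := eq_zero_of_sum_unit_tensor_eq_zero hk n.support _ hindep _ hsum
  have : n = 0 := by
    ext i
    by_cases hi : i ∈ n.support
    · simpa using hz i hi
    · simpa using hi
  simp [this]

lemma eq_zero_or_eq_zero_of_tensorHom_eq_zero
    (hk : Function.Bijective (fun c : k => c • 𝟙 (𝟙_ C))) {X Y U V : C} (f : X ⟶ Y) (g : U ⟶ V)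
    (h : f ⊗ₘ g = 0) : f = 0 ∨ g = 0 := by
  have h1 : TensorProduct.tmul k f g = 0 := by
    apply tensorHomMap_injective hk X Y U V
    rw [map_zero]
    exact h
  simpa using mem_or_mem_of_tmul_mem (k := k) ⊥ ⊥ (h1 ▸ Submodule.zero_mem _)

end RigidAbelian

end

/-! ### Tensor ideals of abelian type are faithfully prime -/

noncomputable section

namespace TensorIdeal

variable {k : Type u} [Field k] {A : Type u₁} [Category.{v₁} A] [Preadditive A] [Linear k A]
  [MonoidalCategory A] [MonoidalPreadditive A] [MonoidalLinear k A]

lemma IsFaithfullyPrime.isPrime {I : TensorIdeal k A} (h : I.IsFaithfullyPrime) : I.IsPrime := by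
  refine ⟨h.1, fun {X Y U V} f g hfg => ?_⟩
  apply mem_or_mem_of_tmul_mem (I.hom X Y) (I.hom U V)
  rw [← h.2 X Y U V]
  exact hfg

/-- By injectivity of the tensor map in the target, the preimage in question is the kernel of `F ⊗
F` on `Hom ⊗ Hom`. Over a field the kernel of a tensor product of linear maps is the expected sum.
-/
lemma IsAbelianType.isFaithfullyPrime {I : TensorIdeal k A} (h : I.IsAbelianType) :
    I.IsFaithfullyPrime := by
  obtain ⟨D, F, _, _, _, hF⟩ := h
  refine ⟨fun h1 => ?_, fun X Y U V => le_antisymm (fun t ht => ?_) ?_⟩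
  · have h2 := (hF _).1 h1
    rw [F.map_id] at h2
    have h3 : 𝟙 (𝟙_ D.carrier) = 0 := by
      have := (Functor.Monoidal.εIso F).hom ≫= (h2 =≫ (Functor.Monoidal.εIso F).inv)
      simpa using this
    have h4 := D.unit_bijective.1 (a₁ := 1) (a₂ := 0) (by simp [h3])
    exact one_ne_zero h4
  · let φ := F.mapLinearMap k (X := X) (Y := Y)
    let ψ := F.mapLinearMap k (X := U) (Y := V)
    have hφ : LinearMap.ker φ = I.hom X Y := by ext f; exact (hF f).symm
    have hψ : LinearMap.ker ψ = I.hom U V := by ext f; exact (hF f).symm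
    have h1 : TensorProduct.map φ ψ t = 0 := by
      apply tensorHomMap_injective D.unit_bijective
      rw [map_zero]
      have h2 : ∀ s, tensorHomMap k _ _ _ _ (TensorProduct.map φ ψ s) =
          Functor.LaxMonoidal.μ F X U ≫ F.map (tensorHomMap k X Y U V s) ≫
            Functor.OplaxMonoidal.δ F Y V := by
        intro s
        induction s using TensorProduct.induction_on with
        | zero => rw [map_zero, map_zero, map_zero, F.map_zero, zero_comp, comp_zero]
        | tmul f g =>
          change F.map f ⊗ₘ F.map g =
            Functor.LaxMonoidal.μ F X U ≫ F.map (f ⊗ₘ g) ≫ Functor.OplaxMonoidal.δ F Y V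
          rw [← Functor.LaxMonoidal.μ_natural_assoc, Functor.Monoidal.μ_δ, Category.comp_id]
        | add a b ha hb =>
          simp only [map_add, ha, hb, F.map_add, Preadditive.comp_add, Preadditive.add_comp]
      rw [h2, (hF _).1 ht, zero_comp, comp_zero]
    -- The kernel formula needs surjective maps, so `φ` and `ψ` are replaced by the quotients by
    -- their kernels; the remaining injective parts stay injective after tensoring over a field.
    let φ' := (LinearMap.ker φ).liftQ φ le_rfl
    let ψ' := (LinearMap.ker ψ).liftQ ψ le_rfl
    have hφ' : Function.Injective φ' := by
      rw [← LinearMap.ker_eq_bot, Submodule.ker_liftQ_eq_bot _ _ _ le_rfl]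
    have hψ' : Function.Injective ψ' := by
      rw [← LinearMap.ker_eq_bot, Submodule.ker_liftQ_eq_bot _ _ _ le_rfl]
    have h3 : TensorProduct.map φ ψ = TensorProduct.map φ' ψ' ∘ₗ
        TensorProduct.map (LinearMap.ker φ).mkQ (LinearMap.ker ψ).mkQ := by
      rw [← TensorProduct.map_comp]
      rfl
    have h4 : t ∈ LinearMap.ker
        (TensorProduct.map (LinearMap.ker φ).mkQ (LinearMap.ker ψ).mkQ) := by
      rw [h3] at h1
      exact (TensorProduct.map_injective_of_flat_flat _ _ hφ' hψ') (h1.trans (map_zero _).symm)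
    rw [TensorProduct.map_ker (f := (LinearMap.ker φ).subtype) (f' := (LinearMap.ker ψ).subtype)
      (LinearMap.exact_subtype_mkQ _) (Submodule.mkQ_surjective _)
      (LinearMap.exact_subtype_mkQ _) (Submodule.mkQ_surjective _), sup_comm] at h4
    rw [← hφ, ← hψ]
    exact h4
  · rw [sup_le_iff]
    constructor
    · rintro _ ⟨s, rfl⟩
      induction s using TensorProduct.induction_on with
      | zero => simp
      | tmul f g =>
        change f.1 ⊗ₘ g ∈ I.hom _ _
        rw [MonoidalCategory.tensorHom_def]
        exact I.comp_right_mem _ (I.whiskerRight_mem _ f.2)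
      | add a b ha hb =>
        rw [map_add]
        exact add_mem ha hb
    · rintro _ ⟨s, rfl⟩
      induction s using TensorProduct.induction_on with
      | zero => simp
      | tmul f g =>
        change f ⊗ₘ g.1 ∈ I.hom _ _
        rw [MonoidalCategory.tensorHom_def]
        exact I.comp_left_mem _ (I.whiskerLeft_mem _ g.2)
      | add a b ha hb =>
        rw [map_add]
        exact add_mem ha hb

end TensorIdeal

end

/-! ### A criterion for abelian envelopes -/

noncomputable section

open Functor.LaxMonoidal Functor.OplaxMonoidal

/-- A faithful tensor functor `F : A ⥤ C` together with a class of objects of `A`, stable under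
tensoring with arbitrary objects, on which `F` is full and takes injective values, and into the
images of which every object of `C` embeds. -/
structure InjectiveCover {A : Type u₁} [Category.{v₁} A] [MonoidalCategory A]
    {C : Type u₂} [Category.{v₂} C] [MonoidalCategory C] (F : A ⥤ C) (good : A → Prop) :
    Prop where
  injective : ∀ {a : A}, good a → Injective (F.obj a)
  full : ∀ {a : A}, good a → ∀ {b : A} (u : F.obj b ⟶ F.obj a), ∃ f : b ⟶ a, F.map f = u
  tensor_left : ∀ {a : A} (b : A), good a → good (b ⊗ a)
  tensor_right : ∀ {a : A} (b : A), good a → good (a ⊗ b)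
  embed : ∀ X : C, ∃ a : A, good a ∧ ∃ i : X ⟶ F.obj a, Mono i

namespace InjectiveCover

variable {A : Type u₁} [Category.{v₁} A] [Preadditive A] [MonoidalCategory A]
  {C : Type u₂} [Category.{v₂} C] [Abelian C] [MonoidalCategory C]
  {F : A ⥤ C} {good : A → Prop} (E : InjectiveCover F good)

/-! ### Copresentations of objects by good objects. -/

section Copresentation

/-- An object whose image under `F` contains `X`. -/
def emb (X : C) : A := (E.embed X).choose

omit [Preadditive A] [Abelian C] in
lemma emb_good (X : C) : good (E.emb X) := (E.embed X).choose_spec.1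

/-- The embedding of `X` into the image of a good object. -/
def ι (X : C) : X ⟶ F.obj (E.emb X) := (E.embed X).choose_spec.2.choose

instance (X : C) : Mono (E.ι X) := (E.embed X).choose_spec.2.choose_spec

omit [Preadditive A] in
lemma exists_cokernel_map {X : C} {a : A} (i : X ⟶ F.obj a) :
    ∃ d : a ⟶ E.emb (cokernel i), F.map d = cokernel.π i ≫ E.ι (cokernel i) :=
  E.full (E.emb_good _) _

/-- A morphism of good objects the image of which under `F` has kernel `i`. -/
def dOf {X : C} {a : A} (i : X ⟶ F.obj a) : a ⟶ E.emb (cokernel i) :=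
  (E.exists_cokernel_map i).choose

omit [Preadditive A] in
lemma map_dOf {X : C} {a : A} (i : X ⟶ F.obj a) :
    F.map (E.dOf i) = cokernel.π i ≫ E.ι (cokernel i) :=
  (E.exists_cokernel_map i).choose_spec

omit [Preadditive A] in
lemma comp_map_dOf {X : C} {a : A} (i : X ⟶ F.obj a) : i ≫ F.map (E.dOf i) = 0 := by
  rw [map_dOf, cokernel.condition_assoc, zero_comp]

omit [Preadditive A] in
lemma exact_dOf {X : C} {a : A} (i : X ⟶ F.obj a) :
    (ShortComplex.mk i (F.map (E.dOf i)) (E.comp_map_dOf i)).Exact := by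
  have h : (ShortComplex.mk i (cokernel.π i) (cokernel.condition i)).Exact :=
    ShortComplex.exact_cokernel i
  let φ : ShortComplex.mk i (cokernel.π i) (cokernel.condition i) ⟶
      ShortComplex.mk i (F.map (E.dOf i)) (E.comp_map_dOf i) :=
    { τ₁ := 𝟙 _
      τ₂ := 𝟙 _
      τ₃ := E.ι _
      comm₁₂ := by simp
      comm₂₃ := by simp [map_dOf] }
  have : Epi φ.τ₁ := inferInstanceAs (Epi (𝟙 _))
  have : IsIso φ.τ₂ := inferInstanceAs (IsIso (𝟙 _))
  have : Mono φ.τ₃ := inferInstanceAs (Mono (E.ι _))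
  exact (ShortComplex.exact_iff_of_epi_of_isIso_of_mono φ).1 h

include E

omit [Preadditive A] [Abelian C] in
lemma exists_lift {X : C} {a b : A} (i : X ⟶ F.obj a) [Mono i] (hb : good b) (u : X ⟶ F.obj b) :
    ∃ f : a ⟶ b, i ≫ F.map f = u := by
  have := E.injective hb
  obtain ⟨f, hf⟩ := E.full hb (Injective.factorThru u i)
  exact ⟨f, by rw [hf, Injective.comp_factorThru]⟩

-- Injectivity of `F.obj b` extends the map induced on the image of `F.map d`, fullness lifts it to
-- `A`, and faithfulness gives the identity in `A` itself, so that any functor on `A` sees it.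
omit [Preadditive A] in
lemma exists_desc [F.Faithful] {X : C} {a a' b : A} {i : X ⟶ F.obj a} {d : a ⟶ a'}
    {w : i ≫ F.map d = 0} (h : (ShortComplex.mk i (F.map d) w).Exact) (hb : good b) (f : a ⟶ b)
    (hf : i ≫ F.map f = 0) : ∃ e : a' ⟶ b, d ≫ e = f := by
  have := E.injective hb
  obtain ⟨e, he⟩ := E.full hb (h.descToInjective (F.map f) hf)
  exact ⟨e, F.map_injective (by rw [F.map_comp, he]; exact h.comp_descToInjective _ hf)⟩

end Copresentation

/-! ### Extension of a functor along an injective cover. -/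

section Extension

variable {D : Type u₃} [Category.{v₃} D] [Abelian D] (G : A ⥤ D)

/-- The value at `X` of the extension of `G` along `F`. -/
def extObj (X : C) : D := kernel (G.map (E.dOf (E.ι X)))

/-- The inclusion of `extObj` into the value of `G` at a good object. -/
def extι (X : C) : E.extObj G X ⟶ G.obj (E.emb X) := kernel.ι _

/-- The universal property of `extObj`. -/
def extLift {X : C} {T : D} (t : T ⟶ G.obj (E.emb X)) (ht : t ≫ G.map (E.dOf (E.ι X)) = 0) :
    T ⟶ E.extObj G X :=
  kernel.lift _ t ht

omit [Preadditive A] in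
lemma extLift_extι {X : C} {T : D} (t : T ⟶ G.obj (E.emb X))
    (ht : t ≫ G.map (E.dOf (E.ι X)) = 0) : E.extLift G t ht ≫ E.extι G X = t :=
  kernel.lift_ι _ _ _

omit [Preadditive A] in
lemma extLift_extι_assoc {X : C} {T : D} (t : T ⟶ G.obj (E.emb X))
    (ht : t ≫ G.map (E.dOf (E.ι X)) = 0) {Z : D} (h : G.obj (E.emb X) ⟶ Z) :
    E.extLift G t ht ≫ E.extι G X ≫ h = t ≫ h := by
  rw [← Category.assoc, extLift_extι]

instance (X : C) : Mono (E.extι G X) := inferInstanceAs (Mono (kernel.ι _))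

/-- The morphism from the extension of `G` induced by a morphism `X ⟶ F.obj b`. -/
def θ {X : C} {b : A} (hb : good b) (u : X ⟶ F.obj b) : E.extObj G X ⟶ G.obj b :=
  E.extι G X ≫ G.map (E.exists_lift (E.ι X) hb u).choose

variable [F.Additive] [F.Faithful] [G.Additive]

-- This makes `θ` independent of the lift chosen: a difference of two lifts kills `X`, hence factors
-- through the differential of the copresentation, which vanishes on the kernel defining `extObj`.
omit [Preadditive A] in
omit [F.Additive] [G.Additive] in
lemma extι_comp_map {X : C} {b : A} (hb : good b) (g : E.emb X ⟶ b) (hg : E.ι X ≫ F.map g = 0) :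
    E.extι G X ≫ G.map g = 0 := by
  obtain ⟨e, rfl⟩ := E.exists_desc (E.exact_dOf (E.ι X)) hb g hg
  rw [G.map_comp]
  exact kernel.condition_assoc _ _ |>.trans zero_comp

lemma θ_eq {X : C} {b : A} (hb : good b) (u : X ⟶ F.obj b) (f : E.emb X ⟶ b)
    (hf : E.ι X ≫ F.map f = u) : E.θ G hb u = E.extι G X ≫ G.map f := by
  have h := E.extι_comp_map G hb ((E.exists_lift (E.ι X) hb u).choose - f) (by
    rw [F.map_sub, Preadditive.comp_sub, (E.exists_lift (E.ι X) hb u).choose_spec, hf, sub_self])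
  rwa [G.map_sub, Preadditive.comp_sub, sub_eq_zero] at h

lemma θ_ι (X : C) : E.θ G (E.emb_good X) (E.ι X) = E.extι G X := by
  rw [E.θ_eq G _ _ (𝟙 _) (by simp)]
  simp

lemma θ_map {X : C} {b c : A} (hb : good b) (hc : good c) (u : X ⟶ F.obj b) (g : b ⟶ c) :
    E.θ G hb u ≫ G.map g = E.θ G hc (u ≫ F.map g) := by
  obtain ⟨f, rfl⟩ := E.exists_lift (E.ι X) hb u
  rw [E.θ_eq G hb _ f rfl, E.θ_eq G hc _ (f ≫ g) (by simp)]
  simp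

lemma θ_zero {X : C} {b : A} (hb : good b) : E.θ G hb (0 : X ⟶ F.obj b) = 0 := by
  rw [E.θ_eq G hb _ 0 (by simp)]
  simp

lemma θ_add {X : C} {b : A} (hb : good b) (u v : X ⟶ F.obj b) :
    E.θ G hb (u + v) = E.θ G hb u + E.θ G hb v := by
  obtain ⟨f, rfl⟩ := E.exists_lift (E.ι X) hb u
  obtain ⟨g, rfl⟩ := E.exists_lift (E.ι X) hb v
  rw [E.θ_eq G hb _ f rfl, E.θ_eq G hb _ g rfl, E.θ_eq G hb _ (f + g) (by simp)]
  simp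

lemma θ_smul {k : Type u} [Field k] [Linear k A] [Linear k C] [Linear k D] [F.Linear k]
    [G.Linear k] {X : C} {b : A} (hb : good b) (c : k) (u : X ⟶ F.obj b) :
    E.θ G hb (c • u) = c • E.θ G hb u := by
  obtain ⟨f, rfl⟩ := E.exists_lift (E.ι X) hb u
  rw [E.θ_eq G hb _ f rfl, E.θ_eq G hb _ (c • f) (by simp [F.map_smul])]
  simp [G.map_smul]

instance mono_θ {X : C} {b : A} (hb : good b) (u : X ⟶ F.obj b) [Mono u] : Mono (E.θ G hb u) := by
  obtain ⟨f, hf⟩ := E.exists_lift u (E.emb_good X) (E.ι X)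
  have h : E.θ G hb u ≫ G.map f = E.extι G X := by
    rw [E.θ_map G hb (E.emb_good X), hf, θ_ι]
  have : Mono (E.θ G hb u ≫ G.map f) := by
    rw [h]
    infer_instance
  exact mono_of_mono _ (G.map f)

/-- Any copresentation of `X` whose middle term is good computes the extension. The lifts `f` and
`f'` compare it with the chosen one, and `f ≫ f' - 𝟙` vanishes on `X`, so it factors through `d` and
disappears on `t`. -/
lemma exists_lift_θ {X : C} {a a' : A} (ha : good a) {i : X ⟶ F.obj a} [Mono i] {d : a ⟶ a'}
    {w : i ≫ F.map d = 0} (h : (ShortComplex.mk i (F.map d) w).Exact) {T : D} (t : T ⟶ G.obj a)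
    (ht : t ≫ G.map d = 0) : ∃ s : T ⟶ E.extObj G X, s ≫ E.θ G ha i = t := by
  obtain ⟨f, hf⟩ := E.exists_lift i (E.emb_good X) (E.ι X)
  obtain ⟨f', hf'⟩ := E.exists_lift (E.ι X) ha i
  obtain ⟨e, he⟩ := E.exists_desc h (E.emb_good _) (f ≫ E.dOf (E.ι X)) (by
    rw [F.map_comp, reassoc_of% hf, comp_map_dOf])
  obtain ⟨e', he'⟩ := E.exists_desc h ha (f ≫ f' - 𝟙 _) (by
    simp [reassoc_of% hf, hf'])
  refine ⟨E.extLift G (t ≫ G.map f) (by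
    rw [Category.assoc, ← G.map_comp, ← he, G.map_comp, reassoc_of% ht, zero_comp]), ?_⟩
  rw [E.θ_eq G ha i f' hf']
  have h1 : t ≫ G.map (f ≫ f' - 𝟙 _) = 0 := by
    rw [← he', G.map_comp, reassoc_of% ht, zero_comp]
  rw [G.map_sub, Preadditive.comp_sub, sub_eq_zero, G.map_id, Category.comp_id] at h1
  rw [extLift_extι_assoc, Category.assoc, ← G.map_comp, h1]

/-- The action on morphisms of the extension of `G` along `F`. -/
def extMap {X Y : C} (f : X ⟶ Y) : E.extObj G X ⟶ E.extObj G Y :=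
  E.extLift G (E.θ G (E.emb_good Y) (f ≫ E.ι Y)) (by
    rw [E.θ_map G _ (E.emb_good _), Category.assoc, comp_map_dOf, comp_zero, θ_zero])

lemma extMap_extι {X Y : C} (f : X ⟶ Y) :
    E.extMap G f ≫ E.extι G Y = E.θ G (E.emb_good Y) (f ≫ E.ι Y) :=
  E.extLift_extι _ _ _

lemma extMap_θ {X Y : C} (f : X ⟶ Y) {b : A} (hb : good b) (u : Y ⟶ F.obj b) :
    E.extMap G f ≫ E.θ G hb u = E.θ G hb (f ≫ u) := by
  obtain ⟨g, rfl⟩ := E.exists_lift (E.ι Y) hb u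
  rw [E.θ_eq G hb _ g rfl, reassoc_of% (E.extMap_extι G f), E.θ_map G _ hb, Category.assoc]

/-- The extension of `G` along `F`. -/
@[simps]
def ext : C ⥤ D where
  obj := E.extObj G
  map := E.extMap G
  map_id X := by
    rw [← cancel_mono (E.extι G X), extMap_extι, Category.id_comp, Category.id_comp, θ_ι]
  map_comp f g := by
    rw [← cancel_mono (E.extι G _), extMap_extι, Category.assoc, Category.assoc, extMap_extι,
      extMap_θ]

instance : (E.ext G).Additive where
  map_add {X Y f g} := by
    change E.extMap G (f + g) = E.extMap G f + E.extMap G g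
    rw [← cancel_mono (E.extι G _)]
    simp only [extMap_extι, Preadditive.add_comp, θ_add]

lemma ext_linear {k : Type u} [Field k] [Linear k A] [Linear k C] [Linear k D] [F.Linear k]
    [G.Linear k] : (E.ext G).Linear k where
  map_smul {X Y} f c := by
    change E.extMap G (c • f) = c • E.extMap G f
    rw [← cancel_mono (E.extι G _)]
    simp only [extMap_extι, Linear.smul_comp, θ_smul]

lemma mono_extMap {X Y : C} (f : X ⟶ Y) [Mono f] : Mono (E.extMap G f) := by
  have := E.injective (E.emb_good X)
  have h : E.extMap G f ≫ E.θ G (E.emb_good X) (Injective.factorThru (E.ι X) f) = E.extι G X := by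
    rw [extMap_θ, Injective.comp_factorThru, θ_ι]
  have : Mono (E.extMap G f ≫ E.θ G (E.emb_good X) (Injective.factorThru (E.ι X) f)) := by
    rw [h]
    infer_instance
  exact mono_of_mono _ (E.θ G (E.emb_good X) (Injective.factorThru (E.ι X) f))

/-- Left exactness: embedding `S.X₂` also embeds `S.X₁`, and the copresentation of `S.X₁` built on
that embedding computes its extension. -/
lemma exists_lift_extMap (S : ShortComplex C) (hS : S.Exact) [Mono S.f] {T : D}
    (t : T ⟶ E.extObj G S.X₂) (ht : t ≫ E.extMap G S.g = 0) :
    ∃ s : T ⟶ E.extObj G S.X₁, s ≫ E.extMap G S.f = t := by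
  let i := S.f ≫ E.ι S.X₂
  have hi : Mono i := mono_comp _ _
  obtain ⟨s, hs⟩ := E.exists_lift_θ G (E.emb_good _) (E.exact_dOf i) (t ≫ E.extι G S.X₂) (by
    rw [Category.assoc, ← θ_ι, E.θ_map G _ (E.emb_good _)]
    have h1 : S.f ≫ E.ι S.X₂ ≫ F.map (E.dOf i) = 0 := by
      rw [← Category.assoc, comp_map_dOf]
    have := E.injective (E.emb_good (cokernel i))
    -- The differential of that copresentation vanishes on `S.f`, so its restriction to `S.X₂`
    -- factors through `S.g`, which `t` kills.
    rw [← hS.comp_descToInjective (E.ι S.X₂ ≫ F.map (E.dOf i)) h1, ← extMap_θ, reassoc_of% ht,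
      zero_comp])
  refine ⟨s, ?_⟩
  rw [← cancel_mono (E.extι G _), Category.assoc, extMap_extι, hs]

lemma exact_map_ext (S : ShortComplex C) (hS : S.ShortExact) : (S.map (E.ext G)).Exact := by
  have := hS.mono_f
  rw [ShortComplex.exact_iff_exact_up_to_refinements]
  intro T t ht
  obtain ⟨s, hs⟩ := E.exists_lift_extMap G S hS.exact t ht
  exact ⟨T, 𝟙 T, inferInstance, s, (Category.id_comp t).trans hs.symm⟩

/-! ### Comparison of `G` with its extension restricted along `F`. -/

section Comparison

omit [Preadditive A] [Abelian C] in
omit [F.Additive] [F.Faithful] in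
/-- A lift to `A` of the embedding of `F.obj c`. -/
lemma exists_map_eq_ι (c : A) : ∃ f : c ⟶ E.emb (F.obj c), F.map f = E.ι (F.obj c) :=
  E.full (E.emb_good _) _

/-- The component at `c` of the comparison from `G` to its extension. -/
def toExtApp (c : A) : G.obj c ⟶ E.extObj G (F.obj c) :=
  E.extLift G (G.map (E.exists_map_eq_ι c).choose) (by
    have : (E.exists_map_eq_ι c).choose ≫ E.dOf (E.ι (F.obj c)) = 0 :=
      F.map_injective (by
        rw [F.map_comp, (E.exists_map_eq_ι c).choose_spec, comp_map_dOf, F.map_zero])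
    rw [← G.map_comp, this, G.map_zero])

lemma toExtApp_θ {c b : A} (hb : good b) (g : c ⟶ b) :
    E.toExtApp G c ≫ E.θ G hb (F.map g) = G.map g := by
  obtain ⟨h, hh⟩ := E.exists_lift (E.ι (F.obj c)) hb (F.map g)
  rw [E.θ_eq G hb _ h hh, toExtApp, extLift_extι_assoc, ← G.map_comp]
  congr 1
  apply F.map_injective
  rw [F.map_comp, (E.exists_map_eq_ι c).choose_spec, hh]

/-- The comparison from `G` to its extension. -/
def toExt : G ⟶ F ⋙ E.ext G where
  app := E.toExtApp G
  naturality {c c'} f := by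
    change G.map f ≫ E.toExtApp G c' = E.toExtApp G c ≫ E.extMap G (F.map f)
    obtain ⟨g, hg⟩ := E.exists_map_eq_ι c'
    rw [← cancel_mono (E.extι G _), Category.assoc, Category.assoc, extMap_extι, ← θ_ι, ← hg,
      toExtApp_θ, ← F.map_comp, toExtApp_θ, G.map_comp]

/-- For good `a` the identity of `F.obj a` is an admissible embedding. Its `θ` is a monomorphism and
a left inverse of the comparison. -/
lemma isIso_toExtApp_of_good {a : A} (ha : good a) : IsIso (E.toExtApp G a) := by
  have h : E.toExtApp G a ≫ E.θ G ha (𝟙 (F.obj a)) = 𝟙 _ := by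
    rw [← F.map_id, toExtApp_θ, G.map_id]
  exact ⟨_, h, by rw [← cancel_mono (E.θ G ha (𝟙 (F.obj a))), Category.assoc, h]; simp⟩

end Comparison

end Extension

end InjectiveCover

end

/-! ### The tensorator of the extension. -/

noncomputable section

open Functor.LaxMonoidal Functor.OplaxMonoidal

namespace InjectiveCover

/-- With exact tensor products, `ker α ⊗ ker β` is the intersection of `ker (α ⊗ B)` and `ker (A ⊗
β)`: lift first through `K ⊗ B`, then through `K ⊗ L`. -/
lemma exists_lift_tensor_kernel {D : Type u₃} [Category.{v₃} D] [Abelian D] [MonoidalCategory D]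
    [RigidCategory D] [MonoidalPreadditive D] {K L A A' B B' : D}
    {κ : K ⟶ A} {α : A ⟶ A'} {l : L ⟶ B} {β : B ⟶ B'} [Mono κ] [Mono l] (w : κ ≫ α = 0)
    (w' : l ≫ β = 0) (h : (ShortComplex.mk κ α w).Exact) (h' : (ShortComplex.mk l β w').Exact)
    {T : D} (t : T ⟶ A ⊗ B) (h₁ : t ≫ α ▷ B = 0) (h₂ : t ≫ A ◁ β = 0) :
    ∃ s : T ⟶ K ⊗ L, s ≫ (κ ⊗ₘ l) = t := by
  have e₁ := h.map (tensorRight B)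
  have : Mono ((ShortComplex.mk κ α w).map (tensorRight B)).f :=
    inferInstanceAs (Mono (κ ▷ B))
  obtain ⟨s₁, hs₁⟩ : ∃ s₁ : T ⟶ K ⊗ B, s₁ ≫ κ ▷ B = t := ⟨e₁.lift t h₁, e₁.lift_f t h₁⟩
  have e₂ := h'.map (tensorLeft K)
  have : Mono ((ShortComplex.mk l β w').map (tensorLeft K)).f :=
    inferInstanceAs (Mono (K ◁ l))
  have h₃ : s₁ ≫ K ◁ β = 0 := by
    rw [← cancel_mono (κ ▷ B'), Category.assoc, whisker_exchange, ← Category.assoc, hs₁, h₂,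
      zero_comp]
  obtain ⟨s₂, hs₂⟩ : ∃ s₂ : T ⟶ K ⊗ L, s₂ ≫ K ◁ l = s₁ := ⟨e₂.lift s₁ h₃, e₂.lift_f s₁ h₃⟩
  refine ⟨s₂, ?_⟩
  rw [MonoidalCategory.tensorHom_def', ← Category.assoc, hs₂, hs₁]

variable {A : Type u₁} [Category.{v₁} A] [Preadditive A] [MonoidalCategory A]
  {C : Type u₂} [Category.{v₂} C] [Abelian C] [MonoidalCategory C] [RigidCategory C]
  [MonoidalPreadditive C] {F : A ⥤ C} {good : A → Prop} (E : InjectiveCover F good)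
  {D : Type u₃} [Category.{v₃} D] [Abelian D] [MonoidalCategory D] [RigidCategory D]
  [MonoidalPreadditive D] (G : A ⥤ D) [F.Additive] [F.Faithful] [G.Additive]
  [F.Monoidal] [G.Monoidal]

omit [Preadditive A] in
omit [RigidCategory C] [MonoidalPreadditive C] [MonoidalCategory D] [RigidCategory D]
  [MonoidalPreadditive D] [F.Additive] [F.Faithful] [G.Additive] [F.Monoidal] [G.Monoidal] in
lemma extι_comp_map_dOf (X : C) : E.extι G X ≫ G.map (E.dOf (E.ι X)) = 0 :=
  kernel.condition _

omit [Preadditive A] in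
omit [RigidCategory C] [MonoidalPreadditive C] [MonoidalCategory D] [RigidCategory D]
  [MonoidalPreadditive D] [F.Additive] [F.Faithful] [G.Additive] [F.Monoidal] [G.Monoidal] in
lemma exact_extι (X : C) :
    (ShortComplex.mk (E.extι G X) (G.map (E.dOf (E.ι X))) (E.extι_comp_map_dOf G X)).Exact :=
  ShortComplex.exact_kernel _

instance mono_tens {X Y : C} {a b : A} (u : X ⟶ F.obj a) (v : Y ⟶ F.obj b) [Mono u] [Mono v] :
    Mono ((u ⊗ₘ v) ≫ μ F a b) :=
  mono_comp _ _

-- A morphism `h` from the tensor product of the two embedding objects that vanishes on `X ⊗ Y` is a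
-- sum of a morphism through the differential of `X` and one through the differential of `Y`. The
-- value of `G` on such a sum vanishes on the tensor product of the two kernels.
omit [RigidCategory D] in
lemma tensor_extι_comp_map {X Y : C} {c : A} (hc : good c) (h : E.emb X ⊗ E.emb Y ⟶ c)
    (hh : (E.ι X ⊗ₘ E.ι Y) ≫ μ F _ _ ≫ F.map h = 0) :
    (E.extι G X ⊗ₘ E.extι G Y) ≫ μ G _ _ ≫ G.map h = 0 := by
  have := E.injective hc
  have S₁ := (E.exact_dOf (E.ι Y)).map (tensorLeft X)
  have w₁ : X ◁ E.ι Y ≫ (E.ι X ▷ F.obj (E.emb Y) ≫ μ F _ _ ≫ F.map h) = 0 := by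
    rw [← hh, MonoidalCategory.tensorHom_def', Category.assoc]
  obtain ⟨v, hv⟩ : ∃ v : X ⊗ F.obj (E.emb (cokernel (E.ι Y))) ⟶ F.obj c,
      X ◁ F.map (E.dOf (E.ι Y)) ≫ v = E.ι X ▷ F.obj (E.emb Y) ≫ μ F _ _ ≫ F.map h :=
    ⟨S₁.descToInjective _ w₁, S₁.comp_descToInjective _ w₁⟩
  -- The restriction of `h` to `X ⊗ F(emb Y)` factors through the differential of `Y`; `e₂` extends
  -- that factor from `X` to its embedding object.
  obtain ⟨e₂, he₂⟩ := E.exists_lift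
    (E.ι X ▷ F.obj (E.emb (cokernel (E.ι Y))) ≫ μ F _ _) hc v
  have w₂ : (E.ι X ▷ F.obj (E.emb Y) ≫ μ F _ _) ≫ F.map (E.dOf (E.ι X) ▷ E.emb Y) = 0 := by
    rw [Category.assoc, ← μ_natural_left, ← comp_whiskerRight_assoc, comp_map_dOf]
    simp
  have S₂ : (ShortComplex.mk _ _ w₂).Exact := by
    let φ : (ShortComplex.mk _ _ (E.comp_map_dOf (E.ι X))).map (tensorRight (F.obj (E.emb Y))) ⟶
        ShortComplex.mk _ _ w₂ :=
      { τ₁ := 𝟙 _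
        τ₂ := μ F _ _
        τ₃ := μ F _ _
        comm₁₂ := Category.id_comp _
        comm₂₃ := (μ_natural_left F _ _).symm }
    have : Epi φ.τ₁ := inferInstanceAs (Epi (𝟙 _))
    have : IsIso φ.τ₂ := inferInstanceAs (IsIso (μ F _ _))
    have : Mono φ.τ₃ := inferInstanceAs (Mono (μ F _ _))
    exact (ShortComplex.exact_iff_of_epi_of_isIso_of_mono φ).1
      ((E.exact_dOf (E.ι X)).map (tensorRight (F.obj (E.emb Y))))
  -- After this correction the morphism vanishes on all of `X ⊗ F(emb Y)`, so it factors through the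
  -- differential of `X`.
  obtain ⟨e₁, he₁⟩ := E.exists_desc S₂ hc (h - E.emb X ◁ E.dOf (E.ι Y) ≫ e₂) (by
    rw [F.map_sub, Preadditive.comp_sub, sub_eq_zero, F.map_comp, Category.assoc, Category.assoc,
      ← reassoc_of% (μ_natural_right F (E.emb X) (E.dOf (E.ι Y))), ← whisker_exchange_assoc, ← hv,
      ← he₂, Category.assoc])
  have e₃ : h = E.dOf (E.ι X) ▷ E.emb Y ≫ e₁ + E.emb X ◁ E.dOf (E.ι Y) ≫ e₂ := by
    rw [he₁, sub_add_cancel]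
  have k₁ : (E.extι G X ⊗ₘ E.extι G Y) ≫ G.map (E.dOf (E.ι X)) ▷ G.obj (E.emb Y) = 0 := by
    rw [MonoidalCategory.tensorHom_def', Category.assoc, ← comp_whiskerRight, extι_comp_map_dOf]
    simp
  have k₂ : (E.extι G X ⊗ₘ E.extι G Y) ≫ G.obj (E.emb X) ◁ G.map (E.dOf (E.ι Y)) = 0 := by
    rw [MonoidalCategory.tensorHom_def, Category.assoc, ← MonoidalCategory.whiskerLeft_comp,
      extι_comp_map_dOf]
    simp
  rw [e₃, G.map_add, G.map_comp, G.map_comp, Preadditive.comp_add, Preadditive.comp_add,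
    ← reassoc_of% (μ_natural_left G (E.dOf (E.ι X)) (E.emb Y)),
    ← reassoc_of% (μ_natural_right G (E.emb X) (E.dOf (E.ι Y))), reassoc_of% k₁, reassoc_of% k₂]
  simp

omit [RigidCategory D] in
lemma exists_extμ (X Y : C) : ∃ s : E.extObj G X ⊗ E.extObj G Y ⟶ E.extObj G (X ⊗ Y),
    s ≫ E.θ G (E.tensor_right (E.emb Y) (E.emb_good X)) ((E.ι X ⊗ₘ E.ι Y) ≫ μ F _ _) =
      (E.extι G X ⊗ₘ E.extι G Y) ≫ μ G _ _ :=
  E.exists_lift_θ G _ (E.exact_dOf _) _ (by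
    rw [Category.assoc]
    apply E.tensor_extι_comp_map G (E.emb_good _)
    rw [← Category.assoc, comp_map_dOf])

/-- The tensorator of the extension of `G`. -/
def extμ (X Y : C) : E.extObj G X ⊗ E.extObj G Y ⟶ E.extObj G (X ⊗ Y) :=
  (E.exists_extμ G X Y).choose

omit [RigidCategory D] in
lemma extμ_θ {X Y : C} {a b : A} (ha : good a) (hb : good b) (hab : good (a ⊗ b))
    (u : X ⟶ F.obj a) (v : Y ⟶ F.obj b) :
    E.extμ G X Y ≫ E.θ G hab ((u ⊗ₘ v) ≫ μ F a b) =
      (E.θ G ha u ⊗ₘ E.θ G hb v) ≫ μ G a b := by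
  obtain ⟨f, rfl⟩ := E.exists_lift (E.ι X) ha u
  obtain ⟨g, rfl⟩ := E.exists_lift (E.ι Y) hb v
  have h : (E.ι X ≫ F.map f ⊗ₘ E.ι Y ≫ F.map g) ≫ μ F a b =
      ((E.ι X ⊗ₘ E.ι Y) ≫ μ F _ _) ≫ F.map (f ⊗ₘ g) := by
    rw [← tensorHom_comp_tensorHom, Category.assoc, Category.assoc, μ_natural]
  rw [h, ← E.θ_map G (E.tensor_right _ (E.emb_good X)) hab, ← Category.assoc, extμ,
    (E.exists_extμ G X Y).choose_spec, E.θ_eq G ha _ f rfl, E.θ_eq G hb _ g rfl,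
    ← tensorHom_comp_tensorHom, Category.assoc, Category.assoc, μ_natural]

/-- The inverse comes from the kernel description of `extObj G X ⊗ extObj G Y`: the embedding of
`extObj G (X ⊗ Y)` is killed by both differentials, each of which already vanishes on `X ⊗ Y`. -/
instance (X Y : C) : IsIso (E.extμ G X Y) := by
  let u := (E.ι X ⊗ₘ E.ι Y) ≫ μ F _ _
  let t := E.θ G (E.tensor_right (E.emb Y) (E.emb_good X)) u
  have hk : ∀ {c : A} (f : E.emb X ⊗ E.emb Y ⟶ c), good c → u ≫ F.map f = 0 →
      t ≫ G.map f = 0 := fun f hc hf => by rw [E.θ_map G _ hc, hf, θ_zero]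
  have h₁ : (t ≫ δ G _ _) ≫ G.map (E.dOf (E.ι X)) ▷ G.obj (E.emb Y) = 0 := by
    rw [Category.assoc, δ_natural_left, ← Category.assoc,
      hk _ (E.tensor_right _ (E.emb_good _)), zero_comp]
    rw [Category.assoc, ← μ_natural_left, ← Category.assoc, ← tensorHom_id,
      tensorHom_comp_tensorHom, comp_map_dOf]
    simp
  have h₂ : (t ≫ δ G _ _) ≫ G.obj (E.emb X) ◁ G.map (E.dOf (E.ι Y)) = 0 := by
    rw [Category.assoc, δ_natural_right, ← Category.assoc,
      hk _ (E.tensor_right _ (E.emb_good _)), zero_comp]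
    rw [Category.assoc, ← μ_natural_right, ← Category.assoc, ← id_tensorHom,
      tensorHom_comp_tensorHom, comp_map_dOf]
    simp
  obtain ⟨s, hs⟩ := exists_lift_tensor_kernel _ _ (E.exact_extι G X) (E.exact_extι G Y) _ h₁ h₂
  have h₃ : E.extμ G X Y ≫ t = (E.extι G X ⊗ₘ E.extι G Y) ≫ μ G _ _ :=
    (E.exists_extμ G X Y).choose_spec
  refine ⟨s, ?_, ?_⟩
  · rw [← cancel_mono (E.extι G X ⊗ₘ E.extι G Y), Category.assoc, hs, reassoc_of% h₃]
    simp
  · rw [← cancel_mono t, Category.assoc, h₃, reassoc_of% hs]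
    simp

omit [RigidCategory D] in
lemma extμ_natural {X Y X' Y' : C} (f : X ⟶ X') (g : Y ⟶ Y') :
    (E.extMap G f ⊗ₘ E.extMap G g) ≫ E.extμ G X' Y' = E.extμ G X Y ≫ E.extMap G (f ⊗ₘ g) := by
  have hab := E.tensor_right (E.emb Y') (E.emb_good X')
  rw [← cancel_mono (E.θ G hab ((E.ι X' ⊗ₘ E.ι Y') ≫ μ F _ _)), Category.assoc, Category.assoc,
    E.extμ_θ G (E.emb_good X') (E.emb_good Y'), extMap_θ]
  have h : (f ⊗ₘ g) ≫ (E.ι X' ⊗ₘ E.ι Y') ≫ μ F _ _ =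
      ((f ≫ E.ι X') ⊗ₘ (g ≫ E.ι Y')) ≫ μ F _ _ := by
    rw [tensorHom_comp_tensorHom_assoc]
  rw [h, E.extμ_θ G (E.emb_good X') (E.emb_good Y'), tensorHom_comp_tensorHom_assoc, extMap_θ,
    extMap_θ]

omit [RigidCategory D] in
lemma toExtApp_tensor (c c' : A) :
    (E.toExtApp G c ⊗ₘ E.toExtApp G c') ≫ E.extμ G (F.obj c) (F.obj c') ≫ E.extMap G (μ F c c') =
      μ G c c' ≫ E.toExtApp G (c ⊗ c') := by
  obtain ⟨f, hf⟩ := E.exists_map_eq_ι c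
  obtain ⟨f', hf'⟩ := E.exists_map_eq_ι c'
  have hab := E.tensor_right (E.emb (F.obj c')) (E.emb_good (F.obj c))
  have h : F.map (f ⊗ₘ f') = δ F _ _ ≫ (E.ι (F.obj c) ⊗ₘ E.ι (F.obj c')) ≫ μ F _ _ := by
    rw [← hf, ← hf', μ_natural, Functor.Monoidal.δ_μ_assoc]
  have hm : Mono (F.map (f ⊗ₘ f')) := by
    rw [h]
    infer_instance
  rw [← cancel_mono (E.θ G hab (F.map (f ⊗ₘ f')))]
  simp only [Category.assoc]
  rw [extMap_θ, toExtApp_θ, h, Functor.Monoidal.μ_δ_assoc,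
    E.extμ_θ G (E.emb_good _) (E.emb_good _), tensorHom_comp_tensorHom_assoc, ← hf, ← hf',
    toExtApp_θ, toExtApp_θ, μ_natural]

end InjectiveCover

end

/-! ### Right exactness and monoidal structure of the extension. -/

noncomputable section

open Functor.LaxMonoidal Functor.OplaxMonoidal

section Faithful

variable {D : Type u₃} [Category.{v₃} D] [Abelian D] [MonoidalCategory D] [RigidCategory D]
  [MonoidalPreadditive D] {k : Type u} [Field k] [Linear k D] [MonoidalLinear k D]

/-- Tensoring with a nonzero object is faithful, so it reflects monomorphisms and epimorphisms.
Statements about the extension can thus be checked after tensoring with a good object. -/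
lemma eq_zero_of_whiskerRight_eq_zero (hk : Function.Bijective (fun c : k => c • 𝟙 (𝟙_ D)))
    {X : D} (hX : ¬ IsZero X) {Y Z : D} {f : Y ⟶ Z} (h : f ▷ X = 0) : f = 0 := by
  rw [← tensorHom_id] at h
  refine (eq_zero_or_eq_zero_of_tensorHom_eq_zero hk _ _ h).resolve_right fun h' => ?_
  exact hX ((IsZero.iff_id_eq_zero X).2 h')

lemma epi_of_epi_whiskerRight (hk : Function.Bijective (fun c : k => c • 𝟙 (𝟙_ D)))
    {X : D} (hX : ¬ IsZero X) {Y Z : D} (f : Y ⟶ Z) [Epi (f ▷ X)] : Epi f :=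
  Preadditive.epi_of_cancel_zero _ fun g hg => by
    apply eq_zero_of_whiskerRight_eq_zero hk hX
    rw [← cancel_epi (f ▷ X), ← comp_whiskerRight, hg]
    simp

lemma mono_of_mono_whiskerRight (hk : Function.Bijective (fun c : k => c • 𝟙 (𝟙_ D)))
    {X : D} (hX : ¬ IsZero X) {Y Z : D} (f : Y ⟶ Z) [Mono (f ▷ X)] : Mono f :=
  Preadditive.mono_of_cancel_zero _ fun g hg => by
    apply eq_zero_of_whiskerRight_eq_zero hk hX
    rw [← cancel_mono (f ▷ X), ← comp_whiskerRight, hg]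
    simp

omit [Abelian D] [RigidCategory D] [MonoidalPreadditive D] [Linear k D] [MonoidalLinear k D] in
lemma unit_not_isZero [Preadditive D] [Linear k D]
    (hk : Function.Bijective (fun c : k => c • 𝟙 (𝟙_ D))) : ¬ IsZero (𝟙_ D) := fun h =>
  one_ne_zero (hk.1 (h.eq_of_src _ _) : (1 : k) = 0)

end Faithful

lemma leftUnitor_inv_comp_tensorHom_μ {A : Type u₁} [Category.{v₁} A] [MonoidalCategory A]
    {D : Type u₃} [Category.{v₃} D] [MonoidalCategory D] (G : A ⥤ D) [G.LaxMonoidal] {X : D}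
    {a o : A} (m : 𝟙_ A ⟶ o) (u : X ⟶ G.obj a) :
    (λ_ X).inv ≫ ((ε G ≫ G.map m) ⊗ₘ u) ≫ μ G o a = u ≫ G.map ((λ_ a).inv ≫ m ▷ a) := by
  rw [G.map_comp, ← left_unitality_inv, Category.assoc, Category.assoc, ← μ_natural_left,
    leftUnitor_inv_naturality_assoc, MonoidalCategory.tensorHom_def', comp_whiskerRight]
  simp only [Category.assoc]

lemma rightUnitor_inv_comp_tensorHom_μ {A : Type u₁} [Category.{v₁} A] [MonoidalCategory A]
    {D : Type u₃} [Category.{v₃} D] [MonoidalCategory D] (G : A ⥤ D) [G.LaxMonoidal] {X : D}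
    {a o : A} (m : 𝟙_ A ⟶ o) (u : X ⟶ G.obj a) :
    (ρ_ X).inv ≫ (u ⊗ₘ (ε G ≫ G.map m)) ≫ μ G a o = u ≫ G.map ((ρ_ a).inv ≫ a ◁ m) := by
  rw [G.map_comp, ← right_unitality_inv, Category.assoc, Category.assoc, ← μ_natural_right,
    rightUnitor_inv_naturality_assoc, MonoidalCategory.tensorHom_def,
    MonoidalCategory.whiskerLeft_comp]
  simp only [Category.assoc]

namespace InjectiveCover

variable {A : Type u₁} [Category.{v₁} A] [Preadditive A] [MonoidalCategory A]
  {C : Type u₂} [Category.{v₂} C] [Abelian C] [MonoidalCategory C] [RigidCategory C]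
  [MonoidalPreadditive C] {F : A ⥤ C} {good : A → Prop} (E : InjectiveCover F good)
  {D : Type u₃} [Category.{v₃} D] [Abelian D] [MonoidalCategory D] [RigidCategory D]
  [MonoidalPreadditive D] (G : A ⥤ D) [F.Additive] [F.Faithful] [G.Additive]
  [F.Monoidal] [G.Monoidal]

omit [RigidCategory C] [MonoidalPreadditive C] [MonoidalCategory D] [RigidCategory D]
  [MonoidalPreadditive D] [F.Faithful] [F.Monoidal] [G.Monoidal] in
include E in
lemma exists_good_not_isZero [G.Faithful] (h1 : ¬ IsZero (𝟙_ C)) :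
    ∃ a, good a ∧ ¬ IsZero (G.obj a) := by
  refine ⟨E.emb (𝟙_ C), E.emb_good _, fun h => h1 ?_⟩
  have h2 : 𝟙 (E.emb (𝟙_ C)) = 0 := G.map_injective (by
    rw [G.map_zero]
    exact h.eq_of_src _ _)
  have h3 : IsZero (F.obj (E.emb (𝟙_ C))) := by
    rw [IsZero.iff_id_eq_zero, ← F.map_id, h2, F.map_zero]
  exact IsZero.of_mono (E.ι _) h3

omit [Preadditive A] [Abelian C] in
omit [F.Additive] [F.Faithful] in
omit [RigidCategory C] [MonoidalPreadditive C] in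
include E in
lemma exists_extension_unit : ∃ (a : A) (_ : good a) (f : 𝟙_ A ⟶ a), Mono (ε F ≫ F.map f) := by
  obtain ⟨f, hf⟩ := E.exists_map_eq_ι (𝟙_ A)
  refine ⟨_, E.emb_good _, f, ?_⟩
  rw [hf]
  infer_instance

/-- The tensorator of the extension of `G`, as an isomorphism. -/
def extμIso (X Y : C) : (E.ext G).obj X ⊗ (E.ext G).obj Y ≅ (E.ext G).obj (X ⊗ Y) :=
  have : IsIso (E.extμ G X Y) := inferInstance
  @asIso _ _ _ _ (E.extμ G X Y) this

variable {k : Type u} [Field k] [Linear k D] [MonoidalLinear k D]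
  (hk : Function.Bijective (fun c : k => c • 𝟙 (𝟙_ D))) (h1 : ¬ IsZero (𝟙_ C)) [G.Faithful]

include hk h1

/-- Tensor with a good `o` such that `G.obj o` is nonzero. The comparison at `c ⊗ o` is invertible
because `c ⊗ o` is good, and tensoring with a nonzero object reflects isomorphisms. -/
lemma isIso_toExtApp (c : A) : IsIso (E.toExtApp G c) := by
  obtain ⟨o, ho, hGo⟩ := E.exists_good_not_isZero G h1
  have i₁ := E.isIso_toExtApp_of_good G ho
  have i₂ := E.isIso_toExtApp_of_good G (E.tensor_left c ho)
  have : IsIso (E.extMap G (μ F c o)) := inferInstanceAs (IsIso ((E.ext G).map (μ F c o)))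
  have i₃ : IsIso ((E.toExtApp G c ⊗ₘ E.toExtApp G o) ≫
      E.extμ G (F.obj c) (F.obj o) ≫ E.extMap G (μ F c o)) := by
    rw [E.toExtApp_tensor G c o]
    infer_instance
  have i₄ : IsIso (E.toExtApp G c ⊗ₘ E.toExtApp G o) := 
    IsIso.of_isIso_comp_right _ (E.extμ G (F.obj c) (F.obj o) ≫ E.extMap G (μ F c o))
  have i₅ : IsIso (E.toExtApp G c ▷ G.obj o) := by
    rw [MonoidalCategory.tensorHom_def] at i₄
    exact IsIso.of_isIso_comp_right _ (E.extObj G (F.obj c) ◁ E.toExtApp G o)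
  have := epi_of_epi_whiskerRight hk hGo (E.toExtApp G c)
  have := mono_of_mono_whiskerRight hk hGo (E.toExtApp G c)
  exact isIso_of_mono_of_epi _

/-- Tensoring with the injective object `F.obj o` makes the first term of the sequence injective, so
the sequence splits and every additive functor keeps the resulting epimorphism split. Tensoring with
a nonzero object reflects epimorphisms. -/
lemma epi_extMap (S : ShortComplex C) (hS : S.ShortExact) : Epi (E.extMap G S.g) := by
  obtain ⟨o, ho, hGo⟩ := E.exists_good_not_isZero G h1
  have i₁ := E.isIso_toExtApp_of_good G ho
  have := E.injective ho
  have := hS.mono_f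
  have := hS.epi_g
  have : Injective (S.X₁ ⊗ F.obj o) :=
    Injective.injective_of_adjoint (tensorLeftAdjunction S.X₁ (S.X₁ᘁ)) (F.obj o)
  have hS' : (S.map (tensorRight (F.obj o))).Exact := hS.exact.map _
  obtain ⟨r, hr⟩ : ∃ r : S.X₂ ⊗ F.obj o ⟶ S.X₁ ⊗ F.obj o, S.f ▷ F.obj o ≫ r = 𝟙 _ :=
    ⟨Injective.factorThru (𝟙 (S.X₁ ⊗ F.obj o)) (S.f ▷ F.obj o), Injective.comp_factorThru _ _⟩
  let s : (S.map (tensorRight (F.obj o))).Splitting :=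
    ShortComplex.Splitting.ofExactOfRetraction _ hS' r hr (epi_whiskerRight (F.obj o) S.g)
  obtain ⟨t, ht⟩ : ∃ t : S.X₃ ⊗ F.obj o ⟶ S.X₂ ⊗ F.obj o, t ≫ S.g ▷ F.obj o = 𝟙 _ :=
    ⟨s.s, s.s_g⟩
  have h2 : E.extMap G t ≫ E.extMap G (S.g ▷ F.obj o) = 𝟙 _ := by
    have := (E.ext G).congr_map ht
    rwa [(E.ext G).map_comp, (E.ext G).map_id] at this
  have : Epi (E.extMap G (S.g ▷ F.obj o)) := epi_of_epi_fac h2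
  have h3 := E.extμ_natural G S.g (𝟙 (F.obj o))
  rw [tensorHom_id] at h3
  have h4 : E.extMap G (𝟙 (F.obj o)) = 𝟙 _ := (E.ext G).map_id _
  rw [h4, tensorHom_id] at h3
  have i₂ : Epi (E.extMap G S.g ▷ E.extObj G (F.obj o)) := by
    have : E.extMap G S.g ▷ E.extObj G (F.obj o) =
        (E.extμ G S.X₂ (F.obj o) ≫ E.extMap G (S.g ▷ F.obj o)) ≫ inv (E.extμ G _ _) := by
      rw [← h3]
      simp
    rw [this]
    infer_instance
  exact epi_of_epi_whiskerRight hk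
    (fun h => hGo (h.of_iso (asIso (E.toExtApp G o)))) (E.extMap G S.g)

/-- The unit isomorphism of the extension of `G`. -/
def extε : 𝟙_ D ≅ E.extObj G (𝟙_ C) :=
  have := E.isIso_toExtApp G hk h1 (𝟙_ A)
  Functor.Monoidal.εIso G ≪≫ asIso (E.toExtApp G (𝟙_ A)) ≪≫
    (E.ext G).mapIso (Functor.Monoidal.εIso F).symm

lemma extε_hom_θ {a : A} (ha : good a) (f : 𝟙_ A ⟶ a) :
    (E.extε G hk h1).hom ≫ E.θ G ha (ε F ≫ F.map f) = ε G ≫ G.map f := by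
  change (ε G ≫ E.toExtApp G (𝟙_ A) ≫ E.extMap G (η F)) ≫ _ = _
  rw [Category.assoc, Category.assoc, extMap_θ, Functor.Monoidal.η_ε_assoc, toExtApp_θ]

/-- The monoidal structure on the extension of `G`. -/
def extCoreMonoidal : (E.ext G).CoreMonoidal where
  εIso := E.extε G hk h1
  μIso := E.extμIso G
  μIso_hom_natural_left {X Y} f X' := by
    have h := E.extμ_natural G f (𝟙 X')
    have h4 : E.extMap G (𝟙 X') = 𝟙 _ := (E.ext G).map_id _
    rwa [h4, tensorHom_id, tensorHom_id] at h
  μIso_hom_natural_right {X Y} X' f := by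
    have h := E.extμ_natural G (𝟙 X') f
    have h4 : E.extMap G (𝟙 X') = 𝟙 _ := (E.ext G).map_id _
    rwa [h4, id_tensorHom, id_tensorHom] at h
  associativity X Y Z := by
    change E.extμ G X Y ▷ E.extObj G Z ≫ E.extμ G (X ⊗ Y) Z ≫ E.extMap G (α_ X Y Z).hom =
      (α_ _ _ _).hom ≫ E.extObj G X ◁ E.extμ G Y Z ≫ E.extμ G X (Y ⊗ Z)
    have gX := E.emb_good X
    have gY := E.emb_good Y
    have gZ := E.emb_good Z
    have gXY := E.tensor_right (E.emb Y) gX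
    have gYZ := E.tensor_right (E.emb Z) gY
    have gX_YZ := E.tensor_right (E.emb Y ⊗ E.emb Z) gX
    have gXY_Z := E.tensor_right (E.emb Z) gXY
    -- The tensor product of the three embeddings gives a monomorphism into a value of `G`, where
    -- the identity becomes associativity of the tensorator of `G`. The unit axioms below are
    -- treated in the same way.
    rw [← cancel_mono (E.θ G gX_YZ
      ((E.ι X ⊗ₘ ((E.ι Y ⊗ₘ E.ι Z) ≫ μ F _ _)) ≫ μ F _ _))]
    simp only [Category.assoc]
    rw [E.extμ_θ G gX gYZ, extMap_θ]
    have h : (α_ X Y Z).hom ≫ (E.ι X ⊗ₘ (E.ι Y ⊗ₘ E.ι Z) ≫ μ F (E.emb Y) (E.emb Z)) ≫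
        μ F (E.emb X) (E.emb Y ⊗ E.emb Z) =
        ((((E.ι X ⊗ₘ E.ι Y) ≫ μ F _ _) ⊗ₘ E.ι Z) ≫ μ F _ _) ≫ F.map (α_ _ _ _).hom := by
      have e₁ : (E.ι X ⊗ₘ (E.ι Y ⊗ₘ E.ι Z) ≫ μ F (E.emb Y) (E.emb Z)) =
          (E.ι X ⊗ₘ (E.ι Y ⊗ₘ E.ι Z)) ≫ F.obj (E.emb X) ◁ μ F (E.emb Y) (E.emb Z) := by
        rw [← id_tensorHom, tensorHom_comp_tensorHom, Category.comp_id]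
      have e₂ : (((E.ι X ⊗ₘ E.ι Y) ≫ μ F _ _) ⊗ₘ E.ι Z) =
          ((E.ι X ⊗ₘ E.ι Y) ⊗ₘ E.ι Z) ≫ μ F (E.emb X) (E.emb Y) ▷ F.obj (E.emb Z) := by
        rw [← tensorHom_id, tensorHom_comp_tensorHom, Category.comp_id]
      rw [e₁, e₂, Category.assoc, Category.assoc, Category.assoc,
        Functor.LaxMonoidal.associativity, ← associator_naturality_assoc]
    rw [h, ← E.θ_map G gXY_Z gX_YZ, reassoc_of% (E.extμ_θ G gXY gZ gXY_Z)]
    have e₃ : E.extμ G X Y ▷ E.extObj G Z ≫ (E.θ G gXY ((E.ι X ⊗ₘ E.ι Y) ≫ μ F _ _) ⊗ₘ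
        E.θ G gZ (E.ι Z)) = ((E.extι G X ⊗ₘ E.extι G Y) ⊗ₘ E.extι G Z) ≫
          μ G (E.emb X) (E.emb Y) ▷ G.obj (E.emb Z) := by
      rw [← tensorHom_id, tensorHom_comp_tensorHom, E.extμ_θ G gX gY, Category.id_comp,
        ← tensorHom_id, tensorHom_comp_tensorHom, Category.comp_id, θ_ι, θ_ι, θ_ι]
    have e₄ : E.extObj G X ◁ E.extμ G Y Z ≫ (E.θ G gX (E.ι X) ⊗ₘ
        E.θ G gYZ ((E.ι Y ⊗ₘ E.ι Z) ≫ μ F _ _)) = (E.extι G X ⊗ₘ (E.extι G Y ⊗ₘ E.extι G Z)) ≫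
          G.obj (E.emb X) ◁ μ G (E.emb Y) (E.emb Z) := by
      rw [← id_tensorHom, tensorHom_comp_tensorHom, E.extμ_θ G gY gZ, Category.id_comp,
        ← id_tensorHom, tensorHom_comp_tensorHom, Category.comp_id, θ_ι, θ_ι, θ_ι]
    rw [reassoc_of% e₃, reassoc_of% e₄, Functor.LaxMonoidal.associativity,
      associator_naturality_assoc]
  left_unitality X := by
    obtain ⟨o, ho, m, hm⟩ := E.exists_extension_unit
    have gX := E.emb_good X
    have goX := E.tensor_right (E.emb X) ho
    have e₁ := leftUnitor_inv_comp_tensorHom_μ F m (E.ι X)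
    have e₂ : Mono ((λ_ X).inv ≫ ((ε F ≫ F.map m) ⊗ₘ E.ι X) ≫ μ F _ _) := inferInstance
    change (λ_ (E.extObj G X)).hom = (E.extε G hk h1).hom ▷ E.extObj G X ≫
      E.extμ G (𝟙_ C) X ≫ E.extMap G (λ_ X).hom
    rw [← cancel_mono (E.θ G goX ((λ_ X).inv ≫ ((ε F ≫ F.map m) ⊗ₘ E.ι X) ≫ μ F _ _))]
    simp only [Category.assoc]
    rw [extMap_θ, Iso.hom_inv_id_assoc, E.extμ_θ G ho gX, θ_ι, e₁, E.θ_eq G goX _ _ rfl]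
    have e₃ : (E.extε G hk h1).hom ▷ E.extObj G X ≫ (E.θ G ho (ε F ≫ F.map m) ⊗ₘ E.extι G X) =
        ((ε G ≫ G.map m) ⊗ₘ E.extι G X) := by
      rw [← tensorHom_id, tensorHom_comp_tensorHom, E.extε_hom_θ G hk h1 ho, Category.id_comp]
    rw [reassoc_of% e₃, ← leftUnitor_inv_comp_tensorHom_μ G m (E.extι G X),
      Iso.hom_inv_id_assoc]
  right_unitality X := by
    obtain ⟨o, ho, m, hm⟩ := E.exists_extension_unit
    have gX := E.emb_good X
    have goX := E.tensor_left (E.emb X) ho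
    have e₁ := rightUnitor_inv_comp_tensorHom_μ F m (E.ι X)
    have e₂ : Mono ((ρ_ X).inv ≫ (E.ι X ⊗ₘ (ε F ≫ F.map m)) ≫ μ F _ _) := inferInstance
    change (ρ_ (E.extObj G X)).hom = E.extObj G X ◁ (E.extε G hk h1).hom ≫
      E.extμ G X (𝟙_ C) ≫ E.extMap G (ρ_ X).hom
    rw [← cancel_mono (E.θ G goX ((ρ_ X).inv ≫ (E.ι X ⊗ₘ (ε F ≫ F.map m)) ≫ μ F _ _))]
    simp only [Category.assoc]
    rw [extMap_θ, Iso.hom_inv_id_assoc, E.extμ_θ G gX ho, θ_ι, e₁, E.θ_eq G goX _ _ rfl]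
    have e₃ : E.extObj G X ◁ (E.extε G hk h1).hom ≫ (E.extι G X ⊗ₘ E.θ G ho (ε F ≫ F.map m)) =
        (E.extι G X ⊗ₘ (ε G ≫ G.map m)) := by
      rw [← id_tensorHom, tensorHom_comp_tensorHom, E.extε_hom_θ G hk h1 ho, Category.id_comp]
    rw [reassoc_of% e₃, ← rightUnitor_inv_comp_tensorHom_μ G m (E.extι G X),
      Iso.hom_inv_id_assoc]

end InjectiveCover

end

/-! ### Full faithfulness of restriction along the cover. -/

noncomputable section

open Functor.LaxMonoidal Functor.OplaxMonoidal

namespace InjectiveCover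

variable {A : Type u₁} [Category.{v₁} A] [Preadditive A] [MonoidalCategory A]
  {C : Type u₂} [Category.{v₂} C] [Abelian C] [MonoidalCategory C] {F : A ⥤ C} {good : A → Prop}
  (E : InjectiveCover F good) {D : Type u₃} [Category.{v₃} D] [Abelian D]
  {H H' : C ⥤ D} [H'.PreservesMonomorphisms] [H.Additive] [H'.Additive] [F.Additive]
  [PreservesFiniteLimits H'] [PreservesFiniteColimits H'] (α : F ⋙ H ⟶ F ⋙ H')

include E

-- Naturality along the embedding of `X` determines the component at `X`, since `H'` keeps the
-- embedding a monomorphism.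
omit [Preadditive A] [Abelian C] [Abelian D] [H.Additive] [H'.Additive] [F.Additive]
  [PreservesFiniteLimits H'] [PreservesFiniteColimits H'] in
lemma natTrans_ext [F.Faithful] {β β' : H ⟶ H'}
    (h : Functor.whiskerLeft F β = Functor.whiskerLeft F β') : β = β' := by
  ext X
  rw [← cancel_mono (H'.map (E.ι X)), ← β.naturality, ← β'.naturality]
  congr 1
  exact NatTrans.congr_app h (E.emb X)

-- Exactness of `H'` presents `H'.obj X` as a kernel of a morphism between values of `F ⋙ H'`, where
-- `α` is defined and natural.
omit [Preadditive A] in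
omit [F.Additive] in
lemma exists_natTrans_app (X : C) : ∃ b : H.obj X ⟶ H'.obj X,
    b ≫ H'.map (E.ι X) = H.map (E.ι X) ≫ α.app (E.emb X) := by
  have hS := (E.exact_dOf (E.ι X)).map H'
  have : Mono ((ShortComplex.mk _ _ (E.comp_map_dOf (E.ι X))).map H').f :=
    inferInstanceAs (Mono (H'.map (E.ι X)))
  have h : (H.map (E.ι X) ≫ α.app (E.emb X)) ≫ H'.map (F.map (E.dOf (E.ι X))) = 0 := by
    have := α.naturality (E.dOf (E.ι X))
    rw [Category.assoc]
    erw [← this]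
    change H.map (E.ι X) ≫ H.map (F.map (E.dOf (E.ι X))) ≫ _ = 0
    rw [← H.map_comp_assoc, comp_map_dOf, H.map_zero, zero_comp]
  exact ⟨hS.lift _ h, hS.lift_f _ h⟩

omit [Preadditive A] in
omit [F.Additive] in
lemma exists_natTrans [F.Faithful] : ∃ β : H ⟶ H', Functor.whiskerLeft F β = α := by
  let b := fun X => (E.exists_natTrans_app α X).choose
  have hb : ∀ X, b X ≫ H'.map (E.ι X) = H.map (E.ι X) ≫ α.app (E.emb X) := fun X =>
    (E.exists_natTrans_app α X).choose_spec
  have hα : ∀ {a a' : A} (f : a ⟶ a'), H.map (F.map f) ≫ α.app a' =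
    α.app a ≫ H'.map (F.map f) := fun f => α.naturality f
  refine ⟨{ app := b, naturality := fun X Y f => ?_ }, ?_⟩
  · obtain ⟨g, hg⟩ := E.exists_lift (E.ι X) (E.emb_good Y) (f ≫ E.ι Y)
    rw [← cancel_mono (H'.map (E.ι Y)), Category.assoc, Category.assoc, hb, ← H'.map_comp, ← hg,
      H'.map_comp, reassoc_of% (hb X), ← hα, ← H.map_comp_assoc, ← H.map_comp_assoc, hg]
  · ext c
    change b (F.obj c) = α.app c
    obtain ⟨f, hf⟩ := E.exists_map_eq_ι c
    have := hb (F.obj c)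
    rw [← cancel_mono (H'.map (E.ι (F.obj c))), this, ← hf, hα]

-- Both compatibilities are tested after embedding `X` and `Y`; the tensor product of the embeddings
-- is again a monomorphism.
omit [Preadditive A] [Abelian D] [H.Additive] [H'.Additive] [F.Additive]
  [PreservesFiniteLimits H'] [PreservesFiniteColimits H'] in
lemma isMonoidal_of_whiskerLeft [F.Faithful] [MonoidalCategory D] [F.Monoidal] [H.Monoidal]
    [H'.Monoidal] [RigidCategory C] [MonoidalPreadditive C] (β : H ⟶ H')
    (hα : NatTrans.IsMonoidal (Functor.whiskerLeft F β)) : NatTrans.IsMonoidal β where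
  unit := by
    have h := hα.unit
    simp only [Functor.LaxMonoidal.comp_ε, Functor.whiskerLeft_app, Category.assoc] at h
    rw [β.naturality, ← Category.assoc, cancel_mono] at h
    exact h
  tensor X Y := by
    have h := hα.tensor (E.emb X) (E.emb Y)
    simp only [Functor.LaxMonoidal.comp_μ, Functor.whiskerLeft_app, Category.assoc] at h
    rw [β.naturality, ← Category.assoc, ← Category.assoc, cancel_mono] at h
    have : Mono (E.ι X ⊗ₘ E.ι Y) := inferInstance
    rw [← cancel_mono (H'.map (E.ι X ⊗ₘ E.ι Y)), Category.assoc, ← β.naturality, Category.assoc,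
      ← μ_natural, ← reassoc_of% (μ_natural H (E.ι X) (E.ι Y)), h, tensorHom_comp_tensorHom_assoc,
      tensorHom_comp_tensorHom_assoc, β.naturality, β.naturality]

end InjectiveCover

/-- Existence is the extension by copresentations, which is exact, monoidal, and agrees with `G` on
`A`. Uniqueness holds because an exact functor on `C` is determined by its values on the images of
good objects. -/
theorem InjectiveCover.isAbelianEnvelope {k : Type u} [Field k] {A : Type u₁} [Category.{v₁} A]
    [Preadditive A] [Linear k A] [MonoidalCategory A] {C : TensorCat.{u, v₂, u₂} k}
    {F : A ⥤ C.carrier} [F.Monoidal] {good : A → Prop} (E : InjectiveCover F good)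
    (h₁ : F.Additive) (h₂ : F.Linear k) (h₃ : F.Faithful) :
    IsAbelianEnvelope.{u, v, w, v₁, u₁, v₂, u₂} k F where
  additive := h₁
  linear := h₂
  faithful := h₃
  factors D G _ hG₁ hG₂ hG₃ := by
    have h1 : ¬ IsZero (𝟙_ C.carrier) := unit_not_isZero C.unit_bijective
    have hk := D.unit_bijective
    let M := (E.extCoreMonoidal G hk h1).toMonoidal
    have : ∀ c, IsIso ((E.toExt G).app c) := fun c => E.isIso_toExtApp G hk h1 c
    have : IsIso (E.toExt G) := NatIso.isIso_of_isIso_app _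
    have hm : NatTrans.IsMonoidal (asIso (E.toExt G)).hom :=
      { unit := by
          change ε G ≫ E.toExtApp G (𝟙_ A) =
            (ε G ≫ E.toExtApp G (𝟙_ A) ≫ E.extMap G (η F)) ≫ E.extMap G (ε F)
          have : E.extMap G (η F) ≫ E.extMap G (ε F) = 𝟙 _ := by
            have := (E.ext G).congr_map (Functor.Monoidal.η_ε F)
            rwa [(E.ext G).map_comp, (E.ext G).map_id] at this
          rw [Category.assoc, Category.assoc, this, Category.comp_id]
        tensor := fun c c' => (E.toExtApp_tensor G c c').symm }
    have hadd : (E.ext G).Additive := inferInstance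
    have hS : ∀ S : ShortComplex C.carrier, S.ShortExact → (S.map (E.ext G)).ShortExact := fun S hS =>
      { exact := E.exact_map_ext G S hS
        mono_f := by
          have := hS.mono_f
          exact E.mono_extMap G S.f
        epi_g := E.epi_extMap G hk h1 S hS }
    -- An additive functor that preserves short exact sequences preserves finite limits and
    -- colimits.
    have hex := ((E.ext G).exact_tfae.out 0 3).1 hS
    exact ⟨E.ext G, M, (asIso (E.toExt G)).symm,
      { additive := hadd
        linear := E.ext_linear G
        preservesFiniteLimits := hex.1
        preservesFiniteColimits := hex.2 },
      inferInstanceAs (NatTrans.IsMonoidal (asIso (E.toExt G)).inv)⟩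
  unique D H H' _ _ hH hH' α hα := by
    have := hH.additive
    have := hH'.additive
    have := hH'.preservesFiniteLimits
    have := hH'.preservesFiniteColimits
    obtain ⟨β, rfl⟩ := E.exists_natTrans α
    exact ⟨β, ⟨E.isMonoidal_of_whiskerLeft β hα, rfl⟩, fun β' h => E.natTrans_ext h.2⟩

end

noncomputable section

/-! ### The quotient by a tensor ideal -/

lemma CategoryTheory.essentiallySmall_of_family {C : Type u₁} [Category.{v₁} C] [LocallySmall.{w} C]
    {ι : Type u₂} [Small.{w} ι] (f : ι → C) (h : ∀ X, ∃ i, Nonempty (f i ≅ X)) :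
    EssentiallySmall.{w} C := by
  rw [essentiallySmall_iff]
  refine ⟨small_of_surjective (f := fun i => toSkeleton (f i)) fun Y => ?_, inferInstance⟩
  obtain ⟨i, ⟨e⟩⟩ := h ((fromSkeleton C).obj Y)
  refine ⟨i, (_root_.Quotient.sound ⟨e⟩ : toSkeleton (f i) = _).trans ?_⟩
  exact _root_.Quotient.out_eq Y

namespace TensorIdeal

variable {k : Type u} [Field k] {A : Type u₁} [Category.{v₁} A] [Preadditive A] [Linear k A]
  [MonoidalCategory A]

/-- The quotient functor `A ⥤ A/𝓘`. -/
abbrev toQuot (I : TensorIdeal k A) : A ⥤ I.Quot := CategoryTheory.Quotient.functor I.rel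

instance (I : TensorIdeal k A) : I.toQuot.Linear k :=
  CategoryTheory.Quotient.linear_functor k I.rel (fun a _ _ f₁ f₂ h => by
    have := (I.hom _ _).smul_mem a h
    simpa [rel, smul_sub] using this)

lemma toQuot_map_eq_iff (I : TensorIdeal k A) {X Y : A} (f g : X ⟶ Y) :
    I.toQuot.map f = I.toQuot.map g ↔ f - g ∈ I.hom X Y :=
  CategoryTheory.Quotient.functor_map_eq_iff I.rel f g

lemma toQuot_map_eq_zero_iff (I : TensorIdeal k A) {X Y : A} (f : X ⟶ Y) :
    I.toQuot.map f = 0 ↔ f ∈ I.hom X Y := by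
  rw [← I.toQuot.map_zero X Y, toQuot_map_eq_iff, sub_zero]

instance (I : TensorIdeal k A) [HasZeroObject A] : HasZeroObject I.Quot :=
  I.toQuot.hasZeroObject_of_additive

instance (I : TensorIdeal k A) [HasBinaryBiproducts A] : HasBinaryBiproducts I.Quot where
  has_binary_biproduct X Y := by
    have := preservesBinaryBiproduct_of_preservesBiproduct I.toQuot X.as Y.as
    exact inferInstanceAs (HasBinaryBiproduct (I.toQuot.obj X.as) (I.toQuot.obj Y.as))

instance (I : TensorIdeal k A) [LocallySmall.{w} A] : LocallySmall.{w} I.Quot where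
  hom_small X Y := small_of_surjective (I.toQuot.map_surjective (X := X.as) (Y := Y.as))

instance (I : TensorIdeal k A) [EssentiallySmall.{w} A] : EssentiallySmall.{w} I.Quot := by
  refine essentiallySmall_of_family (fun X : Skeleton A => I.toQuot.obj ((fromSkeleton A).obj X))
    fun Y => ⟨toSkeleton Y.as, ⟨?_⟩⟩
  exact I.toQuot.mapIso (fromSkeletonToSkeletonIso Y.as)

variable [MonoidalPreadditive A]

instance toQuotMonoidal (I : TensorIdeal k A) : I.toQuot.Monoidal :=
  Functor.CoreMonoidal.toMonoidal
    { εIso := Iso.refl _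
      μIso := fun _ _ => Iso.refl _
      μIso_hom_natural_left := fun _ _ => (Category.comp_id _).trans (Category.id_comp _).symm
      μIso_hom_natural_right := fun _ _ => (Category.comp_id _).trans (Category.id_comp _).symm
      associativity := fun X Y Z => congrArg I.toQuot.map (by
        simp : 𝟙 (X ⊗ Y) ▷ Z ≫ 𝟙 _ ≫ (α_ X Y Z).hom = (α_ X Y Z).hom ≫ X ◁ 𝟙 (Y ⊗ Z) ≫ 𝟙 _)
      left_unitality := fun X => congrArg I.toQuot.map (by
        simp : (λ_ X).hom = 𝟙 (𝟙_ A) ▷ X ≫ 𝟙 _ ≫ (λ_ X).hom)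
      right_unitality := fun X => congrArg I.toQuot.map (by
        simp : (ρ_ X).hom = X ◁ 𝟙 (𝟙_ A) ≫ 𝟙 _ ≫ (ρ_ X).hom) }

instance (I : TensorIdeal k A) : MonoidalPreadditive I.Quot where
  whiskerLeft_zero {X Y Z} :=
    congrArg I.toQuot.map (MonoidalPreadditive.whiskerLeft_zero (X := X.as) (Y := Y.as) (Z := Z.as))
  zero_whiskerRight {X Y Z} :=
    congrArg I.toQuot.map (MonoidalPreadditive.zero_whiskerRight (X := X.as) (Y := Y.as) (Z := Z.as))
  whiskerLeft_add := by
    rintro ⟨X⟩ ⟨Y⟩ ⟨Z⟩ ⟨f⟩ ⟨g⟩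
    exact congrArg I.toQuot.map (MonoidalPreadditive.whiskerLeft_add f g)
  add_whiskerRight := by
    rintro ⟨X⟩ ⟨Y⟩ ⟨Z⟩ ⟨f⟩ ⟨g⟩
    exact congrArg I.toQuot.map (MonoidalPreadditive.add_whiskerRight f g)

instance [MonoidalLinear k A] (I : TensorIdeal k A) : MonoidalLinear k I.Quot where
  whiskerLeft_smul := by
    rintro ⟨X⟩ ⟨Y⟩ ⟨Z⟩ r ⟨f⟩
    exact congrArg I.toQuot.map (MonoidalLinear.whiskerLeft_smul X r f)
  smul_whiskerRight := by
    rintro r ⟨Y⟩ ⟨Z⟩ ⟨f⟩ ⟨X⟩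
    exact congrArg I.toQuot.map (MonoidalLinear.smul_whiskerRight r f X)

instance [BraidedCategory A] (I : TensorIdeal k A) : BraidedCategory I.Quot where
  braiding X Y := I.toQuot.mapIso (β_ X.as Y.as)
  braiding_naturality_right := by
    rintro ⟨X⟩ ⟨Y⟩ ⟨Z⟩ ⟨f⟩
    exact congrArg I.toQuot.map (BraidedCategory.braiding_naturality_right X f)
  braiding_naturality_left := by
    rintro ⟨X⟩ ⟨Y⟩ ⟨f⟩ ⟨Z⟩
    exact congrArg I.toQuot.map (BraidedCategory.braiding_naturality_left f Z)
  hexagon_forward X Y Z :=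
    congrArg I.toQuot.map (BraidedCategory.hexagon_forward X.as Y.as Z.as)
  hexagon_reverse X Y Z :=
    congrArg I.toQuot.map (BraidedCategory.hexagon_reverse X.as Y.as Z.as)

instance (I : TensorIdeal k A) (X Y : A) [ExactPairing X Y] :
    ExactPairing (I.toQuot.obj X) (I.toQuot.obj Y) where
  coevaluation' := I.toQuot.map (η_ X Y)
  evaluation' := I.toQuot.map (ε_ X Y)
  coevaluation_evaluation' :=
    congrArg I.toQuot.map (ExactPairing.coevaluation_evaluation X Y)
  evaluation_coevaluation' :=
    congrArg I.toQuot.map (ExactPairing.evaluation_coevaluation X Y)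

instance [RigidCategory A] (I : TensorIdeal k A) : RigidCategory I.Quot where
  rightDual X :=
    { rightDual := I.toQuot.obj (X.as)ᘁ
      exact := inferInstanceAs (ExactPairing (I.toQuot.obj X.as) (I.toQuot.obj (X.as)ᘁ)) }
  leftDual X :=
    { leftDual := I.toQuot.obj (ᘁ(X.as))
      exact := inferInstanceAs (ExactPairing (I.toQuot.obj (ᘁ(X.as))) (I.toQuot.obj X.as)) }

section Lift

open Functor.LaxMonoidal

variable {D : Type u₂} [Category.{v₂} D] [Preadditive D] (I : TensorIdeal k A) (F : A ⥤ D)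
  [F.Additive] (hF : ∀ {X Y : A} (f : X ⟶ Y), f ∈ I.hom X Y ↔ F.map f = 0)

/-- The functor induced on `A/𝓘` by an additive functor with kernel `𝓘`. -/
def quotLift : I.Quot ⥤ D :=
  CategoryTheory.Quotient.lift I.rel F (fun X Y f g h => by
    have := (hF (f - g)).1 h
    rwa [F.map_sub, sub_eq_zero] at this)

instance : (I.quotLift F hF).Additive where
  map_add := by
    rintro ⟨X⟩ ⟨Y⟩ ⟨f⟩ ⟨g⟩
    exact F.map_add

instance [Linear k D] [F.Linear k] : (I.quotLift F hF).Linear k where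
  map_smul := by
    rintro ⟨X⟩ ⟨Y⟩ ⟨f⟩ r
    exact F.map_smul r f

instance : (I.quotLift F hF).Faithful where
  map_injective := by
    rintro ⟨X⟩ ⟨Y⟩ ⟨f⟩ ⟨g⟩ h
    refine (I.toQuot_map_eq_iff f g).2 ((hF _).2 ?_)
    rw [F.map_sub, sub_eq_zero]
    exact h

instance [MonoidalCategory D] [F.Monoidal] : (I.quotLift F hF).Monoidal :=
  Functor.CoreMonoidal.toMonoidal
    { εIso := Functor.Monoidal.εIso F
      μIso := fun X Y => Functor.Monoidal.μIso F X.as Y.as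
      μIso_hom_natural_left := by
        rintro ⟨X⟩ ⟨Y⟩ ⟨f⟩ ⟨Z⟩
        exact μ_natural_left F f Z
      μIso_hom_natural_right := by
        rintro ⟨X⟩ ⟨Y⟩ ⟨Z⟩ ⟨f⟩
        exact μ_natural_right F Z f
      associativity := fun X Y Z => associativity F X.as Y.as Z.as
      left_unitality := fun X => left_unitality F X.as
      right_unitality := fun X => right_unitality F X.as }

end Lift

end TensorIdeal

end

noncomputable section

/-! ### Morphisms of finite-dimensional representations -/

namespace FDRep

variable {k : Type u} [Field k] {G : Type v} [Group G]

lemma toLin_comp {X Y Z : FDRep k G} (f : X ⟶ Y) (g : Y ⟶ Z) :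
    toLin (f ≫ g) = toLin g ∘ₗ toLin f := rfl

lemma toLin_comp_apply {X Y Z : FDRep k G} (f : X ⟶ Y) (g : Y ⟶ Z) (x : X) :
    toLin (f ≫ g) x = toLin g (toLin f x) := rfl

lemma toLin_id (X : FDRep k G) : toLin (𝟙 X) = LinearMap.id := rfl

lemma toLin_add {X Y : FDRep k G} (f g : X ⟶ Y) : toLin (f + g) = toLin f + toLin g := rfl

lemma toLin_sub {X Y : FDRep k G} (f g : X ⟶ Y) : toLin (f - g) = toLin f - toLin g := rfl

lemma toLin_zero (X Y : FDRep k G) : toLin (0 : X ⟶ Y) = 0 := rfl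

lemma toLin_smul {X Y : FDRep k G} (c : k) (f : X ⟶ Y) : toLin (c • f) = c • toLin f := rfl

lemma toLin_injective {X Y : FDRep k G} : Function.Injective (toLin : (X ⟶ Y) → (X →ₗ[k] Y)) := by
  intro f g h
  exact Action.Hom.ext (FGModuleCat.hom_ext h)

lemma toLin_ρ {X Y : FDRep k G} (f : X ⟶ Y) (g : G) (x : X) :
    toLin f (X.ρ g x) = Y.ρ g (toLin f x) :=
  LinearMap.congr_fun (toLin_comm f g) x

/-- An equivariant linear map as a morphism of representations. -/
def homMk {X Y : FDRep k G} (f : X →ₗ[k] Y) (h : ∀ g x, f (X.ρ g x) = Y.ρ g (f x)) : X ⟶ Y where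
  hom := FGModuleCat.ofHom f
  comm g := by
    ext x
    exact h g x

variable (k G) in
/-- The underlying vector space of a representation, as a functor. -/
abbrev toModuleCat : FDRep k G ⥤ ModuleCat k :=
  Action.forget (FGModuleCat k) G ⋙ forget₂ (FGModuleCat k) (ModuleCat k)

lemma mono_iff_injective {X Y : FDRep k G} (f : X ⟶ Y) :
    Mono f ↔ Function.Injective (toLin f) := by
  refine Iff.trans ⟨fun h => ?_, fun h => ?_⟩ (ModuleCat.mono_iff_injective ((toModuleCat k G).map f))
  · infer_instance
  · exact (toModuleCat k G).mono_of_mono_map h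

lemma epi_iff_surjective {X Y : FDRep k G} (f : X ⟶ Y) :
    Epi f ↔ Function.Surjective (toLin f) := by
  refine Iff.trans ⟨fun h => ?_, fun h => ?_⟩ (ModuleCat.epi_iff_surjective ((toModuleCat k G).map f))
  · infer_instance
  · exact (toModuleCat k G).epi_of_epi_map h

lemma isIso_of_injective {X : FDRep k G} (f : X ⟶ X) (h : Function.Injective (toLin f)) :
    IsIso f := by
  have : Mono f := (mono_iff_injective f).2 h
  have : Epi f := (epi_iff_surjective f).2 (LinearMap.surjective_of_injective h)
  exact isIso_of_mono_of_epi f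

lemma toLin_pow {X : FDRep k G} (φ : End X) (N : ℕ) :
    toLin (φ ^ N : End X) = (toLin (φ : X ⟶ X)) ^ N := by
  induction N with
  | zero => rfl
  | succ N ih =>
    rw [pow_succ, pow_succ, ← ih]
    rfl

/-- Fitting's lemma: `B` is the image of a power of `φ` high enough that its kernel and image meet
in zero. The operator that the power induces on its own image is then injective, hence invertible.
-/
lemma exists_fitting {X : FDRep k G} (φ : X ⟶ X) :
    ∃ (N : ℕ) (ψ : X ⟶ X) (B : FDRep k G) (π : X ⟶ B) (i : B ⟶ X),
      π ≫ i = φ ≫ ψ ∧ toLin (π ≫ i) = (toLin φ) ^ (N + 1) ∧ IsIso (i ≫ π) := by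
  obtain ⟨N, hN⟩ := (Filter.eventually_atTop.1
    (Module.End.eventually_disjoint_ker_pow_range_pow (toLin φ)))
  let φ' : End X := φ
  let ψ : X ⟶ X := φ' ^ (N + 1)
  refine ⟨N, φ' ^ N, Abelian.image ψ, Abelian.factorThruImage ψ,
    Abelian.image.ι ψ, (Abelian.image.fac ψ).trans (pow_succ φ' N),
    (congrArg toLin (Abelian.image.fac ψ)).trans (toLin_pow φ' _), isIso_of_injective _ ?_⟩
  rw [← LinearMap.ker_eq_bot, LinearMap.ker_eq_bot']
  intro b hb
  obtain ⟨x, rfl⟩ := (epi_iff_surjective (Abelian.factorThruImage ψ)).1 inferInstance b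
  have hψ : ∀ y, toLin (Abelian.image.ι ψ) (toLin (Abelian.factorThruImage ψ) y) = toLin ψ y :=
    fun y => congrArg (fun f => toLin f y) (Abelian.image.fac ψ)
  have hi := (mono_iff_injective (Abelian.image.ι ψ)).1 inferInstance
  rw [toLin_comp_apply, hψ] at hb
  have h2 : toLin ψ (toLin ψ x) = 0 := by rw [← hψ (toLin ψ x), hb, map_zero]
  have := (hN (N + 1) (Nat.le_succ N)).le_bot
    (show toLin ψ x ∈ _ from ⟨by
      exact (congrArg (fun f => f (toLin ψ x)) (toLin_pow φ' (N + 1))).symm.trans h2,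
      ⟨x, (congrArg (fun f => f x) (toLin_pow φ' (N + 1))).symm⟩⟩)
  apply hi
  rw [hψ, map_zero]
  exact this

end FDRep

/-! ### Negligible morphisms -/

namespace FDRep

variable {k : Type u} [Field k] {G : Type v} [Group G]

lemma finrank_biprod (A B : FDRep k G) :
    Module.finrank k (A ⊞ B : FDRep k G) = Module.finrank k A + Module.finrank k B := by
  rw [← Module.finrank_prod]
  have h : ∀ {X Y : FDRep k G} {f g : X ⟶ Y} (_ : f = g) (x : X), toLin f x = toLin g x := by
    rintro X Y f _ rfl x
    rfl
  refine LinearEquiv.finrank_eq (LinearEquiv.ofLinearMap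
    ((toLin (biprod.fst : A ⊞ B ⟶ A)).prod (toLin (biprod.snd : A ⊞ B ⟶ B)))
    (LinearMap.coprod (toLin (biprod.inl : A ⟶ A ⊞ B)) (toLin (biprod.inr : B ⟶ A ⊞ B))) ?_
    (LinearMap.ext fun x => h (biprod.total : _ = 𝟙 (A ⊞ B)) x))
  refine LinearMap.ext fun ⟨a, b⟩ => Prod.ext ?_ ?_
  · change toLin (biprod.fst : A ⊞ B ⟶ A) (toLin biprod.inl a + toLin biprod.inr b) = a
    rw [map_add, ← toLin_comp_apply, ← toLin_comp_apply, h biprod.inl_fst, h biprod.inr_fst]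
    exact add_zero a
  · change toLin (biprod.snd : A ⊞ B ⟶ B) (toLin biprod.inl a + toLin biprod.inr b) = b
    rw [map_add, ← toLin_comp_apply, ← toLin_comp_apply, h biprod.inl_snd, h biprod.inr_snd]
    exact zero_add b

lemma mem_negligible_of_isNilpotent {X : FDRep k G} (f : X ⟶ X)
    (h : ∀ g : X ⟶ X, IsNilpotent (toLin (f ≫ g))) : f ∈ (negligible k G).hom X X :=
  fun g => (LinearMap.isNilpotent_trace_of_isNilpotent (h g)).eq_zero

/-- Every morphism `f` of representations is, up to negligible morphisms, the inclusion of a direct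
summand followed by a projection onto it. -/
theorem exists_split_mod_negligible {X Y : FDRep k G} (f : X ⟶ Y) :
    ∃ (A : FDRep k G) (s : A ⟶ X) (q : Y ⟶ A), s ≫ f ≫ q = 𝟙 A ∧
      f - f ≫ q ≫ s ≫ f ∈ (negligible k G).hom X Y := by
  let P : ℕ → Prop := fun d => ∃ (A : FDRep k G) (s : A ⟶ X) (q : Y ⟶ A), s ≫ f ≫ q = 𝟙 A ∧
    d = Module.finrank k A
  have hb : ∀ d, P d → d ≤ Module.finrank k X := by
    rintro d ⟨A, s, q, h, rfl⟩
    have : Mono s := by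
      have : Mono (s ≫ f ≫ q) := by rw [h]; infer_instance
      exact mono_of_mono s (f ≫ q)
    exact LinearMap.finrank_le_finrank_of_injective ((mono_iff_injective s).1 this)
  have h0 : P 0 := by
    refine ⟨FDRep.of (Representation.trivial k G PUnit.{u + 1}), 0, 0, toLin_injective ?_, ?_⟩
    · exact LinearMap.ext fun x => Subsingleton.elim _ _
    · exact (Module.finrank_zero_of_subsingleton (R := k) (M := PUnit.{u + 1})).symm
  classical
  -- `A` is chosen of the largest possible dimension. If the remainder were not negligible, a
  -- composite with some `g` would have nonzero trace, and Fitting's lemma would split off a further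
  -- nonzero summand.
  obtain ⟨A, s, q, h, hd⟩ := Nat.findGreatest_spec (P := P) (Nat.zero_le _) h0
  refine ⟨A, s, q, h, fun g => ?_⟩
  by_contra htr
  obtain ⟨N, ψ, B, π, i, hπ, hN, hi⟩ := exists_fitting ((f - f ≫ q ≫ s ≫ f) ≫ g)
  obtain ⟨r, hir⟩ : ∃ r : X ⟶ B, i ≫ (f - f ≫ q ≫ s ≫ f) ≫ g ≫ r = 𝟙 B := by
    refine ⟨ψ ≫ π ≫ inv (i ≫ π) ≫ inv (i ≫ π), ?_⟩
    have h2 := IsIso.hom_inv_id (i ≫ π)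
    have h3 : i ≫ (f - f ≫ q ≫ s ≫ f) ≫ g ≫ ψ ≫ π ≫ inv (i ≫ π) ≫ inv (i ≫ π) =
        i ≫ (((f - f ≫ q ≫ s ≫ f) ≫ g) ≫ ψ) ≫ π ≫ inv (i ≫ π) ≫ inv (i ≫ π) := by
      simp only [Category.assoc]
    have h4 : i ≫ (π ≫ i) ≫ π ≫ inv (i ≫ π) ≫ inv (i ≫ π) =
        (i ≫ π) ≫ ((i ≫ π) ≫ inv (i ≫ π)) ≫ inv (i ≫ π) := by
      simp only [Category.assoc]
    rw [h3, ← hπ, h4, h2, Category.id_comp, h2]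
  have hP : P (Module.finrank k (A ⊞ B : FDRep k G)) := by
    -- The correction terms make the off-diagonal entries vanish, as in Gram-Schmidt; the entry at
    -- `B` becomes `i ≫ (f - f ≫ q ≫ s ≫ f) ≫ g ≫ r`.
    refine ⟨A ⊞ B, biprod.desc s (i - i ≫ f ≫ q ≫ s), biprod.lift q (g ≫ r - q ≫ s ≫ f ≫ g ≫ r), ?_, rfl⟩
    have h' : ∀ {Z : FDRep k G} (t : A ⟶ Z), s ≫ f ≫ q ≫ t = t := fun t => by
      rw [← Category.assoc f q, ← Category.assoc, h, Category.id_comp]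
    refine biprod.hom_ext' _ _ (biprod.hom_ext _ _ ?_ ?_) (biprod.hom_ext _ _ ?_ ?_)
    · simp [h]
    · simp [h']
    · simp [h]
    · simp only [biprod.inr_desc_assoc, Category.assoc, biprod.lift_snd,
        Preadditive.comp_sub, Preadditive.sub_comp, h', sub_self, comp_zero, sub_zero, biprod.inr_snd,
        Category.comp_id] at hir ⊢
      exact hir
  have hle := Nat.le_findGreatest (hb _ hP) hP
  rw [hd, finrank_biprod] at hle
  -- By maximality the new summand is zero, so the composite is nilpotent and has trace zero after
  -- all.
  have hB : Module.finrank k B = 0 := by omega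
  apply htr
  have hB0 : toLin π = 0 := by
    have := Module.finrank_zero_iff.1 hB
    exact LinearMap.ext fun x => Subsingleton.elim _ _
  have hz : (toLin ((f - f ≫ q ≫ s ≫ f) ≫ g)) ^ (N + 1) = 0 := by
    rw [← hN, toLin_comp, hB0, LinearMap.comp_zero]
  exact (LinearMap.isNilpotent_trace_of_isNilpotent ⟨N + 1, hz⟩).eq_zero

end FDRep

end

noncomputable section

/-! ### Quotients in which every morphism splits -/

namespace TensorIdeal

variable {k : Type u} [Field k] {A : Type u₁} [Category.{v₁} A] [MonoidalCategory A]

/-- Modulo `𝓘`, every morphism factors as the projection to a direct summand followed by the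
inclusion of a direct summand. -/
def IsSplit [Preadditive A] [Linear k A] (I : TensorIdeal k A) : Prop :=
  ∀ ⦃X Y : A⦄ (f : X ⟶ Y), ∃ (Z : A) (s : Z ⟶ X) (q : Y ⟶ Z),
    s ≫ f ≫ q = 𝟙 Z ∧ f - f ≫ q ≫ s ≫ f ∈ I.hom X Y

namespace IsSplit

lemma exists_comp_comp_eq [Preadditive A] [Linear k A] {I : TensorIdeal k A} (hI : I.IsSplit)
    {X Y : I.Quot} (f : X ⟶ Y) : ∃ g : Y ⟶ X, f ≫ g ≫ f = f := by
  obtain ⟨f, rfl⟩ := I.toQuot.map_surjective f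
  obtain ⟨Z, s, q, -, h⟩ := hI f
  refine ⟨I.toQuot.map (q ≫ s), ?_⟩
  have := (I.toQuot_map_eq_iff _ _).2 h
  simp only [Functor.map_comp, Category.assoc] at this ⊢
  exact this.symm

variable [Abelian A] [Linear k A] {I : TensorIdeal k A} (hI : I.IsSplit)

include hI

/-- In the quotient `f` equals `f ≫ q ≫ s ≫ f`, so `f` and `f ≫ q` have the same kernel. Before
passing to the quotient, `f ≫ q` is a split epimorphism, so its kernel is a direct summand and
survives. -/
lemma hasKernels : HasKernels I.Quot where
  has_limit {X Y} f := by
    obtain ⟨f, rfl⟩ := I.toQuot.map_surjective f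
    obtain ⟨Z, s, q, h₁, h₂⟩ := hI f
    have hc : (𝟙 _ - f ≫ q ≫ s) ≫ f ≫ q = 0 := by
      simp only [Preadditive.sub_comp, Category.id_comp, Category.assoc, h₁, Category.comp_id,
        sub_self]
    let r := kernel.lift (f ≫ q) (𝟙 _ - f ≫ q ≫ s) hc
    have hr : r ≫ kernel.ι (f ≫ q) = 𝟙 _ - f ≫ q ≫ s := kernel.lift_ι _ _ _
    have hir : kernel.ι (f ≫ q) ≫ r = 𝟙 _ := by
      rw [← cancel_mono (kernel.ι (f ≫ q)), Category.assoc, hr, Preadditive.comp_sub]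
      have := kernel.condition (f ≫ q)
      rw [show kernel.ι (f ≫ q) ≫ f ≫ q ≫ s = (kernel.ι (f ≫ q) ≫ f ≫ q) ≫ s by
        simp only [Category.assoc], this, zero_comp, sub_zero, Category.comp_id, Category.id_comp]
    have : Mono (I.toQuot.map (kernel.ι (f ≫ q))) := by
      have : Mono (I.toQuot.map (kernel.ι (f ≫ q)) ≫ I.toQuot.map r) := by
        rw [← I.toQuot.map_comp, hir, I.toQuot.map_id]
        infer_instance
      exact mono_of_mono _ (I.toQuot.map r)
    have hz : I.toQuot.map (kernel.ι (f ≫ q)) ≫ I.toQuot.map f = 0 := by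
      rw [← I.toQuot.map_comp, toQuot_map_eq_zero_iff]
      have := I.comp_left_mem (kernel.ι (f ≫ q)) h₂
      rwa [Preadditive.comp_sub, show kernel.ι (f ≫ q) ≫ f ≫ q ≫ s ≫ f =
        (kernel.ι (f ≫ q) ≫ f ≫ q) ≫ s ≫ f by simp only [Category.assoc], kernel.condition,
        zero_comp, sub_zero] at this
    have key : ∀ {W : I.Quot} (t : W ⟶ I.toQuot.obj _), t ≫ I.toQuot.map f = 0 →
        (t ≫ I.toQuot.map r) ≫ I.toQuot.map (kernel.ι (f ≫ q)) = t := by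
      intro W t ht
      rw [Category.assoc, ← I.toQuot.map_comp, hr, Functor.map_sub, Preadditive.comp_sub,
        Functor.map_comp, reassoc_of% ht, zero_comp, sub_zero, I.toQuot.map_id, Category.comp_id]
    exact ⟨⟨KernelFork.ofι _ hz, KernelFork.IsLimit.ofι' _ _ fun t ht =>
      ⟨t ≫ I.toQuot.map r, key t ht⟩⟩⟩

/-- Dually, `f` has the cokernel of `s ≫ f`, a split monomorphism before passing to the quotient. -/
lemma hasCokernels : HasCokernels I.Quot where
  has_colimit {X Y} f := by
    obtain ⟨f, rfl⟩ := I.toQuot.map_surjective f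
    obtain ⟨Z, s, q, h₁, h₂⟩ := hI f
    have hc : (s ≫ f) ≫ (𝟙 _ - q ≫ s ≫ f) = 0 := by
      have : s ≫ f ≫ q ≫ s ≫ f = (s ≫ f ≫ q) ≫ s ≫ f := by simp only [Category.assoc]
      simp only [Preadditive.comp_sub, Category.comp_id, Category.assoc, this, h₁, Category.id_comp,
        sub_self]
    let r := cokernel.desc (s ≫ f) (𝟙 _ - q ≫ s ≫ f) hc
    have hr : cokernel.π (s ≫ f) ≫ r = 𝟙 _ - q ≫ s ≫ f := cokernel.π_desc _ _ _
    have hir : r ≫ cokernel.π (s ≫ f) = 𝟙 _ := by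
      rw [← cancel_epi (cokernel.π (s ≫ f)), reassoc_of% hr, Preadditive.sub_comp]
      have := cokernel.condition (s ≫ f)
      simp only [Category.assoc] at this
      simp only [Category.assoc, this, comp_zero, sub_zero, Category.comp_id, Category.id_comp]
    have : Epi (I.toQuot.map (cokernel.π (s ≫ f))) :=
      epi_of_epi_fac (f := I.toQuot.map r) (h := 𝟙 _) (by rw [← I.toQuot.map_comp, hir, I.toQuot.map_id])
    have hz : I.toQuot.map f ≫ I.toQuot.map (cokernel.π (s ≫ f)) = 0 := by
      rw [← I.toQuot.map_comp, toQuot_map_eq_zero_iff]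
      have h₃ := I.comp_right_mem (cokernel.π (s ≫ f)) h₂
      have := cokernel.condition (s ≫ f)
      simp only [Category.assoc] at this
      simpa only [Preadditive.sub_comp, Category.assoc, this, comp_zero, sub_zero] using h₃
    have key : ∀ {W : I.Quot} (t : I.toQuot.obj _ ⟶ W), I.toQuot.map f ≫ t = 0 →
        I.toQuot.map (cokernel.π (s ≫ f)) ≫ I.toQuot.map r ≫ t = t := by
      intro W t ht
      rw [← Category.assoc, ← I.toQuot.map_comp, hr, Functor.map_sub, Preadditive.sub_comp,
        Functor.map_comp, Functor.map_comp, Category.assoc, Category.assoc, ht, comp_zero,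
        comp_zero, sub_zero, I.toQuot.map_id, Category.id_comp]
    exact ⟨⟨CokernelCofork.ofπ _ hz, CokernelCofork.IsColimit.ofπ' _ _ fun t ht =>
      ⟨I.toQuot.map r ≫ t, key t ht⟩⟩⟩

/-- A quotient in which all morphisms split is abelian. -/
abbrev abelian : Abelian I.Quot where
  has_finite_products := hasFiniteProducts_of_has_binary_and_terminal
  has_kernels := hI.hasKernels
  has_cokernels := hI.hasCokernels
  normalMonoOfMono {X Y} f _ := by
    obtain ⟨g, hg⟩ := hI.exists_comp_comp_eq f
    have hfg : f ≫ g = 𝟙 X := by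
      rw [← cancel_mono f, Category.assoc, hg, Category.id_comp]
    have hz : f ≫ (𝟙 Y - g ≫ f) = 0 := by
      rw [Preadditive.comp_sub, hg, Category.comp_id, sub_self]
    exact ⟨⟨Y, 𝟙 Y - g ≫ f, hz, KernelFork.IsLimit.ofι' _ _ fun t ht => ⟨t ≫ g, by
      rw [Preadditive.comp_sub, Category.comp_id, sub_eq_zero] at ht
      rw [Category.assoc]
      exact ht.symm⟩⟩⟩
  normalEpiOfEpi {X Y} f _ := by
    obtain ⟨g, hg⟩ := hI.exists_comp_comp_eq f
    have hz : (𝟙 X - f ≫ g) ≫ f = 0 := by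
      rw [Preadditive.sub_comp, Category.assoc, hg, Category.id_comp, sub_self]
    exact ⟨⟨X, 𝟙 X - f ≫ g, hz, CokernelCofork.IsColimit.ofπ' _ _ fun t ht => ⟨g ≫ t, by
      rw [Preadditive.sub_comp, Category.id_comp, sub_eq_zero] at ht
      rw [← Category.assoc]
      exact ht.symm⟩⟩⟩

end IsSplit

end TensorIdeal

/-- An additive functor on an abelian category in which every morphism has a generalized inverse
is exact. -/
lemma CategoryTheory.Functor.preservesFiniteLimits_and_colimits_of_regular {C : Type u₁}
    [Category.{v₁} C] [Abelian C] (hC : ∀ {X Y : C} (f : X ⟶ Y), ∃ g : Y ⟶ X, f ≫ g ≫ f = f)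
    {D : Type u₂} [Category.{v₂} D] [Abelian D] (F : C ⥤ D) [F.Additive] :
    PreservesFiniteLimits F ∧ PreservesFiniteColimits F := by
  have h : ∀ S : ShortComplex C, S.ShortExact → (S.map F).ShortExact := by
    intro S hS
    obtain ⟨g, hg⟩ := hC S.f
    have := hS.mono_f
    have hfg : S.f ≫ g = 𝟙 _ := by
      rw [← cancel_mono S.f, Category.assoc, hg, Category.id_comp]
    have := hS.epi_g
    exact ((ShortComplex.Splitting.ofExactOfRetraction S hS.exact g hfg
      inferInstance).map F).shortExact
  exact (F.exact_tfae.out 0 3).1 h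

/-! ### The semisimplification of a category of representations is a tensor category -/

section Semisimplification

variable (k : Type u) [Field k] (G : Type v) [Group G]

lemma negligible_isSplit : (negligible k G).IsSplit := fun _ _ f => FDRep.exists_split_mod_negligible f

instance : Abelian (negligible k G).Quot := (negligible_isSplit k G).abelian

instance : RigidCategory (FDRep k G) := BraidedCategory.rigidCategoryOfRightRigidCategory

variable {k G}

lemma FDRep.end_unit_eq_smul (f : 𝟙_ (FDRep k G) ⟶ 𝟙_ (FDRep k G)) :
    ∃ c : k, f = c • 𝟙 (𝟙_ (FDRep k G)) := by
  refine ⟨(toLin f : k →ₗ[k] k) (1 : k), toLin_injective ?_⟩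
  refine LinearMap.ext_ring (M₃ := k) (σ := RingHom.id k) ?_
  exact (mul_one ((toLin f : k →ₗ[k] k) (1 : k))).symm

lemma negligible_unit_bijective :
    Function.Bijective (fun c : k => c • 𝟙 (𝟙_ (negligible k G).Quot)) := by
  constructor
  · intro c d h
    have : (c • 𝟙 (𝟙_ (FDRep k G))) - (d • 𝟙 (𝟙_ (FDRep k G))) ∈ (negligible k G).hom _ _ :=
      ((negligible k G).toQuot_map_eq_iff _ _).1 h
    have h2 := this (𝟙 _)
    rw [Category.comp_id, ← sub_smul, FDRep.toLin_smul, FDRep.toLin_id, map_smul,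
      LinearMap.trace_id] at h2
    have h3 : Module.finrank k (𝟙_ (FDRep k G) : FDRep k G) = 1 := Module.finrank_self k
    rw [h3, Nat.cast_one, smul_eq_mul, mul_one, sub_eq_zero] at h2
    exact h2
  · intro f
    obtain ⟨f, rfl⟩ := (negligible k G).toQuot.map_surjective (X := 𝟙_ _) (Y := 𝟙_ _) f
    obtain ⟨c, rfl⟩ := FDRep.end_unit_eq_smul f
    exact ⟨c, rfl⟩

end Semisimplification

end

noncomputable section

/-! ### Tensor categories of equivariant objects -/

instance Action.essentiallySmall {V : Type u₁} [Category.{v₁} V]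
    [EssentiallySmall.{w} V] {H : Type v} [Monoid H] [Small.{w} H] [LocallySmall.{w} (Action V H)] :
    EssentiallySmall.{w} (Action V H) := by
  have : Small.{w} (Σ X : Skeleton V, H →* End ((fromSkeleton V).obj X)) := by
    have : ∀ X : Skeleton V, Small.{w} (End ((fromSkeleton V).obj X)) := fun X =>
      inferInstanceAs (Small.{w} ((fromSkeleton V).obj X ⟶ (fromSkeleton V).obj X))
    have : ∀ X : Skeleton V, Small.{w} (H →* End ((fromSkeleton V).obj X)) := fun X =>
      small_of_injective (f := fun f : H →* End ((fromSkeleton V).obj X) => (f : H → _))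
        DFunLike.coe_injective
    infer_instance
  refine essentiallySmall_of_family (ι := Σ X : Skeleton V, H →* End ((fromSkeleton V).obj X))
    (fun X => ⟨_, X.2⟩) fun Y => ?_
  let e := fromSkeletonToSkeletonIso Y.V
  refine ⟨⟨toSkeleton Y.V,
    { toFun := fun h => e.hom ≫ Y.ρ h ≫ e.inv
      map_one' := by
        change e.hom ≫ Y.ρ 1 ≫ e.inv = 𝟙 _
        rw [Action.ρ_one, Category.id_comp, e.hom_inv_id]
      map_mul' := fun h h' => by
        change e.hom ≫ Y.ρ (h * h') ≫ e.inv = (e.hom ≫ Y.ρ h' ≫ e.inv) ≫ (e.hom ≫ Y.ρ h ≫ e.inv)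
        rw [map_mul]
        change e.hom ≫ (Y.ρ h' ≫ Y.ρ h) ≫ e.inv = _
        simp only [Category.assoc, e.inv_hom_id_assoc] }⟩, ⟨Action.mkIso e fun h => ?_⟩⟩
  change (e.hom ≫ Y.ρ h ≫ e.inv) ≫ e.hom = e.hom ≫ Y.ρ h
  simp

section FiniteLength

variable {k : Type u} [Field k] {V : Type u₁} [Category.{v₁} V] [Abelian V] [Linear k V]
  (hV : ∀ {X Y : V} (f : X ⟶ Y), ∃ g : Y ⟶ X, f ≫ g ≫ f = f) {H : Type v} [Monoid H]

/-- The endomorphisms of the underlying object which factor through a subobject. -/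
def Action.factoring (k : Type u) [Field k] [Linear k V] (X : Action V H)
    (S : Subobject X) : Submodule k (X.V ⟶ X.V) where
  carrier := {f | ∃ g, g ≫ S.arrow.hom = f}
  add_mem' := by
    rintro _ _ ⟨a, rfl⟩ ⟨b, rfl⟩
    exact ⟨a + b, Preadditive.add_comp _ _ _ _ _ _⟩
  zero_mem' := ⟨0, zero_comp⟩
  smul_mem' := by
    rintro c _ ⟨a, rfl⟩
    exact ⟨c • a, Linear.smul_comp _ _ _ _ _ _⟩

include hV

/-- Sends a subobject to a right-ideal-like subspace of the endomorphisms of the underlying object.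
Since these are finite dimensional in the application, chains of subobjects are bounded, which is
how finite length is obtained. -/
lemma Action.factoring_strictMono (X : Action V H) :
    StrictMono (Action.factoring k X) := by
  have key : ∀ S T : Subobject X, Action.factoring k X S ≤ Action.factoring k X T → S ≤ T := by
    intro S T h
    have : Mono T.arrow.hom := inferInstanceAs (Mono ((Action.forget V H).map T.arrow))
    have : Mono S.arrow.hom := inferInstanceAs (Mono ((Action.forget V H).map S.arrow))
    -- The idempotent `r ≫ S.arrow.hom` has image `S`; if it factors through `T`, then `S` lies in
    -- `T`.
    obtain ⟨r, hr⟩ := hV S.arrow.hom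
    obtain ⟨g, hg⟩ := h ⟨r, rfl⟩
    refine Subobject.le_of_comm { hom := S.arrow.hom ≫ g, comm := fun x => ?_ } ?_
    · rw [← cancel_mono T.arrow.hom]
      simp only [Category.assoc]
      erw [T.arrow.comm]
      rw [hg, hr, reassoc_of% hg, reassoc_of% hr]
      exact S.arrow.comm x
    · ext
      change (S.arrow.hom ≫ g) ≫ T.arrow.hom = S.arrow.hom
      rw [Category.assoc, hg, hr]
  refine Monotone.strictMono_of_injective ?_ ?_
  · rintro S T hST _ ⟨g, rfl⟩
    refine ⟨g ≫ (Subobject.ofLE S T hST).hom, ?_⟩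
    rw [Category.assoc, ← Action.comp_hom, Subobject.ofLE_arrow]
  · intro S T h
    exact le_antisymm (key _ _ h.le) (key _ _ h.ge)

lemma Action.isArtinianObject_and_isNoetherianObject (X : Action V H)
    [FiniteDimensional k (X.V ⟶ X.V)] : IsArtinianObject X ∧ IsNoetherianObject X := by
  have h := Action.factoring_strictMono (k := k) hV X
  exact ⟨⟨StrictMono.wellFoundedLT h⟩, ⟨StrictMono.wellFoundedGT h⟩⟩

end FiniteLength

section Equivariant

variable (k : Type u) [Field k] (G H : Type) [Group G] [Group H]

instance (X Y : (negligible k G).Quot) : FiniteDimensional k (X ⟶ Y) :=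
  Module.Finite.of_surjective ((negligible k G).toQuot.mapLinearMap k (X := X.as) (Y := Y.as))
    (negligible k G).toQuot.map_surjective

/-- The tensor category of `H`-equivariant objects in the semisimplification of the category of
representations of `G`. -/
abbrev equivariantTensorCat : TensorCat.{u, u, u + 1} k where
  carrier := Action (negligible k G).Quot H
  isArtinian X := (Action.isArtinianObject_and_isNoetherianObject (k := k)
    (negligible_isSplit k G).exists_comp_comp_eq X).1
  isNoetherian X := (Action.isArtinianObject_and_isNoetherianObject (k := k)
    (negligible_isSplit k G).exists_comp_comp_eq X).2
  unit_bijective := by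
    have h := negligible_unit_bijective (k := k) (G := G)
    constructor
    · intro c d hcd
      exact h.1 (congrArg Action.Hom.hom hcd)
    · intro f
      obtain ⟨c, hc⟩ := h.2 f.hom
      exact ⟨c, Action.Hom.ext hc⟩

end Equivariant

end

noncomputable section

open Functor.LaxMonoidal Functor.OplaxMonoidal

/-! ### Equivariant lifts of monoidal functors -/

section EquivariantLift

variable {A : Type u₁} [Category.{v₁} A] {S : Type u₂} [Category.{v₂} S] (R : A ⥤ S)
  {G : Type v} [Monoid G] (α : G →* End R)

/-- A monoid acting on a functor `R` lifts it to a functor to equivariant objects. -/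
def CategoryTheory.Functor.equivariantLift : A ⥤ Action S G where
  obj X :=
    { V := R.obj X
      ρ :=
        { toFun := fun g => (α g : R ⟶ R).app X
          map_one' := by rw [map_one]; rfl
          map_mul' := fun g h => by rw [map_mul]; rfl } }
  map f :=
    { hom := R.map f
      comm := fun g => ((α g : R ⟶ R).naturality f).symm }
  map_id X := Action.Hom.ext (R.map_id X)
  map_comp f g := Action.Hom.ext (R.map_comp f g)

instance [Preadditive A] [Preadditive S] [R.Additive] : (R.equivariantLift α).Additive where
  map_add := Action.Hom.ext R.map_add

instance {k : Type u} [Field k] [Preadditive A] [Preadditive S] [Linear k A] [Linear k S]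
    [R.Linear k] : (R.equivariantLift α).Linear k where
  map_smul f r := Action.Hom.ext (R.map_smul r f)

variable [MonoidalCategory A] [MonoidalCategory S] [R.Monoidal]

/-- A monoid acting on a monoidal functor by monoidal transformations lifts it to a monoidal functor
to equivariant objects. -/
abbrev CategoryTheory.Functor.equivariantLiftMonoidal
    (hα : ∀ g, NatTrans.IsMonoidal (α g : R ⟶ R)) : (R.equivariantLift α).Monoidal :=
  Functor.CoreMonoidal.toMonoidal
    { εIso := Action.mkIso (Functor.Monoidal.εIso R) fun g =>
        (Category.id_comp _).trans (hα g).unit.symm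
      μIso := fun X Y => Action.mkIso (Functor.Monoidal.μIso R X Y) fun g =>
        ((hα g).tensor X Y).symm
      μIso_hom_natural_left := fun f X => Action.Hom.ext (μ_natural_left R f X)
      μIso_hom_natural_right := fun X f => Action.Hom.ext (μ_natural_right R X f)
      associativity := fun X Y Z => Action.Hom.ext (by
        simp only [Action.comp_hom, Action.associator_hom_hom, Action.whiskerRight_hom,
          Action.whiskerLeft_hom]
        exact Functor.LaxMonoidal.associativity R X Y Z)
      left_unitality := fun X => Action.Hom.ext (by
        simp only [Action.comp_hom, Action.leftUnitor_hom_hom, Action.whiskerRight_hom]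
        exact Functor.LaxMonoidal.left_unitality R X)
      right_unitality := fun X => Action.Hom.ext (by
        simp only [Action.comp_hom, Action.rightUnitor_hom_hom, Action.whiskerLeft_hom]
        exact Functor.LaxMonoidal.right_unitality R X) }

end EquivariantLift

/-! ### Restriction of representations -/

instance Action.resMonoidal {V : Type u₁} [Category.{v₁} V] [MonoidalCategory V] {H K : Type*}
    [Monoid H] [Monoid K] (j : H →* K) : (Action.res V j).Monoidal :=
  Functor.CoreMonoidal.toMonoidal
    { εIso := Action.mkIso (Iso.refl _) fun _ => (Category.comp_id _).trans (Category.id_comp _).symm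
      μIso := fun _ _ => Action.mkIso (Iso.refl _) fun _ =>
        (Category.comp_id _).trans (Category.id_comp _).symm
      μIso_hom_natural_left := fun _ _ =>
        Action.Hom.ext ((Category.comp_id _).trans (Category.id_comp _).symm)
      μIso_hom_natural_right := fun _ _ =>
        Action.Hom.ext ((Category.comp_id _).trans (Category.id_comp _).symm)
      associativity := fun X Y Z => Action.Hom.ext (by
        simp only [Action.comp_hom, Action.associator_hom_hom, Action.whiskerRight_hom,
          Action.whiskerLeft_hom]
        change 𝟙 (X.V ⊗ Y.V) ▷ Z.V ≫ 𝟙 _ ≫ (α_ X Y Z).hom.hom =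
          (α_ X.V Y.V Z.V).hom ≫ X.V ◁ 𝟙 (Y.V ⊗ Z.V) ≫ 𝟙 _
        simp [Action.associator_hom_hom])
      left_unitality := fun X => Action.Hom.ext (by
        simp only [Action.comp_hom, Action.leftUnitor_hom_hom, Action.whiskerRight_hom]
        change (λ_ X.V).hom = 𝟙 (𝟙_ V) ▷ X.V ≫ 𝟙 _ ≫ (λ_ X).hom.hom
        simp [Action.leftUnitor_hom_hom])
      right_unitality := fun X => Action.Hom.ext (by
        simp only [Action.comp_hom, Action.rightUnitor_hom_hom, Action.whiskerLeft_hom]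
        change (ρ_ X.V).hom = X.V ◁ 𝟙 (𝟙_ V) ≫ 𝟙 _ ≫ (ρ_ X).hom.hom
        simp [Action.rightUnitor_hom_hom]) }

/-! ### Unipotent group elements act trivially modulo negligible morphisms -/

namespace FDRep

variable {k : Type u} [Field k]

/-- The action of an element of a commutative group as a morphism of representations. -/
def actHom {K : Type v} [CommGroup K] (X : FDRep k K) (x : K) : X ⟶ X :=
  homMk (X.ρ x) fun g v => by
    rw [← Module.End.mul_apply, ← map_mul, mul_comm, map_mul, Module.End.mul_apply]

section

variable {K : Type v} [CommGroup K]

lemma toLin_actHom (X : FDRep k K) (x : K) : toLin (actHom X x) = X.ρ x := rfl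

lemma actHom_one (X : FDRep k K) : actHom X 1 = 𝟙 X :=
  toLin_injective (by rw [toLin_actHom, map_one]; rfl)

lemma actHom_mul (X : FDRep k K) (x y : K) : actHom X (x * y) = actHom X y ≫ actHom X x :=
  toLin_injective (by rw [toLin_actHom, map_mul]; rfl)

lemma actHom_naturality {X Y : FDRep k K} (f : X ⟶ Y) (x : K) :
    f ≫ actHom Y x = actHom X x ≫ f :=
  toLin_injective (toLin_comm f x).symm

lemma actHom_tensor (X Y : FDRep k K) (x : K) : actHom (X ⊗ Y) x = actHom X x ⊗ₘ actHom Y x :=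
  Action.Hom.ext rfl

lemma actHom_unit (x : K) : actHom (𝟙_ (FDRep k K)) x = 𝟙 _ :=
  Action.Hom.ext rfl

/-- In characteristic `p`, `(x - 1)^(p^N) = x^(p^N) - 1 = 0`. The nilpotent operator `x - 1`
commutes with every morphism, so all composites with it are nilpotent and have trace zero. -/
lemma actHom_mem_negligible {p : ℕ} [Fact p.Prime] [CharP k p] (X : FDRep k K) {x : K} {N : ℕ}
    (hx : x ^ p ^ N = 1) : actHom X x - 𝟙 X ∈ (negligible k K).hom X X := by
  refine mem_negligible_of_isNilpotent _ fun g => ?_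
  have hc : Commute (toLin (actHom X x - 𝟙 X)) (toLin g) := by
    have := toLin_comm g x
    rw [toLin_sub, toLin_actHom, toLin_id]
    exact (Commute.sub_left this.symm (Commute.one_left _))
  rw [toLin_comp, ← Module.End.mul_eq_comp]
  refine hc.symm.isNilpotent_mul_left ⟨p ^ N, ?_⟩
  rw [toLin_sub, toLin_actHom, toLin_id]
  change (X.ρ x - 1) ^ p ^ N = 0
  have : CharP (Module.End k X) p ∨ Subsingleton (Module.End k X) := by
    rcases subsingleton_or_nontrivial (Module.End k X) with h | h
    · exact Or.inr h
    · exact Or.inl (charP_of_injective_algebraMap (algebraMap k (Module.End k X)).injective p)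
  rcases this with h | h
  · rw [sub_pow_char_pow_of_commute _ _ (Commute.one_right _), one_pow, ← map_pow, hx, map_one,
      sub_self]
  · exact Subsingleton.elim _ _

end

end FDRep

/-! ### The functor to equivariant objects in the semisimplification -/

/-- An extension of groups `H → K → G` with `K` commutative and `H` a `p`-group. -/
structure PExtension (p : ℕ) (H K G : Type) [CommGroup H] [CommGroup K] [Group G] where
  incl : H →* K
  proj : K →* G
  incl_injective : Function.Injective incl
  proj_surjective : Function.Surjective proj
  proj_eq_one_iff : ∀ x, proj x = 1 ↔ ∃ h, incl h = x
  isPGroup : IsPGroup p H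

namespace PExtension

variable {p : ℕ} {H K G : Type} [CommGroup H] [CommGroup K] [Group G] (E : PExtension p H K G)
  (k : Type u) [Field k]

/-- A set-theoretic section of the projection. -/
def sec (g : G) : K := Function.surjInv E.proj_surjective g

lemma proj_sec (g : G) : E.proj (E.sec g) = g := Function.surjInv_eq E.proj_surjective g

/-- Restriction of representations. -/
abbrev res : FDRep k K ⥤ FDRep k H := Action.res (FGModuleCat k) E.incl

/-- Restriction of representations followed by semisimplification. -/
abbrev resQuot : FDRep k K ⥤ (negligible k H).Quot := E.res k ⋙ (negligible k H).toQuot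

lemma res_map_actHom (X : FDRep k K) (h : H) :
    (E.res k).map (FDRep.actHom X (E.incl h)) = FDRep.actHom ((E.res k).obj X) h := rfl

variable [Fact p.Prime] [CharP k p]

include E in
lemma toQuot_actHom (X : FDRep k H) (h : H) :
    (negligible k H).toQuot.map (FDRep.actHom X h) = 𝟙 _ := by
  obtain ⟨N, hN⟩ := E.isPGroup h
  rw [← (negligible k H).toQuot.map_id, TensorIdeal.toQuot_map_eq_iff]
  exact FDRep.actHom_mem_negligible X hN

lemma resQuot_actHom_eq (X : FDRep k K) {x y : K} (hxy : E.proj x = E.proj y) :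
    (E.resQuot k).map (FDRep.actHom X x) = (E.resQuot k).map (FDRep.actHom X y) := by
  obtain ⟨h, hh⟩ := (E.proj_eq_one_iff (y⁻¹ * x)).1 (by rw [map_mul, map_inv, hxy, inv_mul_cancel])
  have : x = E.incl h * y := by rw [hh, mul_comm, mul_inv_cancel_left]
  rw [this, FDRep.actHom_mul, Functor.map_comp, Functor.comp_map, Functor.comp_map, res_map_actHom,
    E.toQuot_actHom k]
  exact Category.comp_id _

/-- The action of the quotient group on the restriction functor. -/
def resQuotAction : G →* End (E.resQuot k) where
  toFun g :=
    { app := fun X => (E.resQuot k).map (FDRep.actHom X (E.sec g))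
      naturality := fun X Y f => by
        rw [← Functor.map_comp, ← Functor.map_comp, FDRep.actHom_naturality] }
  map_one' := by
    refine NatTrans.ext (funext fun X => ?_)
    change (E.resQuot k).map (FDRep.actHom X (E.sec 1)) = 𝟙 _
    rw [E.resQuot_actHom_eq k X (y := 1) (by rw [proj_sec, map_one]), FDRep.actHom_one,
      CategoryTheory.Functor.map_id]
  map_mul' g h := by
    refine NatTrans.ext (funext fun X => ?_)
    change (E.resQuot k).map (FDRep.actHom X (E.sec (g * h))) =
      (E.resQuot k).map (FDRep.actHom X (E.sec h)) ≫ (E.resQuot k).map (FDRep.actHom X (E.sec g))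
    rw [← Functor.map_comp, ← FDRep.actHom_mul]
    exact E.resQuot_actHom_eq k X (by rw [map_mul, proj_sec, proj_sec, proj_sec])

/-- The functor from representations of `K` to `G`-equivariant objects in the semisimplification of
the category of representations of `H`. -/
def toEquivariant : FDRep k K ⥤ Action (negligible k H).Quot G :=
  (E.resQuot k).equivariantLift (E.resQuotAction k)

instance : (E.toEquivariant k).Additive :=
  inferInstanceAs ((E.resQuot k).equivariantLift (E.resQuotAction k)).Additive

instance : (E.toEquivariant k).Linear k :=
  inferInstanceAs (((E.resQuot k).equivariantLift (E.resQuotAction k)).Linear k)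

lemma toEquivariant_ρ (X : FDRep k K) (x : K) :
    ((E.toEquivariant k).obj X).ρ (E.proj x) = (E.resQuot k).map (FDRep.actHom X x) :=
  E.resQuot_actHom_eq k X (E.proj_sec _)

instance : (E.toEquivariant k).Monoidal :=
  (E.resQuot k).equivariantLiftMonoidal (E.resQuotAction k) fun g =>
    { unit := by
        change ε (E.resQuot k) ≫ (E.resQuot k).map (FDRep.actHom (𝟙_ _) (E.sec g)) = _
        rw [FDRep.actHom_unit, CategoryTheory.Functor.map_id, Category.comp_id]
      tensor := fun X Y => by
        change μ (E.resQuot k) X Y ≫ (E.resQuot k).map (FDRep.actHom (X ⊗ Y) (E.sec g)) = _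
        rw [FDRep.actHom_tensor, ← μ_natural]
        rfl }

end PExtension

end

noncomputable section

open Functor.LaxMonoidal Functor.OplaxMonoidal

/-! ### Averaging over a finite group -/

namespace Action

variable {S : Type u₂} [Category.{v₂} S] [Preadditive S] {G : Type v} [Group G] [Fintype G]

omit [Preadditive S] [Fintype G] in
lemma ρ_mul_eq_comp (X : Action S G) (g h : G) : X.ρ (g * h) = (X.ρ h ≫ X.ρ g : X.V ⟶ X.V) :=
  map_mul X.ρ g h

/-- The sum of the conjugates of a morphism. -/
def average {X Y : Action S G} (θ : X.V ⟶ Y.V) : X ⟶ Y where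
  hom := ∑ g : G, X.ρ g ≫ θ ≫ Y.ρ g⁻¹
  comm h := by
    rw [Preadditive.comp_sum, Preadditive.sum_comp]
    refine Fintype.sum_equiv (Equiv.mulRight h) _ _ fun g => ?_
    rw [Equiv.coe_mulRight, Category.assoc, Category.assoc, ← ρ_mul_eq_comp,
      ← Category.assoc (X.ρ h), ← ρ_mul_eq_comp, mul_inv_rev, mul_inv_cancel_left]

lemma comp_average {X Y Z : Action S G} (u : X ⟶ Y) (θ : Y.V ⟶ Z.V) :
    u ≫ average θ = average (u.hom ≫ θ) := by
  ext
  change u.hom ≫ (∑ g : G, _) = ∑ g : G, _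
  rw [Preadditive.comp_sum]
  refine Finset.sum_congr rfl fun g _ => ?_
  rw [← Category.assoc, ← u.comm, Category.assoc, Category.assoc]

end Action

/-- The kernel of a monoidal functor, as a tensor ideal. -/
def TensorIdeal.ker (k : Type u) [Field k] {A : Type u₁} [Category.{v₁} A]
    [Preadditive A] [Linear k A] [MonoidalCategory A] {D : Type u₂} [Category.{v₂} D]
    [Preadditive D] [Linear k D] [MonoidalCategory D] [MonoidalPreadditive D] (F : A ⥤ D)
    [F.Additive] [F.Linear k] [F.Monoidal] : TensorIdeal k A where
  hom X Y := LinearMap.ker (F.mapLinearMap k (X := X) (Y := Y))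
  comp_left_mem f g hg := by
    have hg : F.map g = 0 := hg
    change F.map (f ≫ g) = 0
    rw [F.map_comp, hg, comp_zero]
  comp_right_mem {_ _ _ f} g hf := by
    have hf : F.map f = 0 := hf
    change F.map (f ≫ g) = 0
    rw [F.map_comp, hf, zero_comp]
  whiskerLeft_mem Z _ _ f hf := by
    have hf : F.map f = 0 := hf
    change F.map (Z ◁ f) = 0
    rw [Functor.Monoidal.map_whiskerLeft, hf, MonoidalPreadditive.whiskerLeft_zero, zero_comp,
      comp_zero]
  whiskerRight_mem {_ _ f} Z hf := by
    have hf : F.map f = 0 := hf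
    change F.map (f ▷ Z) = 0
    rw [Functor.Monoidal.map_whiskerRight, hf, MonoidalPreadditive.zero_whiskerRight, zero_comp,
      comp_zero]

lemma FDRep.toLin_sum {k : Type u} [Field k] {G : Type v} [Group G] {X Y : FDRep k G}
    {ι : Type*} (s : Finset ι) (f : ι → (X ⟶ Y)) : toLin (∑ i ∈ s, f i) = ∑ i ∈ s, toLin (f i) :=
  map_sum (AddMonoidHom.mk' (toLin : (X ⟶ Y) → _) toLin_add) f s

namespace PExtension

variable {p : ℕ} {H K G : Type} [CommGroup H] [CommGroup K] [Group G] (E : PExtension p H K G)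
  {k : Type u} [Field k]

/-! ### Relative traces -/

section RelTrace

variable [Fintype G] {X Y : FDRep k K}

/-- The linear map underlying a morphism between restrictions. -/
def resLin (φ : (E.res k).obj X ⟶ (E.res k).obj Y) : X →ₗ[k] Y :=
  FDRep.toLin (X := (E.res k).obj X) (Y := (E.res k).obj Y) φ

-- Since `φ` is `H`-equivariant, conjugation depends only on the class of `x` modulo `H`. The
-- relative trace, a sum over representatives of `G`, is therefore independent of them.
omit [Fintype G] in
lemma conj_incl_mul (φ : (E.res k).obj X ⟶ (E.res k).obj Y) (h : H) (x : K) :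
    Y.ρ (E.incl h * x)⁻¹ ∘ₗ E.resLin φ ∘ₗ X.ρ (E.incl h * x) =
      Y.ρ x⁻¹ ∘ₗ E.resLin φ ∘ₗ X.ρ x := by
  have hφ : E.resLin φ ∘ₗ X.ρ (E.incl h) = Y.ρ (E.incl h) ∘ₗ E.resLin φ :=
    FDRep.toLin_comm φ h
  have h1 : Y.ρ (E.incl h)⁻¹ * Y.ρ (E.incl h) = 1 := by rw [← map_mul, inv_mul_cancel, map_one]
  rw [mul_inv_rev, map_mul, map_mul, Module.End.mul_eq_comp, Module.End.mul_eq_comp,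
    LinearMap.comp_assoc, ← LinearMap.comp_assoc (X.ρ x), hφ, LinearMap.comp_assoc,
    ← LinearMap.comp_assoc _ (Y.ρ (E.incl h)), ← Module.End.mul_eq_comp, h1]
  rfl

/-- The relative trace of a morphism between the restrictions of representations. -/
def relTrace (φ : (E.res k).obj X ⟶ (E.res k).obj Y) : X ⟶ Y :=
  FDRep.homMk (∑ g : G, Y.ρ (E.sec g)⁻¹ ∘ₗ E.resLin φ ∘ₗ X.ρ (E.sec g)) fun x v => by
    have key : ∀ a b : K, E.proj a = E.proj b → Y.ρ a⁻¹ ∘ₗ E.resLin φ ∘ₗ X.ρ a =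
        Y.ρ b⁻¹ ∘ₗ E.resLin φ ∘ₗ X.ρ b := by
      intro a b hab
      obtain ⟨h, hh⟩ := (E.proj_eq_one_iff (a * b⁻¹)).1 (by
        rw [map_mul, map_inv, hab, mul_inv_cancel])
      rw [← E.conj_incl_mul φ h b, hh, inv_mul_cancel_right]
    rw [LinearMap.sum_apply, LinearMap.sum_apply, map_sum]
    refine Fintype.sum_equiv (Equiv.mulRight (E.proj x)) _ _ fun g => ?_
    have h := LinearMap.congr_fun (key (E.sec (g * E.proj x)) (E.sec g * x) (by
      rw [map_mul, proj_sec, proj_sec])) v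
    rw [Equiv.coe_mulRight, h]
    change Y.ρ (E.sec g)⁻¹ (E.resLin φ (X.ρ (E.sec g) (X.ρ x v))) =
      Y.ρ x (Y.ρ (E.sec g * x)⁻¹ (E.resLin φ (X.ρ (E.sec g * x) v)))
    rw [← Module.End.mul_apply (X.ρ _), ← Module.End.mul_apply (Y.ρ x), ← map_mul, ← map_mul,
      mul_inv_rev, mul_inv_cancel_left]

lemma res_map_relTrace (φ : (E.res k).obj X ⟶ (E.res k).obj Y) :
    (E.res k).map (E.relTrace φ) = ∑ g : G, (E.res k).map (FDRep.actHom X (E.sec g)) ≫ φ ≫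
      (E.res k).map (FDRep.actHom Y (E.sec g)⁻¹) :=
  FDRep.toLin_injective (by
    rw [FDRep.toLin_sum]
    exact (Finset.sum_congr rfl fun g _ => rfl :
      ∑ g : G, Y.ρ (E.sec g)⁻¹ ∘ₗ E.resLin φ ∘ₗ X.ρ (E.sec g) = _))

variable [Fact p.Prime] [CharP k p]

omit [Fintype G] in
lemma toEquivariant_ρ_sec_inv (X : FDRep k K) (g : G) :
    ((E.toEquivariant k).obj X).ρ g⁻¹ = (E.resQuot k).map (FDRep.actHom X (E.sec g)⁻¹) := by
  rw [← E.toEquivariant_ρ, MonoidHom.map_inv E.proj, E.proj_sec]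

lemma toEquivariant_map_relTrace (φ : (E.res k).obj X ⟶ (E.res k).obj Y) :
    (E.toEquivariant k).map (E.relTrace φ) =
      Action.average (X := (E.toEquivariant k).obj X) (Y := (E.toEquivariant k).obj Y)
        ((negligible k H).toQuot.map φ) := by
  refine Action.Hom.ext ?_
  change (negligible k H).toQuot.map ((E.res k).map (E.relTrace φ)) = ∑ g : G, _
  rw [res_map_relTrace, Functor.map_sum]
  refine Finset.sum_congr rfl fun g _ => ?_
  rw [toEquivariant_ρ_sec_inv, Functor.map_comp, Functor.map_comp]
  rfl

end RelTrace

/-! ### Relatively projective representations -/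

variable [Fintype G]

/-- A representation of `K` is projective relative to `H` if its identity is a relative trace. -/
def IsRelProjective (X : FDRep k K) : Prop :=
  ∃ φ : (E.res k).obj X ⟶ (E.res k).obj X, E.relTrace φ = 𝟙 X

lemma actHom_comp_inv (X : FDRep k K) (x : K) :
    FDRep.actHom X x ≫ FDRep.actHom X x⁻¹ = 𝟙 X := by
  rw [← FDRep.actHom_mul, inv_mul_cancel, FDRep.actHom_one]

/-- Projection formula: the relative trace of `Y ⊗ φ` is `Y` tensored with the relative trace of
`φ`, because the action on `Y` cancels in each conjugate. -/
lemma IsRelProjective.tensor_left {X : FDRep k K} (Y : FDRep k K) (hX : E.IsRelProjective X) :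
    E.IsRelProjective (Y ⊗ X) := by
  obtain ⟨φ, hφ⟩ := hX
  refine ⟨δ (E.res k) Y X ≫ (E.res k).obj Y ◁ φ ≫ μ (E.res k) Y X, ?_⟩
  apply (E.res k).map_injective
  have : ∀ g : G, (E.res k).map (FDRep.actHom (Y ⊗ X) (E.sec g)) ≫
      (δ (E.res k) Y X ≫ (E.res k).obj Y ◁ φ ≫ μ (E.res k) Y X) ≫
      (E.res k).map (FDRep.actHom (Y ⊗ X) (E.sec g)⁻¹) = δ (E.res k) Y X ≫ ((E.res k).obj Y ◁
        ((E.res k).map (FDRep.actHom X (E.sec g)) ≫ φ ≫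
          (E.res k).map (FDRep.actHom X (E.sec g)⁻¹))) ≫ μ (E.res k) Y X := by
    intro g
    have h := congrArg (E.res k).map (actHom_comp_inv Y (E.sec g))
    rw [Functor.map_comp, CategoryTheory.Functor.map_id] at h
    simp only [FDRep.actHom_tensor, Functor.Monoidal.map_tensor, Category.assoc,
      Functor.Monoidal.μ_δ_assoc, ← id_tensorHom, tensorHom_comp_tensorHom_assoc,
      Category.id_comp, h]
  rw [res_map_relTrace, Finset.sum_congr rfl fun g _ => this g, ← Preadditive.comp_sum,
    ← Preadditive.sum_comp, ← whiskerLeft_sum, ← res_map_relTrace, hφ]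
  simp

lemma IsRelProjective.of_iso {X Y : FDRep k K} (e : X ≅ Y) (hX : E.IsRelProjective X) :
    E.IsRelProjective Y := by
  obtain ⟨φ, hφ⟩ := hX
  refine ⟨(E.res k).map e.inv ≫ φ ≫ (E.res k).map e.hom, ?_⟩
  apply (E.res k).map_injective
  have : ∀ g : G, (E.res k).map (FDRep.actHom Y (E.sec g)) ≫
      ((E.res k).map e.inv ≫ φ ≫ (E.res k).map e.hom) ≫
        (E.res k).map (FDRep.actHom Y (E.sec g)⁻¹) = (E.res k).map e.inv ≫
        ((E.res k).map (FDRep.actHom X (E.sec g)) ≫ φ ≫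
          (E.res k).map (FDRep.actHom X (E.sec g)⁻¹)) ≫ (E.res k).map e.hom := by
    intro g
    simp only [Category.assoc, ← Functor.map_comp, FDRep.actHom_naturality]
    rw [← Category.assoc, ← Functor.map_comp, ← FDRep.actHom_naturality, Functor.map_comp,
      Category.assoc]
  rw [res_map_relTrace, Finset.sum_congr rfl fun g _ => this g, ← Preadditive.comp_sum,
    ← Preadditive.sum_comp, ← res_map_relTrace, hφ]
  simp

lemma IsRelProjective.tensor_right {X : FDRep k K} (Y : FDRep k K) (hX : E.IsRelProjective X) :
    E.IsRelProjective (X ⊗ Y) :=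
  (hX.tensor_left E Y).of_iso E (β_ Y X)

/-! ### Coinduced representations -/

section Coind

variable [Finite K] (M : FDRep k H)

instance : Module.Finite k (Representation.coindV E.incl M.ρ) :=
  inferInstanceAs (Module.Finite k (_ : Submodule k (K → M)))

/-- The coinduced representation. -/
def coind : FDRep k K := FDRep.of (Representation.coind E.incl M.ρ)

/-- The function underlying an element of a coinduced representation. -/
def coindFun : (E.coind M : FDRep k K) →ₗ[k] (K → M) := (Representation.coindV E.incl M.ρ).subtype

omit [Fintype G] in
lemma coindFun_injective : Function.Injective (E.coindFun M) := Subtype.val_injective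

omit [Fintype G] in
lemma coindFun_incl_mul (f : (E.coind M : FDRep k K)) (h : H) (x : K) :
    E.coindFun M f (E.incl h * x) = M.ρ h (E.coindFun M f x) :=
  (show Representation.coindV E.incl M.ρ from f).2 h x

/-- Evaluation at the neutral element. -/
def coindEv : (E.res k).obj (E.coind M) ⟶ M :=
  FDRep.homMk (LinearMap.proj (1 : K) ∘ₗ E.coindFun M) fun h f => by
    have := E.coindFun_incl_mul M f h 1
    rw [mul_one] at this
    change E.coindFun M f (1 * E.incl h) = M.ρ h (E.coindFun M f 1)
    rw [one_mul, this]

open Classical in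
/-- The function supported on `H` attached to an element of a representation of `H`. -/
def extendFun (x : K) : M →ₗ[k] M :=
  if hx : ∃ h, E.incl h = x then M.ρ hx.choose else 0

omit [Fintype G] [Finite K] in
lemma extendFun_incl (h : H) : E.extendFun M (E.incl h) = M.ρ h := by
  have hx : ∃ h', E.incl h' = E.incl h := ⟨h, rfl⟩
  rw [extendFun, dif_pos hx, E.incl_injective hx.choose_spec]

omit [Fintype G] [Finite K] in
lemma extendFun_eq_zero {x : K} (hx : E.proj x ≠ 1) : E.extendFun M x = 0 :=
  dif_neg fun h => hx ((E.proj_eq_one_iff x).2 h)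

omit [Fintype G] [Finite K] in
lemma extendFun_mul_incl (h : H) (x : K) :
    E.extendFun M (x * E.incl h) = E.extendFun M x ∘ₗ M.ρ h := by
  by_cases hx : E.proj x = 1
  · obtain ⟨h', rfl⟩ := (E.proj_eq_one_iff x).1 hx
    rw [← map_mul, extendFun_incl, extendFun_incl, map_mul]
    rfl
  · have h1 : E.proj (E.incl h) = 1 := (E.proj_eq_one_iff _).2 ⟨h, rfl⟩
    rw [extendFun_eq_zero _ _ hx, extendFun_eq_zero _ _ (by rwa [map_mul, h1, mul_one]),
      LinearMap.zero_comp]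

omit [Fintype G] [Finite K] in
lemma extendFun_incl_mul (h : H) (x : K) :
    E.extendFun M (E.incl h * x) = M.ρ h ∘ₗ E.extendFun M x := by
  by_cases hx : E.proj x = 1
  · obtain ⟨h', rfl⟩ := (E.proj_eq_one_iff x).1 hx
    rw [← map_mul, extendFun_incl, extendFun_incl, map_mul]
    rfl
  · have h1 : E.proj (E.incl h) = 1 := (E.proj_eq_one_iff _).2 ⟨h, rfl⟩
    rw [extendFun_eq_zero _ _ hx, extendFun_eq_zero _ _ (by rwa [map_mul, h1, one_mul]),
      LinearMap.comp_zero]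

/-- Extension by zero from `H` to `K`. -/
def coindι : M ⟶ (E.res k).obj (E.coind M) :=
  FDRep.homMk (LinearMap.codRestrict (Representation.coindV E.incl M.ρ)
    (LinearMap.pi (E.extendFun M)) fun m h x => LinearMap.congr_fun (E.extendFun_incl_mul M h x) m)
    fun h m => Subtype.ext (funext fun x =>
      (LinearMap.congr_fun (E.extendFun_mul_incl M h x) m).symm)

omit [Fintype G] in
lemma coindι_ev : E.coindι M ≫ E.coindEv M = 𝟙 M := by
  refine FDRep.toLin_injective (LinearMap.ext fun m => ?_)
  change E.extendFun M 1 m = m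
  rw [← map_one E.incl, extendFun_incl, map_one]
  rfl

omit [Fintype G] in
lemma coindι_actHom_ev {x : K} (hx : E.proj x ≠ 1) :
    E.coindι M ≫ (E.res k).map (FDRep.actHom (E.coind M) x) ≫ E.coindEv M = 0 := by
  refine FDRep.toLin_injective (LinearMap.ext fun m => ?_)
  change E.extendFun M (1 * x) m = 0
  rw [one_mul, E.extendFun_eq_zero M hx]
  rfl

/-- The endomorphism `coindEv ≫ coindι` cuts a function on `K` down to `H`. Its conjugates cut down
to the other cosets, and at a point `x` only the coset of `x` contributes. -/
lemma coind_isRelProjective : E.IsRelProjective (E.coind M) := by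
  refine ⟨E.coindEv M ≫ E.coindι M, FDRep.toLin_injective (LinearMap.ext fun f => ?_)⟩
  refine E.coindFun_injective M (funext fun x => ?_)
  have h1 : FDRep.toLin (E.relTrace (E.coindEv M ≫ E.coindι M)) f =
    ∑ g : G, (E.coind M).ρ (E.sec g)⁻¹ (E.resLin (E.coindEv M ≫ E.coindι M)
      ((E.coind M).ρ (E.sec g) f)) := LinearMap.sum_apply _ _ _
  have h2 : ∀ g : G, E.coindFun M ((E.coind M).ρ (E.sec g)⁻¹
      (E.resLin (E.coindEv M ≫ E.coindι M) ((E.coind M).ρ (E.sec g) f))) x =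
      E.extendFun M (x * (E.sec g)⁻¹) (E.coindFun M f (1 * E.sec g)) := fun g => rfl
  rw [h1, map_sum, Finset.sum_apply, Finset.sum_congr rfl fun g _ => h2 g,
    Finset.sum_eq_single (E.proj x)]
  · obtain ⟨h, hh⟩ := (E.proj_eq_one_iff (x * (E.sec (E.proj x))⁻¹)).1 (by
      rw [map_mul, map_inv, E.proj_sec, mul_inv_cancel])
    rw [← hh, extendFun_incl, one_mul, ← coindFun_incl_mul, hh, inv_mul_cancel_right]
    rfl
  · intro g _ hg
    rw [E.extendFun_eq_zero M fun h => hg ?_]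
    · rfl
    · rw [map_mul, map_inv, E.proj_sec, mul_inv_eq_one] at h
      exact h.symm
  · exact fun h => absurd (Finset.mem_univ _) h

end Coind

/-! ### The injective cover of the category of equivariant objects -/

section Cover

variable (k) [Fact p.Prime] [CharP k p]

/-- The kernel of the functor to equivariant objects. -/
def ideal : TensorIdeal k (FDRep k K) := TensorIdeal.ker k (E.toEquivariant k)

omit [Fintype G] in
lemma mem_ideal_iff {X Y : FDRep k K} (f : X ⟶ Y) :
    f ∈ (E.ideal k).hom X Y ↔ (E.res k).map f ∈ (negligible k H).hom _ _ := by
  refine Iff.trans ?_ ((negligible k H).toQuot_map_eq_zero_iff _)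
  exact ⟨fun h => congrArg Action.Hom.hom (show (E.toEquivariant k).map f = 0 from h),
    fun h => Action.Hom.ext h⟩

omit [Fintype G] in
lemma mem_ideal_iff_map_eq_zero {X Y : FDRep k K} (f : X ⟶ Y) :
    f ∈ (E.ideal k).hom X Y ↔ (E.toEquivariant k).map f = 0 := Iff.rfl

/-- The faithful functor induced on the quotient by the kernel. -/
abbrev envelope : (E.ideal k).Quot ⥤ Action (negligible k H).Quot G :=
  (E.ideal k).quotLift (E.toEquivariant k) (E.mem_ideal_iff_map_eq_zero k)

variable {k} in
lemma average_eq_id {X : FDRep k K} {φ : (E.res k).obj X ⟶ (E.res k).obj X}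
    (hφ : E.relTrace φ = 𝟙 X) :
    Action.average (X := (E.toEquivariant k).obj X) (Y := (E.toEquivariant k).obj X)
        ((negligible k H).toQuot.map φ) = 𝟙 _ := by
  rw [← toEquivariant_map_relTrace, hφ, CategoryTheory.Functor.map_id]

-- With `𝟙 Y` the relative trace of `φ`, `u` is `u` followed by an average, hence the average of `u
-- ≫ φ`, and averages of lifted morphisms come from relative traces.
variable {k} in
lemma exists_map_eq {X Y : FDRep k K} (hY : E.IsRelProjective Y)
    (u : (E.toEquivariant k).obj X ⟶ (E.toEquivariant k).obj Y) :
    ∃ f, (E.toEquivariant k).map f = u := by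
  obtain ⟨φ, hφ⟩ := hY
  obtain ⟨ψ, hψ⟩ := (negligible k H).toQuot.map_surjective (X := (E.res k).obj X)
    (Y := (E.res k).obj Y) u.hom
  refine ⟨E.relTrace (ψ ≫ φ), ?_⟩
  rw [toEquivariant_map_relTrace, Functor.map_comp, hψ]
  refine (Action.comp_average u _).symm.trans ?_
  rw [E.average_eq_id hφ, Category.comp_id]

-- As for Maschke's theorem: a monomorphism splits in the semisimplification without regard to the
-- action, and averaging the retraction weighted by `φ` makes the extension equivariant. No division
-- by the order of `G` occurs.
variable {k} in
lemma injective_toEquivariant {X : FDRep k K} (hX : E.IsRelProjective X) :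
    Injective ((E.toEquivariant k).obj X) where
  factors {Y Z} f i _ := by
    obtain ⟨φ, hφ⟩ := hX
    have : Mono i.hom := inferInstanceAs (Mono ((Action.forget _ G).map i))
    obtain ⟨r, hr⟩ := (negligible_isSplit k H).exists_comp_comp_eq i.hom
    have hr' : i.hom ≫ r = 𝟙 _ := by
      rw [← cancel_mono i.hom, Category.assoc, hr, Category.id_comp]
    refine ⟨Action.average (r ≫ f.hom ≫ (negligible k H).toQuot.map φ), ?_⟩
    rw [Action.comp_average, reassoc_of% hr']
    refine (Action.comp_average f _).symm.trans ?_
    rw [E.average_eq_id hφ, Category.comp_id]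

/-- The embedding is the average of the non-equivariant inclusion into the coinduced object.
Followed by evaluation at the neutral element only the term `g = 1` survives, so it is a split
monomorphism of underlying objects. -/
lemma exists_mono [Finite K] (X : Action (negligible k H).Quot G) :
    ∃ (a : FDRep k K) (_ : E.IsRelProjective a) (i : X ⟶ (E.toEquivariant k).obj a), Mono i := by
  refine ⟨E.coind X.V.as, E.coind_isRelProjective X.V.as,
    Action.average (Y := (E.toEquivariant k).obj (E.coind X.V.as))
      ((negligible k H).toQuot.map (E.coindι X.V.as)), ?_⟩
  refine (Action.forget _ G).mono_of_mono_map ?_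
  have h : (∑ g : G, X.ρ g ≫ ((negligible k H).toQuot.map (E.coindι X.V.as) : X.V ⟶ _) ≫
      (E.resQuot k).map (FDRep.actHom (E.coind X.V.as) (E.sec g)⁻¹)) ≫
        (negligible k H).toQuot.map (E.coindEv X.V.as) = 𝟙 X.V := by
    rw [Preadditive.sum_comp, Finset.sum_eq_single 1]
    · have h1 : (E.resQuot k).map (FDRep.actHom (E.coind X.V.as) (E.sec 1)⁻¹) = 𝟙 _ := by
        rw [E.resQuot_actHom_eq k _ (y := 1) (by rw [map_inv, E.proj_sec, inv_one, map_one]),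
          FDRep.actHom_one, CategoryTheory.Functor.map_id]
      rw [h1, Action.ρ_one, Category.assoc, Category.assoc]
      refine (Category.id_comp _).trans ?_
      refine Eq.trans (congrArg _ (Category.id_comp _)) ?_
      rw [← Functor.map_comp, coindι_ev, CategoryTheory.Functor.map_id]
      rfl
    · intro g _ hg
      have := E.coindι_actHom_ev X.V.as (x := (E.sec g)⁻¹) (by
        rw [map_inv, E.proj_sec]; exact inv_ne_one.2 hg)
      rw [Functor.comp_map, Category.assoc, Category.assoc, ← Functor.map_comp, ← Functor.map_comp,
        this, Functor.map_zero, comp_zero]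
    · exact fun h => absurd (Finset.mem_univ _) h
  have h' : ((Action.forget _ G).map (Action.average (Y := (E.toEquivariant k).obj (E.coind X.V.as))
      ((negligible k H).toQuot.map (E.coindι X.V.as) : X.V ⟶ _)) : X.V ⟶ _) ≫
        (negligible k H).toQuot.map (E.coindEv X.V.as) = 𝟙 X.V := by
    rw [← h]
    congr 1
    refine Finset.sum_congr rfl fun g _ => ?_
    rw [toEquivariant_ρ_sec_inv]
    rfl
  exact @mono_of_mono_fac _ _ _ _ _ _ _ _ (inferInstanceAs (Mono (𝟙 X.V))) h'

lemma injectiveCover [Finite K] :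
    InjectiveCover (E.envelope k) (fun X : (E.ideal k).Quot => E.IsRelProjective X.as) where
  injective h := E.injective_toEquivariant h
  full {a} h {b} u := by
    obtain ⟨f, hf⟩ := E.exists_map_eq (X := b.as) h u
    exact ⟨(E.ideal k).toQuot.map f, hf⟩
  tensor_left b h := h.tensor_left E b.as
  tensor_right b h := h.tensor_right E b.as
  embed X := by
    obtain ⟨a, ha, i, hi⟩ := E.exists_mono k X
    exact ⟨(E.ideal k).toQuot.obj a, ha, i, hi⟩

theorem isAbelianEnvelope [Finite K] :
    IsAbelianEnvelope.{u, v, w, u, u + 1, u, u + 1} k (C := equivariantTensorCat k H G)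
      (E.envelope k) :=
  InjectiveCover.isAbelianEnvelope (C := equivariantTensorCat k H G) (E.injectiveCover k)
    (inferInstanceAs (E.envelope k).Additive) (inferInstanceAs ((E.envelope k).Linear k))
    (inferInstanceAs (E.envelope k).Faithful)

omit [Fintype G] in
theorem ideal_isAbelianType : (E.ideal k).IsAbelianType :=
  ⟨equivariantTensorCat k H G, E.toEquivariant k, inferInstanceAs (E.toEquivariant k).Monoidal,
    inferInstanceAs (E.toEquivariant k).Additive, inferInstanceAs ((E.toEquivariant k).Linear k),
    fun _ => Iff.rfl⟩

end Cover

end PExtension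

end

noncomputable section

open Functor.LaxMonoidal Functor.OplaxMonoidal

/-! ### Linear functors on finite-dimensional vector spaces -/

namespace FGModuleCat

variable {k : Type u} [Field k]

lemma exists_resolution (W : FGModuleCat.{u} k) :
    ∃ (n : ℕ) (v : Fin n → (𝟙_ (FGModuleCat k) ⟶ W)) (ξ : Fin n → (W ⟶ 𝟙_ (FGModuleCat k))),
      ∑ i, ξ i ≫ v i = 𝟙 W := by
  let b := Module.finBasis k W
  refine ⟨_, fun i => FGModuleCat.ofHom (V := k) (W := W) (LinearMap.toSpanSingleton k W (b i)),
    fun i => FGModuleCat.ofHom (V := W) (W := k) (b.coord i), ?_⟩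
  refine FGModuleCat.hom_ext (LinearMap.ext fun w => ?_)
  have h : ((∑ i, (FGModuleCat.ofHom (V := W) (W := k) (b.coord i)) ≫
      (FGModuleCat.ofHom (V := k) (W := W) (LinearMap.toSpanSingleton k W (b i))) : W ⟶ W)).hom.hom =
      ∑ i, (LinearMap.toSpanSingleton k W (b i)) ∘ₗ b.coord i :=
    map_sum (AddMonoidHom.mk' (fun f : W ⟶ W => (f.hom.hom : W →ₗ[k] W)) fun _ _ => rfl) _ _
  refine (LinearMap.congr_fun h w).trans ?_
  rw [LinearMap.sum_apply]
  exact b.sum_repr w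

lemma end_unit_eq_smul (c : 𝟙_ (FGModuleCat.{u} k) ⟶ 𝟙_ (FGModuleCat.{u} k)) :
    ∃ a : k, c = a • 𝟙 (𝟙_ (FGModuleCat k)) := by
  refine ⟨(c.hom.hom : k →ₗ[k] k) (1 : k), FGModuleCat.hom_ext ?_⟩
  refine LinearMap.ext_ring (M₃ := k) (σ := RingHom.id k) ?_
  exact (mul_one ((c.hom.hom : k →ₗ[k] k) (1 : k))).symm

lemma exists_comp_comp_eq {X Y : FGModuleCat.{u} k} (f : X ⟶ Y) :
    ∃ g : Y ⟶ X, f ≫ g ≫ f = f := by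
  obtain ⟨g, hg⟩ := LinearMap.exists_leftInverse_of_injective
    (f.hom.hom : X →ₗ[k] Y).range.subtype (Submodule.ker_subtype _)
  obtain ⟨s, hs⟩ := LinearMap.exists_rightInverse_of_surjective
    (f.hom.hom : X →ₗ[k] Y).rangeRestrict (LinearMap.range_rangeRestrict _)
  refine ⟨FGModuleCat.ofHom (s ∘ₗ g), FGModuleCat.hom_ext (LinearMap.ext fun x => ?_)⟩
  have h1 : g ((f.hom.hom : X →ₗ[k] Y) x) = (f.hom.hom : X →ₗ[k] Y).rangeRestrict x :=
    LinearMap.congr_fun hg ((f.hom.hom : X →ₗ[k] Y).rangeRestrict x)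
  have h2 := LinearMap.congr_fun hs ((f.hom.hom : X →ₗ[k] Y).rangeRestrict x)
  change (f.hom.hom : X →ₗ[k] Y) (s (g ((f.hom.hom : X →ₗ[k] Y) x))) = (f.hom.hom : X →ₗ[k] Y) x
  rw [h1]
  exact congrArg Subtype.val h2

section Extend

variable {E : Type u₁} [Category.{v₁} E] [Preadditive E] (Φ Ψ : FGModuleCat.{u} k ⥤ E)
  [Φ.Additive] [Ψ.Additive]

-- Resolving both identities through the unit turns `f` into a matrix of endomorphisms of the unit,
-- with which `t` commutes. So additive functors on vector spaces are compared by their values at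
-- the unit.
variable {Φ Ψ} in
lemma extend_natural {t : Φ.obj (𝟙_ _) ⟶ Ψ.obj (𝟙_ _)}
    (ht : ∀ c : 𝟙_ (FGModuleCat k) ⟶ 𝟙_ _, Φ.map c ≫ t = t ≫ Ψ.map c) {W W' : FGModuleCat k}
    (f : W ⟶ W') {m n : ℕ} {v : Fin m → (𝟙_ (FGModuleCat k) ⟶ W)} {ξ : Fin m → (W ⟶ 𝟙_ _)}
    (h : ∑ i, ξ i ≫ v i = 𝟙 W) {v' : Fin n → (𝟙_ (FGModuleCat k) ⟶ W')}
    {ξ' : Fin n → (W' ⟶ 𝟙_ _)} (h' : ∑ i, ξ' i ≫ v' i = 𝟙 W') :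
    Φ.map f ≫ ∑ j, Φ.map (ξ' j) ≫ t ≫ Ψ.map (v' j) =
      (∑ i, Φ.map (ξ i) ≫ t ≫ Ψ.map (v i)) ≫ Ψ.map f := by
  have h1 : ∀ j, f ≫ ξ' j = ∑ i, ξ i ≫ v i ≫ f ≫ ξ' j := fun j => by
    have := congrArg (· ≫ f ≫ ξ' j) h
    simpa only [Preadditive.sum_comp, Category.assoc, Category.id_comp] using this.symm
  have h2 : ∀ i, v i ≫ f = ∑ j, v i ≫ f ≫ ξ' j ≫ v' j := fun i => by
    have := congrArg (fun g => v i ≫ f ≫ g) h'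
    simpa only [Preadditive.comp_sum, Category.comp_id] using this.symm
  calc Φ.map f ≫ ∑ j, Φ.map (ξ' j) ≫ t ≫ Ψ.map (v' j)
      = ∑ j, ∑ i, Φ.map (ξ i) ≫ Φ.map (v i ≫ f ≫ ξ' j) ≫ t ≫ Ψ.map (v' j) := by
        rw [Preadditive.comp_sum]
        refine Finset.sum_congr rfl fun j _ => ?_
        rw [← Functor.map_comp_assoc]
        conv_lhs => rw [h1, Functor.map_sum, Preadditive.sum_comp]
        simp only [Functor.map_comp, Category.assoc]
    _ = ∑ i, ∑ j, Φ.map (ξ i) ≫ t ≫ Ψ.map (v i ≫ f ≫ ξ' j) ≫ Ψ.map (v' j) := by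
        rw [Finset.sum_comm]
        refine Finset.sum_congr rfl fun i _ => Finset.sum_congr rfl fun j _ => ?_
        rw [reassoc_of% (ht (v i ≫ f ≫ ξ' j))]
    _ = _ := by
        rw [Preadditive.sum_comp]
        refine Finset.sum_congr rfl fun i _ => ?_
        rw [Category.assoc, Category.assoc, ← Ψ.map_comp, h2, Functor.map_sum, Preadditive.comp_sum,
          Preadditive.comp_sum]
        simp only [Functor.map_comp, Category.assoc]

omit [Ψ.Additive] in
variable {Φ Ψ} in
lemma extend_comp {t : Φ.obj (𝟙_ _) ⟶ Ψ.obj (𝟙_ _)} {t' : Ψ.obj (𝟙_ _) ⟶ Φ.obj (𝟙_ _)}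
    (ht : ∀ c : 𝟙_ (FGModuleCat k) ⟶ 𝟙_ _, Φ.map c ≫ t = t ≫ Ψ.map c) (htt' : t ≫ t' = 𝟙 _)
    {W : FGModuleCat k} {m : ℕ} {v : Fin m → (𝟙_ (FGModuleCat k) ⟶ W)} {ξ : Fin m → (W ⟶ 𝟙_ _)}
    (h : ∑ i, ξ i ≫ v i = 𝟙 W) :
    (∑ i, Φ.map (ξ i) ≫ t ≫ Ψ.map (v i)) ≫ (∑ j, Ψ.map (ξ j) ≫ t' ≫ Φ.map (v j)) =
      𝟙 (Φ.obj W) := by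
  calc (∑ i, Φ.map (ξ i) ≫ t ≫ Ψ.map (v i)) ≫ (∑ j, Ψ.map (ξ j) ≫ t' ≫ Φ.map (v j))
      = ∑ i, ∑ j, Φ.map (ξ i ≫ v i) ≫ Φ.map (ξ j ≫ v j) := by
        rw [Preadditive.sum_comp]
        refine Finset.sum_congr rfl fun i _ => ?_
        rw [Preadditive.comp_sum]
        refine Finset.sum_congr rfl fun j _ => ?_
        have := ht (v i ≫ ξ j)
        simp only [Functor.map_comp, Category.assoc] at this ⊢
        rw [← reassoc_of% this, reassoc_of% htt']
    _ = 𝟙 _ := by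
        simp only [← Preadditive.comp_sum, ← Preadditive.sum_comp, ← Functor.map_sum]
        rw [h]
        simp only [CategoryTheory.Functor.map_id, Category.comp_id]

/-- The natural isomorphism between additive functors on finite-dimensional vector spaces induced by
an isomorphism between their values at the unit. -/
def extendIso (t : Φ.obj (𝟙_ _) ≅ Ψ.obj (𝟙_ _))
    (ht : ∀ c : 𝟙_ (FGModuleCat k) ⟶ 𝟙_ _, Φ.map c ≫ t.hom = t.hom ≫ Ψ.map c) : Φ ≅ Ψ where
  hom :=
    { app := fun W => ∑ j, Φ.map ((exists_resolution W).choose_spec.choose_spec.choose j) ≫ t.hom ≫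
        Ψ.map ((exists_resolution W).choose_spec.choose j)
      naturality := fun W W' f =>
        extend_natural ht f (exists_resolution W).choose_spec.choose_spec.choose_spec
          (exists_resolution W').choose_spec.choose_spec.choose_spec }
  inv :=
    { app := fun W => ∑ j, Ψ.map ((exists_resolution W).choose_spec.choose_spec.choose j) ≫ t.inv ≫
        Φ.map ((exists_resolution W).choose_spec.choose j)
      naturality := fun W W' f =>
        extend_natural (fun c => by rw [t.eq_inv_comp, ← reassoc_of% (ht c), t.hom_inv_id, Category.comp_id]) f
          (exists_resolution W).choose_spec.choose_spec.choose_spec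
          (exists_resolution W').choose_spec.choose_spec.choose_spec }
  hom_inv_id := by
    refine NatTrans.ext (funext fun W => ?_)
    exact extend_comp ht t.hom_inv_id (exists_resolution W).choose_spec.choose_spec.choose_spec
  inv_hom_id := by
    refine NatTrans.ext (funext fun W => ?_)
    exact extend_comp
      (fun c => by rw [t.eq_inv_comp, ← reassoc_of% (ht c), t.hom_inv_id, Category.comp_id])
      t.inv_hom_id (exists_resolution W).choose_spec.choose_spec.choose_spec

lemma extendIso_hom_app (t : Φ.obj (𝟙_ _) ≅ Ψ.obj (𝟙_ _))
    (ht : ∀ c : 𝟙_ (FGModuleCat k) ⟶ 𝟙_ _, Φ.map c ≫ t.hom = t.hom ≫ Ψ.map c)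
    (W : FGModuleCat k) : (extendIso Φ Ψ t ht).hom.app W =
      ∑ j, Φ.map ((exists_resolution W).choose_spec.choose_spec.choose j) ≫ t.hom ≫
        Ψ.map ((exists_resolution W).choose_spec.choose j) := rfl

end Extend

end FGModuleCat

/-! ### Free representations of a finite group -/

namespace FDRep

variable (k : Type u) [Field k] (G : Type) [Group G] [Fintype G]

/-- The free representation on a vector space: the functions on the group, with the action by left
translation. -/
def free : FGModuleCat.{u} k ⥤ FDRep k G where
  obj W := FDRep.of (V := G → W)
    { toFun := fun h => LinearMap.funLeft k W (h⁻¹ * ·)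
      map_one' := by ext; simp
      map_mul' := fun h h' => by ext; simp [mul_assoc] }
  map {W W'} f := homMk (LinearMap.compLeft (f.hom.hom : W →ₗ[k] W') G) fun _ _ => rfl

variable {k G}

/-- The functions underlying the elements of a free representation. -/
def freeFun (W : FGModuleCat.{u} k) : ((free k G).obj W : FDRep k G) ≃ₗ[k] (G → W) :=
  LinearEquiv.refl k _

lemma freeFun_ρ (W : FGModuleCat.{u} k) (h : G) (f : (free k G).obj W) (x : G) :
    freeFun W (((free k G).obj W).ρ h f) x = freeFun W f (h⁻¹ * x) := rfl

instance : (free k G).Additive where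

instance : (free k G).Linear k where

/-- Right translation on free representations. -/
def freeShift (s : G) : free k G ⟶ free k G where
  app W := homMk (X := (free k G).obj W) (Y := (free k G).obj W)
    (LinearMap.funLeft k W (· * s⁻¹)) fun h f => funext fun x => by
      change freeFun W f (h⁻¹ * (x * s⁻¹)) = freeFun W f ((h⁻¹ * x) * s⁻¹)
      rw [mul_assoc]

/-- The function supported at one point. -/
def freeSingle (W : FGModuleCat.{u} k) (g : G) : W →ₗ[k] ((free k G).obj W : FDRep k G) :=
  letI := Classical.decEq G
  LinearMap.single k (fun _ : G => (W : Type u)) g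

lemma freeFun_freeSingle_self (W : FGModuleCat.{u} k) (g : G) (w : W) :
    freeFun W (freeSingle W g w) g = w :=
  letI := Classical.decEq G
  Pi.single_eq_same (M := fun _ : G => (W : Type u)) g w

lemma freeFun_freeSingle_of_ne (W : FGModuleCat.{u} k) {g x : G} (h : x ≠ g) (w : W) :
    freeFun W (freeSingle W g w) x = 0 :=
  letI := Classical.decEq G
  Pi.single_eq_of_ne (M := fun _ : G => (W : Type u)) h w

lemma ρ_freeSingle (W : FGModuleCat.{u} k) (h g : G) (w : W) :
    ((free k G).obj W).ρ h (freeSingle W g w) = freeSingle W (h * g) w := by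
  refine (freeFun W).injective (funext fun x => ?_)
  rw [freeFun_ρ]
  by_cases hx : x = h * g
  · rw [hx, inv_mul_cancel_left, freeFun_freeSingle_self, freeFun_freeSingle_self]
  · rw [freeFun_freeSingle_of_ne _ hx, freeFun_freeSingle_of_ne _ fun h' => hx (by
      rw [← h', mul_inv_cancel_left])]

lemma freeShift_freeSingle (W : FGModuleCat.{u} k) (s g : G) (w : W) :
    toLin ((freeShift s).app W) (freeSingle W g w) = freeSingle W (g * s) w := by
  refine (freeFun W).injective (funext fun x => ?_)
  change freeFun W (freeSingle W g w) (x * s⁻¹) = _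
  by_cases hx : x = g * s
  · rw [hx, mul_inv_cancel_right, freeFun_freeSingle_self, freeFun_freeSingle_self]
  · rw [freeFun_freeSingle_of_ne _ hx, freeFun_freeSingle_of_ne _ fun h' => hx (by
      rw [← h', inv_mul_cancel_right])]

lemma sum_freeSingle (W : FGModuleCat.{u} k) (f : (free k G).obj W) :
    ∑ g : G, freeSingle W g (freeFun W f g) = f :=
  letI := Classical.decEq G
  LinearMap.sum_single_apply (fun _ : G => (W : Type u)) f

lemma free_hom_ext {W : FGModuleCat.{u} k} {Z : FDRep k G} {s t : (free k G).obj W ⟶ Z}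
    (h : ∀ w, toLin s (freeSingle W 1 w) = toLin t (freeSingle W 1 w)) : s = t := by
  refine toLin_injective (LinearMap.ext fun f => ?_)
  rw [← sum_freeSingle W f, map_sum, map_sum]
  refine Finset.sum_congr rfl fun g _ => ?_
  rw [← mul_one g, ← ρ_freeSingle, toLin_ρ, toLin_ρ, h]

/-- The morphism from the free representation on the space underlying a representation. -/
def freeπ (V : FDRep k G) : (free k G).obj V.V ⟶ V :=
  homMk (∑ g : G, V.ρ g ∘ₗ LinearMap.proj g ∘ₗ (freeFun V.V).toLinearMap) fun h f => by
    rw [LinearMap.sum_apply, LinearMap.sum_apply, map_sum]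
    refine Fintype.sum_equiv (Equiv.mulLeft h⁻¹) _ _ fun g => ?_
    change V.ρ g (freeFun V.V f (h⁻¹ * g)) = V.ρ h (V.ρ (h⁻¹ * g) (freeFun V.V f (h⁻¹ * g)))
    rw [← Module.End.mul_apply, ← map_mul, mul_inv_cancel_left]

lemma freeπ_freeSingle (V : FDRep k G) (g : G) (v : V) :
    toLin (freeπ V) (freeSingle V.V g v) = V.ρ g v := by
  refine (LinearMap.sum_apply _ _ _).trans ((Finset.sum_eq_single g ?_ ?_).trans ?_)
  · intro x _ hx
    change V.ρ x (freeFun V.V (freeSingle V.V g v) x) = 0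
    rw [freeFun_freeSingle_of_ne _ hx, map_zero]
  · exact fun h => absurd (Finset.mem_univ _) h
  · change V.ρ g (freeFun V.V (freeSingle V.V g v) g) = _
    rw [freeFun_freeSingle_self]

lemma free_map_freeSingle {W W' : FGModuleCat.{u} k} (f : W ⟶ W') (g : G) (w : W) :
    toLin ((free k G).map f) (freeSingle W g w) = freeSingle W' g (f.hom.hom w) := by
  refine (freeFun W').injective (funext fun x => ?_)
  change f.hom.hom (freeFun W (freeSingle W g w) x) = _
  by_cases hx : x = g
  · rw [hx, freeFun_freeSingle_self, freeFun_freeSingle_self]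
  · rw [freeFun_freeSingle_of_ne _ hx, freeFun_freeSingle_of_ne _ hx, map_zero]

lemma freeπ_naturality {V V' : FDRep k G} (f : V ⟶ V') :
    (free k G).map f.hom ≫ freeπ V' = freeπ V ≫ f := by
  refine free_hom_ext fun v => ?_
  rw [toLin_comp_apply, toLin_comp_apply, free_map_freeSingle, freeπ_freeSingle, freeπ_freeSingle,
    toLin_ρ]
  rfl

lemma freeπ_condition (V : FDRep k G) (s : G) :
    ((freeShift s).app V.V - (free k G).map (Action.ρ V s)) ≫ freeπ V = 0 := by
  refine free_hom_ext fun v => ?_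
  rw [toLin_comp_apply, toLin_sub, LinearMap.sub_apply, freeShift_freeSingle, free_map_freeSingle,
    map_sub, freeπ_freeSingle, freeπ_freeSingle, one_mul, map_one, toLin_zero]
  exact sub_self _

end FDRep

end

noncomputable section

open Functor.LaxMonoidal Functor.OplaxMonoidal

/-! ### Cokernels, as a property of composable pairs -/

/-- The morphism `g` is a cokernel of the morphism `f`. -/
structure IsCokernelPair {C : Type u₁} [Category.{v₁} C] [Preadditive C] {X Y Z : C} (f : X ⟶ Y)
    (g : Y ⟶ Z) : Prop where
  condition : f ≫ g = 0
  epi : Epi g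
  exists_desc : ∀ {W : C} (s : Y ⟶ W), f ≫ s = 0 → ∃ t : Z ⟶ W, g ≫ t = s

namespace IsCokernelPair

variable {C : Type u₁} [Category.{v₁} C] [Preadditive C] {X Y Z : C} {f : X ⟶ Y} {g : Y ⟶ Z}

lemma cokernel_π (f : X ⟶ Y) [HasCokernel f] : IsCokernelPair f (cokernel.π f) where
  condition := cokernel.condition f
  epi := inferInstance
  exists_desc s hs := ⟨cokernel.desc f s hs, cokernel.π_desc f s hs⟩

/-- The colimit cocone of a cokernel pair. -/
def isColimit (h : IsCokernelPair f g) : IsColimit (CokernelCofork.ofπ g h.condition) :=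
  haveI := h.epi
  CokernelCofork.IsColimit.ofπ' g h.condition fun s hs =>
    ⟨(h.exists_desc s hs).choose, (h.exists_desc s hs).choose_spec⟩

lemma of_isColimit {c : CokernelCofork f} (hc : IsColimit c) : IsCokernelPair f c.π where
  condition := c.condition
  epi := Cofork.IsColimit.epi hc
  exists_desc s hs := ⟨hc.desc (CokernelCofork.ofπ s hs), Cofork.IsColimit.π_desc hc⟩

lemma map (h : IsCokernelPair f g) {D : Type u₂} [Category.{v₂} D] [Preadditive D] (F : C ⥤ D)
    [F.Additive] [PreservesFiniteColimits F] : IsCokernelPair (F.map f) (F.map g) :=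
  of_isColimit (CokernelCofork.mapIsColimit _ h.isColimit F)

lemma of_iso (h : IsCokernelPair f g) {X' Y' : C} (e : X' ≅ X) (e' : Y' ≅ Y) {f' : X' ⟶ Y'}
    (hf : f' ≫ e'.hom = e.hom ≫ f) : IsCokernelPair f' (e'.hom ≫ g) where
  condition := by rw [reassoc_of% hf, h.condition, comp_zero]
  epi := haveI := h.epi; epi_comp _ _
  exists_desc s hs := by
    obtain ⟨t, ht⟩ := h.exists_desc (e'.inv ≫ s) (by
      rw [← cancel_epi e.hom, ← reassoc_of% hf, e'.hom_inv_id_assoc, hs, comp_zero])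
    exact ⟨t, by rw [Category.assoc, ht, e'.hom_inv_id_assoc]⟩

lemma exists_iso (h : IsCokernelPair f g) {Z' : C} {g' : Y ⟶ Z'} (h' : IsCokernelPair f g') :
    ∃ e : Z ≅ Z', g ≫ e.hom = g' := by
  obtain ⟨t, ht⟩ := h.exists_desc g' h'.condition
  obtain ⟨t', ht'⟩ := h'.exists_desc g h.condition
  have := h.epi
  have := h'.epi
  exact ⟨⟨t, t', by rw [← cancel_epi g, reassoc_of% ht, ht', Category.comp_id],
    by rw [← cancel_epi g', reassoc_of% ht', ht, Category.comp_id]⟩, ht⟩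

lemma preservesFiniteColimits {A : Type u₁} [Category.{v₁} A] [Abelian A] {D : Type u₂}
    [Category.{v₂} D] [Abelian D] (F : A ⥤ D) [F.Additive]
    (h : ∀ {X Y Z : A} {f : X ⟶ Y} {g : Y ⟶ Z}, IsCokernelPair f g →
      IsCokernelPair (F.map f) (F.map g)) : PreservesFiniteColimits F :=
  (F.preservesFiniteColimits_tfae.out 2 3).1 fun {X Y} f =>
    preservesColimit_of_preserves_colimit_cocone (cokernelIsCokernel f)
      ((CokernelCofork.isColimitMapCoconeEquiv _ F).symm (h (cokernel_π f)).isColimit)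

end IsCokernelPair

namespace FDRep

variable {k : Type u} [Field k] {G : Type} [Group G] [Fintype G]

/-- `V` is the quotient of the free representation on `V` by the relations `[g s] ⊗ v = [g] ⊗ s v`.
Because `s` generates, this single family of relations gives those for all group elements. -/
lemma isCokernelPair_freeπ {s : G} (hs : ∀ g : G, ∃ N : ℕ, s ^ N = g) (V : FDRep k G) :
    IsCokernelPair ((freeShift s).app V.V - (free k G).map (Action.ρ V s)) (freeπ V) where
  condition := freeπ_condition V s
  epi := (epi_iff_surjective _).2 fun v =>
    ⟨freeSingle V.V 1 v, by rw [freeπ_freeSingle, map_one, Module.End.one_apply]⟩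
  exists_desc {W} t ht := by
    have h1 : ∀ g v, toLin t (freeSingle V.V (g * s) v) = toLin t (freeSingle V.V g (V.ρ s v)) :=
      fun g v => by
        have := LinearMap.congr_fun (congrArg toLin ht) (freeSingle V.V g v)
        rw [toLin_comp_apply, toLin_sub, LinearMap.sub_apply, freeShift_freeSingle,
          free_map_freeSingle, map_sub, toLin_zero] at this
        exact sub_eq_zero.1 this
    -- The relation is propagated from `s` to its powers; these exhaust the group by `hs`.
    have h2 : ∀ (N : ℕ) v, toLin t (freeSingle V.V (s ^ N) v) =
        toLin t (freeSingle V.V 1 (V.ρ (s ^ N) v)) := fun N => by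
      induction N with
      | zero => intro v; rw [pow_zero, map_one, Module.End.one_apply]
      | succ N ih =>
        intro v
        rw [pow_succ, h1, ih, map_mul, Module.End.mul_apply]
    have h3 : ∀ g v, toLin t (freeSingle V.V g v) = toLin t (freeSingle V.V 1 (V.ρ g v)) :=
      fun g v => by obtain ⟨N, rfl⟩ := hs g; exact h2 N v
    refine ⟨homMk (toLin t ∘ₗ freeSingle V.V 1) fun g v => ?_, free_hom_ext fun v => ?_⟩
    · rw [LinearMap.comp_apply, LinearMap.comp_apply, ← toLin_ρ, ρ_freeSingle, mul_one, h3 g]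
    · rw [toLin_comp_apply, freeπ_freeSingle, map_one, Module.End.one_apply]
      rfl

end FDRep

section UnitTensor

variable {k : Type u} [Field k] {S : Type u₂} [Category.{v₂} S] [MonoidalCategory S]
  (J : FGModuleCat.{u} k ⥤ S) [J.Monoidal]

/-- The isomorphism `J 𝟙 ⊗ Y ≅ Y`. -/
def unitTensorIso (Y : S) : J.obj (𝟙_ _) ⊗ Y ≅ Y :=
  whiskerRightIso (Functor.Monoidal.εIso J).symm Y ≪≫ λ_ Y

lemma unitTensorIso_naturality {Y Y' : S} (f : Y ⟶ Y') :
    J.obj (𝟙_ _) ◁ f ≫ (unitTensorIso J Y').hom = (unitTensorIso J Y).hom ≫ f := by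
  simp [unitTensorIso, whisker_exchange_assoc]

end UnitTensor

/-! ### Bifunctors on representations and a monoidal category -/

section Bifunctor

open FDRep

variable {k : Type u} [Field k] {G : Type} [Group G] [Fintype G]
  {S : Type u₂} [Category.{v₂} S] [Abelian S] [Linear k S] [MonoidalCategory S]
  [MonoidalPreadditive S] [MonoidalLinear k S] (J : FGModuleCat.{u} k ⥤ S) [J.Monoidal]
  [J.Additive] [J.Linear k]

variable {E : Type u₃} [Category.{v₃} E] [Abelian E] [Linear k E]
  (B : FDRep k G × S ⥤ E)

/-- The value of a bifunctor at two morphisms. -/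
abbrev bimap {V V' : FDRep k G} {Y Y' : S} (f : V ⟶ V') (g : Y ⟶ Y') :
    B.obj (V, Y) ⟶ B.obj (V', Y') := B.map (Prod.mkHom f g)

omit [Fintype G] [Abelian S] [Linear k S] [MonoidalCategory S] [MonoidalPreadditive S]
  [MonoidalLinear k S] [Abelian E] [Linear k E] in
lemma bimap_comp {V V' V'' : FDRep k G} {Y Y' Y'' : S} (f : V ⟶ V') (g : Y ⟶ Y') (f' : V' ⟶ V'')
    (g' : Y' ⟶ Y'') : bimap B f g ≫ bimap B f' g' = bimap B (f ≫ f') (g ≫ g') :=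
  (B.map_comp _ _).symm

omit [Fintype G] [Abelian S] [Linear k S] [MonoidalCategory S] [MonoidalPreadditive S]
  [MonoidalLinear k S] [Abelian E] [Linear k E] in
lemma bimap_id (V : FDRep k G) (Y : S) : bimap B (𝟙 V) (𝟙 Y) = 𝟙 _ := B.map_id _

variable {B} (hB : IsBilinearRightExact k B)

include hB

omit [Fintype G] [MonoidalCategory S] [MonoidalPreadditive S] [MonoidalLinear k S] in
lemma bimap_sub_left {V V' : FDRep k G} (Y : S) (f f' : V ⟶ V') :
    bimap B (f - f') (𝟙 Y) = bimap B f (𝟙 Y) - bimap B f' (𝟙 Y) :=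
  haveI := (hB.left Y).additive
  (Prod.sectL (FDRep k G) Y ⋙ B).map_sub

omit [Fintype G] [MonoidalCategory S] [MonoidalPreadditive S] [MonoidalLinear k S] in
lemma bimap_smul_right (V : FDRep k G) {Y Y' : S} (a : k) (f : Y ⟶ Y') :
    bimap B (𝟙 V) (a • f) = a • bimap B (𝟙 V) f :=
  haveI := (hB.right V).linear
  (Prod.sectR V S ⋙ B).map_smul a f

omit [Fintype G] [MonoidalCategory S] [MonoidalPreadditive S] [MonoidalLinear k S] in
lemma bimap_add_right (V : FDRep k G) {Y Y' : S} (f f' : Y ⟶ Y') :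
    bimap B (𝟙 V) (f + f') = bimap B (𝟙 V) f + bimap B (𝟙 V) f' :=
  haveI := (hB.right V).additive
  (Prod.sectR V S ⋙ B).map_add

omit [J.Additive] in
lemma map_unitTensorIso_comm (Y : S) (c : 𝟙_ (FGModuleCat.{u} k) ⟶ 𝟙_ _) :
    (J ⋙ tensorRight Y ⋙ Prod.sectR ((free k G).obj (𝟙_ _)) S ⋙ B).map c ≫
      (B.mapIso (Iso.prod (Iso.refl ((free k G).obj (𝟙_ _))) (unitTensorIso J Y))).hom =
    (B.mapIso (Iso.prod (Iso.refl ((free k G).obj (𝟙_ _))) (unitTensorIso J Y))).hom ≫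
      (free k G ⋙ Prod.sectL (FDRep k G) Y ⋙ B).map c := by
  have := (hB.left Y).linear
  have := (hB.right ((free k G).obj (𝟙_ _))).linear
  obtain ⟨a, rfl⟩ := FGModuleCat.end_unit_eq_smul c
  simp only [Functor.map_smul, CategoryTheory.Functor.map_id]
  exact (Linear.smul_comp _ _ _ _ _ _).trans ((congrArg (a • ·) ((Category.id_comp _).trans
    (Category.comp_id _).symm)).trans (Linear.comp_smul _ _ _ _ _ _).symm)

/-- The natural isomorphism `B(k[G], J W ⊗ Y) ≅ B(free W, Y)`. -/
def bifunctorFreeIso (Y : S) :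
    J ⋙ tensorRight Y ⋙ Prod.sectR ((free k G).obj (𝟙_ _)) S ⋙ B ≅
      free k G ⋙ Prod.sectL (FDRep k G) Y ⋙ B :=
  haveI := (hB.left Y).additive
  haveI := (hB.right ((free k G).obj (𝟙_ _))).additive
  FGModuleCat.extendIso _ _
    (B.mapIso (Iso.prod (Iso.refl ((free k G).obj (𝟙_ _))) (unitTensorIso J Y)))
    (map_unitTensorIso_comm J hB Y)

/-- The isomorphism `B(k[G], J W ⊗ Y) ≅ B(free W, Y)`. -/
def bifunctorFree (W : FGModuleCat.{u} k) (Y : S) :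
    B.obj ((free k G).obj (𝟙_ _), J.obj W ⊗ Y) ≅ B.obj ((free k G).obj W, Y) :=
  (bifunctorFreeIso J hB Y).app W

lemma bifunctorFree_hom_app (W : FGModuleCat.{u} k) (Y : S) :
    (bifunctorFree J hB W Y).hom =
      ∑ i, bimap B ((free k G).map ((FGModuleCat.exists_resolution W).choose_spec.choose i))
        (J.map ((FGModuleCat.exists_resolution W).choose_spec.choose_spec.choose i) ▷ Y ≫
          (unitTensorIso J Y).hom) := by
  have := (hB.left Y).additive
  have := (hB.right ((free k G).obj (𝟙_ _))).additive
  refine (FGModuleCat.extendIso_hom_app _ _ _ (map_unitTensorIso_comm J hB Y) W).trans (Finset.sum_congr rfl fun i _ => ?_)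
  change bimap B (𝟙 _) _ ≫ bimap B (𝟙 _) _ ≫ bimap B _ (𝟙 _) = _
  simp only [bimap_comp, Category.id_comp, Category.comp_id]
  rfl

/-- The composite `B(k[G], J V ⊗ Y) ≅ B(free V, Y) ⟶ B(V, Y)`. -/
def bifunctorπ (V : FDRep k G) (Y : S) :
    B.obj ((free k G).obj (𝟙_ _), J.obj V.V ⊗ Y) ⟶ B.obj (V, Y) :=
  (bifunctorFree J hB V.V Y).hom ≫ bimap B (freeπ V) (𝟙 Y)

lemma bifunctorπ_eq (V : FDRep k G) (Y : S) : bifunctorπ J hB V Y =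
    ∑ i, bimap B ((free k G).map ((FGModuleCat.exists_resolution V.V).choose_spec.choose i) ≫
        freeπ V)
      (J.map ((FGModuleCat.exists_resolution V.V).choose_spec.choose_spec.choose i) ▷ Y ≫
        (unitTensorIso J Y).hom) := by
  rw [bifunctorπ, bifunctorFree_hom_app, Preadditive.sum_comp]
  simp only [bimap_comp, Category.comp_id]

lemma bifunctorFree_naturality_left {W W' : FGModuleCat.{u} k} (f : W ⟶ W') (Y : S) :
    bimap B (𝟙 _) (J.map f ▷ Y) ≫ (bifunctorFree J hB W' Y).hom =
      (bifunctorFree J hB W Y).hom ≫ bimap B ((free k G).map f) (𝟙 Y) :=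
  (bifunctorFreeIso J hB Y).hom.naturality f

lemma bifunctorFree_naturality_right (W : FGModuleCat.{u} k) {Y Y' : S} (g : Y ⟶ Y') :
    bimap B (𝟙 _) (J.obj W ◁ g) ≫ (bifunctorFree J hB W Y').hom =
      (bifunctorFree J hB W Y).hom ≫ bimap B (𝟙 _) g := by
  rw [bifunctorFree_hom_app, bifunctorFree_hom_app, Preadditive.sum_comp,
    Preadditive.comp_sum]
  refine Finset.sum_congr rfl fun i _ => ?_
  rw [bimap_comp, bimap_comp, Category.id_comp, Category.comp_id, whisker_exchange_assoc,
    unitTensorIso_naturality, Category.assoc]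

lemma bifunctorFree_naturality_shift (W : FGModuleCat.{u} k) (Y : S) (s : G) :
    bimap B ((freeShift s).app (𝟙_ _)) (𝟙 (J.obj W ⊗ Y)) ≫ (bifunctorFree J hB W Y).hom =
      (bifunctorFree J hB W Y).hom ≫ bimap B ((freeShift s).app W) (𝟙 Y) := by
  rw [bifunctorFree_hom_app, Preadditive.sum_comp, Preadditive.comp_sum]
  refine Finset.sum_congr rfl fun i _ => ?_
  rw [bimap_comp, bimap_comp, Category.id_comp, Category.comp_id, (freeShift s).naturality]

lemma bifunctorπ_naturality {V V' : FDRep k G} {Y Y' : S} (f : V ⟶ V') (g : Y ⟶ Y') :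
    bimap B (𝟙 _) (J.map f.hom ⊗ₘ g) ≫ bifunctorπ J hB V' Y' =
      bifunctorπ J hB V Y ≫ bimap B f g := by
  have h1 : bimap B (𝟙 ((free k G).obj (𝟙_ _))) (J.map f.hom ⊗ₘ g) =
      bimap B (𝟙 _) (J.map f.hom ▷ Y) ≫ bimap B (𝟙 _) (J.obj V'.V ◁ g) := by
    rw [bimap_comp, Category.id_comp, MonoidalCategory.tensorHom_def]
  rw [bifunctorπ, bifunctorπ, h1, Category.assoc,
    reassoc_of% (bifunctorFree_naturality_right J hB V'.V g),
    reassoc_of% (bifunctorFree_naturality_left J hB f.hom Y), Category.assoc, bimap_comp,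
    bimap_comp, bimap_comp, Category.id_comp, Category.comp_id, Category.id_comp, freeπ_naturality]

/-- Apply the right exact functor `B(-, Y)` to the free presentation of `V` and move the vector
space to the second variable. The result depends on `V` and `Y` only through the equivariant object
`J V ⊗ Y`, so it prescribes the functor induced by `B`. -/
lemma isCokernelPair_bifunctorπ {s : G} (hs : ∀ g : G, ∃ N : ℕ, s ^ N = g) (V : FDRep k G) (Y : S) :
    IsCokernelPair (bimap B ((freeShift s).app (𝟙_ _)) (𝟙 (J.obj V.V ⊗ Y)) -
      bimap B (𝟙 _) (J.map (Action.ρ V s) ▷ Y)) (bifunctorπ J hB V Y) := by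
  have := (hB.left Y).additive
  have := (hB.left Y).preservesFiniteColimits
  refine ((isCokernelPair_freeπ hs V).map (Prod.sectL (FDRep k G) Y ⋙ B)).of_iso
    (bifunctorFree J hB V.V Y) (bifunctorFree J hB V.V Y) ?_
  change _ ≫ (bifunctorFree J hB V.V Y).hom =
    (bifunctorFree J hB V.V Y).hom ≫ bimap B _ (𝟙 Y)
  rw [bimap_sub_left hB, Preadditive.sub_comp, Preadditive.comp_sub,
    bifunctorFree_naturality_shift, bifunctorFree_naturality_left]

end Bifunctor

end

noncomputable section

open Functor.LaxMonoidal Functor.OplaxMonoidal FDRep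

/-! ### Elements and coelements -/

section Elements

variable {k : Type u} [Field k] {S : Type u₂} [Category.{v₂} S] [MonoidalCategory S] (J : FGModuleCat.{u} k ⥤ S) [J.Monoidal]

/-- The morphism `Y ⟶ J W ⊗ Y` given by an element of `W`. -/
def eltTensor {W : FGModuleCat.{u} k} (v : 𝟙_ _ ⟶ W) (Y : S) : Y ⟶ J.obj W ⊗ Y :=
  (unitTensorIso J Y).inv ≫ J.map v ▷ Y

/-- The morphism `J W ⊗ Y ⟶ Y` given by a linear form on `W`. -/
def coeltTensor {W : FGModuleCat.{u} k} (ξ : W ⟶ 𝟙_ _) (Y : S) : J.obj W ⊗ Y ⟶ Y :=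
  J.map ξ ▷ Y ≫ (unitTensorIso J Y).hom

lemma eltTensor_comp {W W' : FGModuleCat.{u} k} (v : 𝟙_ _ ⟶ W) (f : W ⟶ W') (Y : S) :
    eltTensor J v Y ≫ J.map f ▷ Y = eltTensor J (v ≫ f) Y := by
  rw [eltTensor, eltTensor, Category.assoc, J.map_comp, comp_whiskerRight]

lemma comp_coeltTensor {W W' : FGModuleCat.{u} k} (f : W ⟶ W') (ξ : W' ⟶ 𝟙_ _) (Y : S) :
    J.map f ▷ Y ≫ coeltTensor J ξ Y = coeltTensor J (f ≫ ξ) Y := by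
  rw [coeltTensor, coeltTensor, J.map_comp, comp_whiskerRight, Category.assoc]

lemma coeltTensor_eltTensor {W W' : FGModuleCat.{u} k} (ξ : W ⟶ 𝟙_ _) (v : 𝟙_ _ ⟶ W') (Y : S) :
    coeltTensor J ξ Y ≫ eltTensor J v Y = J.map (ξ ≫ v) ▷ Y := by
  rw [coeltTensor, eltTensor, Category.assoc, Iso.hom_inv_id_assoc, J.map_comp, comp_whiskerRight]

lemma eltTensor_coeltTensor {W : FGModuleCat.{u} k} (v : 𝟙_ _ ⟶ W) (ξ : W ⟶ 𝟙_ _) (Y : S) :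
    eltTensor J v Y ≫ coeltTensor J ξ Y =
      (unitTensorIso J Y).inv ≫ J.map (v ≫ ξ) ▷ Y ≫ (unitTensorIso J Y).hom := by
  rw [coeltTensor, eltTensor, Category.assoc, J.map_comp, comp_whiskerRight, Category.assoc]

lemma eltTensor_naturality {W : FGModuleCat.{u} k} (v : 𝟙_ _ ⟶ W) {Y Y' : S} (f : Y ⟶ Y') :
    eltTensor J v Y ≫ J.obj W ◁ f = f ≫ eltTensor J v Y' := by
  rw [eltTensor, eltTensor, Category.assoc, ← whisker_exchange, ← Category.assoc, ← Category.assoc]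
  congr 1
  rw [Iso.inv_comp_eq, ← Category.assoc, ← unitTensorIso_naturality, Category.assoc,
    Iso.hom_inv_id, Category.comp_id]

end Elements

namespace FDRep

variable {k : Type u} [Field k] {G : Type} [Group G] [Fintype G]

/-- The basis elements of the regular representation. -/
def regularElt (k : Type u) [Field k] {G : Type} [Group G] [Fintype G] (g : G) :
    𝟙_ (FGModuleCat k) ⟶ ((free k G).obj (𝟙_ (FGModuleCat k))).V :=
  FGModuleCat.ofHom (freeSingle (𝟙_ (FGModuleCat k)) g)

/-- The coordinates of the regular representation. -/
def regularCoelt (k : Type u) [Field k] {G : Type} [Group G] [Fintype G] (g : G) :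
    ((free k G).obj (𝟙_ (FGModuleCat k))).V ⟶ 𝟙_ (FGModuleCat k) :=
  FGModuleCat.ofHom (LinearMap.proj g ∘ₗ (freeFun (𝟙_ (FGModuleCat k))).toLinearMap)

lemma regularElt_regularCoelt_self (g : G) : regularElt k g ≫ regularCoelt k g = 𝟙 _ :=
  FGModuleCat.hom_ext (LinearMap.ext fun w => freeFun_freeSingle_self _ g w)

lemma regularElt_regularCoelt_of_ne {g h : G} (hgh : h ≠ g) :
    regularElt k g ≫ regularCoelt k h = 0 :=
  FGModuleCat.hom_ext (LinearMap.ext fun w => freeFun_freeSingle_of_ne _ hgh w)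

lemma sum_regularCoelt_regularElt : ∑ g : G, regularCoelt k g ≫ regularElt k g = 𝟙 _ := by
  refine FGModuleCat.hom_ext (LinearMap.ext fun f => ?_)
  have h : ((∑ g : G, regularCoelt k g ≫ regularElt k g : _ ⟶ _)).hom.hom =
      ∑ g : G, (regularCoelt k g ≫ regularElt k g).hom.hom :=
    map_sum (AddMonoidHom.mk' (fun f : ((free k G).obj (𝟙_ (FGModuleCat k))).V ⟶
      ((free k G).obj (𝟙_ (FGModuleCat k))).V => f.hom.hom) fun _ _ => rfl) _ _
  refine (LinearMap.congr_fun h f).trans ?_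
  rw [LinearMap.sum_apply]
  exact sum_freeSingle (𝟙_ (FGModuleCat k)) f

lemma regularElt_ρ (h g : G) : regularElt k g ≫ Action.ρ ((free k G).obj (𝟙_ _)) h =
    regularElt k (h * g) :=
  FGModuleCat.hom_ext (LinearMap.ext fun w => ρ_freeSingle (𝟙_ (FGModuleCat k)) h g w)

lemma ρ_regularCoelt (h g : G) : Action.ρ ((free k G).obj (𝟙_ _)) h ≫ regularCoelt k g =
    regularCoelt k (h⁻¹ * g) := rfl

lemma regularElt_freeShift (s g : G) : regularElt k g ≫ ((freeShift s).app (𝟙_ _)).hom =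
    regularElt k (g * s) :=
  FGModuleCat.hom_ext (LinearMap.ext fun w => freeShift_freeSingle (𝟙_ (FGModuleCat k)) s g w)

lemma regularElt_freeπ {V : FDRep k G} (v : 𝟙_ (FGModuleCat k) ⟶ V.V) :
    regularElt k 1 ≫ ((free k G).map v ≫ freeπ V).hom = v := by
  refine FGModuleCat.hom_ext (LinearMap.ext fun w => ?_)
  change toLin (freeπ V) (toLin ((free k G).map v) (freeSingle (𝟙_ (FGModuleCat k)) 1 w)) = _
  rw [free_map_freeSingle, freeπ_freeSingle, map_one]
  rfl

end FDRep

/-! ### The bifunctor to equivariant objects -/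

section DeligneTensor

variable {k : Type u} [Field k] {G : Type} [Group G] [Fintype G]
  {S : Type u₂} [Category.{v₂} S] [MonoidalCategory S]

/-- The functor giving an object the trivial action. -/
def trivialAction (S : Type u₂) [Category.{v₂} S] (G : Type) [Monoid G] : S ⥤ Action S G :=
  (𝟭 S).equivariantLift (1 : G →* End (𝟭 S))

instance : (trivialAction S G).Monoidal :=
  (𝟭 S).equivariantLiftMonoidal 1 fun _ =>
    inferInstanceAs (NatTrans.IsMonoidal (𝟙 (𝟭 S)))

instance [Preadditive S] : (trivialAction S G).Additive :=
  inferInstanceAs (Functor.equivariantLift (𝟭 S) _).Additive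

instance [Preadditive S] [Linear k S] : (trivialAction S G).Linear k :=
  inferInstanceAs ((Functor.equivariantLift (𝟭 S) _).Linear k)

variable (J : FGModuleCat.{u} k ⥤ S) 

/-- The bifunctor `(V, Y) ↦ J V ⊗ Y` to equivariant objects. -/
def deligneTensor (G : Type) [Group G] : FDRep k G × S ⥤ Action S G :=
  (J.mapAction G).prod (trivialAction S G) ⋙ tensor (Action S G)

instance [BraidedCategory S] [J.Monoidal] : (deligneTensor J G).Monoidal :=
  inferInstanceAs ((J.mapAction G).prod (trivialAction S G) ⋙ tensor (Action S G)).Monoidal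

omit [Fintype G] in
lemma deligneTensor_ρ (V : FDRep k G) (Y : S) (g : G) :
    ((deligneTensor J G).obj (V, Y)).ρ g = (J.map (Action.ρ V g) ▷ Y : J.obj V.V ⊗ Y ⟶ _) := by
  rw [← tensorHom_id]
  rfl

omit [Fintype G] in
lemma deligneTensor_map_hom {V V' : FDRep k G} {Y Y' : S} (f : V ⟶ V') (g : Y ⟶ Y') :
    (bimap (deligneTensor J G) f g).hom = J.map f.hom ⊗ₘ g := rfl

variable [Abelian S] [Linear k S] [MonoidalPreadditive S] [MonoidalLinear k S] [J.Monoidal]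
  [J.Additive] [J.Linear k]

omit [Linear k S] [MonoidalLinear k S] [Functor.Linear k J] in
lemma eltTensor_hom_ext {Y Z : S}
    {a b : J.obj ((free k G).obj (𝟙_ (FGModuleCat k))).V ⊗ Y ⟶ Z}
    (h : ∀ g : G, eltTensor J (regularElt k g) Y ≫ a = eltTensor J (regularElt k g) Y ≫ b) :
    a = b := by
  have h1 : ∑ g : G, coeltTensor J (regularCoelt k g) Y ≫ eltTensor J (regularElt k g) Y = 𝟙 _ := by
    simp only [coeltTensor_eltTensor]
    rw [← sum_whiskerRight, ← Functor.map_sum, sum_regularCoelt_regularElt, J.map_id,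
      id_whiskerRight]
  rw [← Category.id_comp a, ← Category.id_comp b, ← h1, Preadditive.sum_comp, Preadditive.sum_comp]
  refine Finset.sum_congr rfl fun g _ => ?_
  rw [Category.assoc, Category.assoc, h]

/-- The inclusion of an object in the equivariant object that it induces. -/
def inducedι (G : Type) [Group G] [Fintype G] (Y : S) :
    Y ⟶ ((deligneTensor J G).obj ((free k G).obj (𝟙_ _), Y)).V :=
  eltTensor J (regularElt k 1) Y

omit [Abelian S] [Linear k S] [MonoidalPreadditive S] [MonoidalLinear k S] [J.Additive]
  [Functor.Linear k J] in
lemma inducedι_ρ (Y : S) (g : G) :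
    inducedι J G Y ≫ ((deligneTensor J G).obj ((free k G).obj (𝟙_ _), Y)).ρ g =
      eltTensor J (regularElt k g) Y := by
  rw [deligneTensor_ρ]
  refine (eltTensor_comp J _ _ _).trans ?_
  rw [regularElt_ρ, mul_one]

omit [Abelian S] [Linear k S] [MonoidalPreadditive S] [MonoidalLinear k S] [J.Additive]
  [Functor.Linear k J] in
lemma inducedι_bimap {Y Y' : S} {V : FDRep k G} (f : (free k G).obj (𝟙_ _) ⟶ V) (g : Y ⟶ Y') :
    inducedι J G Y ≫ (bimap (deligneTensor J G) f g).hom =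
      g ≫ eltTensor J (regularElt k 1 ≫ f.hom) Y' := by
  rw [deligneTensor_map_hom, MonoidalCategory.tensorHom_def']
  refine (Category.assoc _ _ _).symm.trans ((congrArg (· ≫ J.map f.hom ▷ Y')
    (eltTensor_naturality J (regularElt k 1) g)).trans ?_)
  rw [Category.assoc, eltTensor_comp]

omit [Abelian S] [Linear k S] [MonoidalPreadditive S] [MonoidalLinear k S] [J.Additive]
  [Functor.Linear k J] in
lemma inducedι_bimap_id {Y Y' : S} (g : Y ⟶ Y') :
    inducedι J G Y ≫ (bimap (deligneTensor J G) (𝟙 _) g).hom = g ≫ inducedι J G Y' := by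
  rw [inducedι_bimap, Action.id_hom, Category.comp_id]
  rfl

omit [Abelian S] [Linear k S] [MonoidalPreadditive S] [MonoidalLinear k S] [J.Additive]
  [Functor.Linear k J] in
lemma inducedι_bimap_shift (s : G) (Y : S) :
    inducedι J G Y ≫ (bimap (deligneTensor J G) ((freeShift s).app (𝟙_ _)) (𝟙 Y)).hom =
      inducedι J G Y ≫ ((deligneTensor J G).obj ((free k G).obj (𝟙_ _), Y)).ρ s := by
  rw [inducedι_bimap, inducedι_ρ, Category.id_comp, regularElt_freeShift, one_mul]

-- The uniqueness part of Frobenius reciprocity: the translates of the component at the neutral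
-- element cover the induced object.
omit [Linear k S] [MonoidalLinear k S] [Functor.Linear k J] in
lemma inducedι_hom_ext {Y : S} {X : Action S G}
    {a b : (deligneTensor J G).obj ((free k G).obj (𝟙_ _), Y) ⟶ X}
    (h : inducedι J G Y ≫ a.hom = inducedι J G Y ≫ b.hom) : a = b := by
  refine Action.Hom.ext (eltTensor_hom_ext J fun g => ?_)
  have h2 : ∀ c : (deligneTensor J G).obj ((free k G).obj (𝟙_ _), Y) ⟶ X,
      (inducedι J G Y ≫ ((deligneTensor J G).obj ((free k G).obj (𝟙_ _), Y)).ρ g) ≫ c.hom =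
        (inducedι J G Y ≫ c.hom) ≫ X.ρ g := fun c => by
    rw [Category.assoc, c.comm, Category.assoc]
  exact ((congrArg (· ≫ a.hom) (inducedι_ρ J Y g)).symm.trans (h2 a)).trans
    ((congrArg (· ≫ X.ρ g) h).trans
      ((congrArg (· ≫ b.hom) (inducedι_ρ J Y g)).symm.trans (h2 b)).symm)

/-- The morphism underlying `inducedπ`. -/
def inducedHom (X : Action S G) :
    J.obj ((free k G).obj (𝟙_ (FGModuleCat k))).V ⊗ X.V ⟶ X.V :=
  ∑ g : G, coeltTensor J (regularCoelt k g) X.V ≫ X.ρ g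

omit [Linear k S] [MonoidalPreadditive S] [MonoidalLinear k S] [J.Additive]
  [Functor.Linear k J] in
lemma inducedHom_comm (X : Action S G) (h : G) :
    J.map (Action.ρ ((free k G).obj (𝟙_ _)) h) ▷ X.V ≫ inducedHom J X =
      inducedHom J X ≫ X.ρ h := by
  rw [inducedHom, Preadditive.comp_sum, Preadditive.sum_comp]
  refine Fintype.sum_equiv (Equiv.mulLeft h⁻¹) _ _ fun g => ?_
  rw [Equiv.coe_mulLeft, ← Category.assoc, comp_coeltTensor, ρ_regularCoelt, Category.assoc,
    ← Action.ρ_mul_eq_comp, mul_inv_cancel_left]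

omit [Linear k S] [MonoidalLinear k S] [Functor.Linear k J] in
lemma eltTensor_inducedHom (X : Action S G) :
    eltTensor J (regularElt k 1) X.V ≫ inducedHom J X = 𝟙 X.V := by
  rw [inducedHom, Preadditive.comp_sum, Finset.sum_eq_single 1]
  · rw [Action.ρ_one, Category.comp_id, eltTensor_coeltTensor, regularElt_regularCoelt_self,
      J.map_id, id_whiskerRight, Category.id_comp, Iso.inv_hom_id]
  · intro g _ hg
    rw [← Category.assoc, eltTensor_coeltTensor, regularElt_regularCoelt_of_ne hg, J.map_zero,
      MonoidalPreadditive.zero_whiskerRight, zero_comp, comp_zero, zero_comp]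
  · exact fun h => absurd (Finset.mem_univ _) h

/-- The morphism to an equivariant object from the one induced from its underlying object. -/
def inducedπ (X : Action S G) :
    (deligneTensor J G).obj ((free k G).obj (𝟙_ _), X.V) ⟶ X where
  hom := inducedHom J X
  comm h := (congrArg (· ≫ inducedHom J X) (deligneTensor_ρ J _ _ h)).trans (inducedHom_comm J X h)

omit [Linear k S] [MonoidalLinear k S] [Functor.Linear k J] in
lemma inducedι_inducedπ (X : Action S G) : inducedι J G X.V ≫ (inducedπ J X).hom = 𝟙 X.V :=
  eltTensor_inducedHom J X

omit [Linear k S] [MonoidalLinear k S] [Functor.Linear k J] in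
lemma inducedπ_naturality {X X' : Action S G} (f : X ⟶ X') :
    bimap (deligneTensor J G) (𝟙 _) f.hom ≫ inducedπ J X' = inducedπ J X ≫ f := by
  apply inducedι_hom_ext
  rw [Action.comp_hom, Action.comp_hom, ← Category.assoc, inducedι_bimap_id, Category.assoc,
    inducedι_inducedπ, ← Category.assoc, inducedι_inducedπ, Category.id_comp, Category.comp_id]

/-- The difference of the right translation by `s` and the action of `s`. -/
def inducedDiff (s : G) (X : Action S G) :
    (deligneTensor J G).obj ((free k G).obj (𝟙_ _), X.V) ⟶
      (deligneTensor J G).obj ((free k G).obj (𝟙_ _), X.V) :=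
  bimap (deligneTensor J G) ((freeShift s).app (𝟙_ _)) (𝟙 X.V) -
    bimap (deligneTensor J G) (𝟙 _) (X.ρ s)

-- Under Frobenius reciprocity, precomposition with `inducedDiff` measures the failure of a morphism
-- of underlying objects to commute with `s`.
omit [Linear k S] [MonoidalPreadditive S] [MonoidalLinear k S] [J.Additive]
  [Functor.Linear k J] in
lemma inducedι_inducedDiff (s : G) (X : Action S G) {Z : Action S G}
    (t : (deligneTensor J G).obj ((free k G).obj (𝟙_ _), X.V) ⟶ Z) :
    inducedι J G X.V ≫ (inducedDiff J s X ≫ t).hom =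
      (inducedι J G X.V ≫ t.hom) ≫ Z.ρ s - X.ρ s ≫ inducedι J G X.V ≫ t.hom := by
  rw [Action.comp_hom, inducedDiff, Action.sub_hom, Preadditive.sub_comp, Preadditive.comp_sub,
    ← Category.assoc, inducedι_bimap_shift, ← Category.assoc, inducedι_bimap_id, Category.assoc,
    Category.assoc, Category.assoc, t.comm]

-- The counterpart of the free presentation for equivariant objects. A morphism that kills the
-- difference has a component at the neutral element commuting with `s`, hence with every power of
-- `s`, and that component is the required factorization.
omit [Linear k S] [MonoidalLinear k S] [Functor.Linear k J] in
lemma isCokernelPair_inducedπ {s : G} (hs : ∀ g : G, ∃ N : ℕ, s ^ N = g) (X : Action S G) :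
    IsCokernelPair (inducedDiff J s X) (inducedπ J X) where
  condition := by
    apply inducedι_hom_ext
    rw [inducedι_inducedDiff, inducedι_inducedπ, Category.id_comp, Category.comp_id, sub_self]
    exact comp_zero.symm
  epi := ⟨fun a b h => Action.Hom.ext (by
    have := congrArg (fun f => inducedι J G X.V ≫ f.hom) h
    simp only [Action.comp_hom] at this
    rwa [reassoc_of% (inducedι_inducedπ J X), reassoc_of% (inducedι_inducedπ J X)] at this)⟩
  exists_desc {W} t ht := by
    have h1 : X.ρ s ≫ inducedι J G X.V ≫ t.hom = (inducedι J G X.V ≫ t.hom) ≫ W.ρ s := by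
      have := inducedι_inducedDiff J s X t
      rw [ht] at this
      exact (sub_eq_zero.1 (this.symm.trans comp_zero)).symm
    have h2 : ∀ N : ℕ, X.ρ (s ^ N) ≫ inducedι J G X.V ≫ t.hom =
        (inducedι J G X.V ≫ t.hom) ≫ W.ρ (s ^ N) := fun N => by
      induction N with
      | zero => rw [pow_zero, Action.ρ_one, Action.ρ_one, Category.id_comp, Category.comp_id]
      | succ N ih =>
        rw [pow_succ', Action.ρ_mul_eq_comp, Action.ρ_mul_eq_comp, Category.assoc, h1,
          ← Category.assoc, ih, Category.assoc]
    refine ⟨⟨inducedι J G X.V ≫ t.hom, fun g => ?_⟩, ?_⟩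
    · obtain ⟨N, rfl⟩ := hs g
      exact h2 N
    · apply inducedι_hom_ext
      rw [Action.comp_hom, ← Category.assoc, inducedι_inducedπ, Category.id_comp]

end DeligneTensor

end

noncomputable section

open Functor.LaxMonoidal Functor.OplaxMonoidal FDRep

section Deligne

variable {k : Type u} [Field k] {G : Type} [Group G] [Fintype G]
  {S : Type u₂} [Category.{v₂} S] [Abelian S] [Linear k S] [MonoidalCategory S]
  [MonoidalPreadditive S] [MonoidalLinear k S]

/-! ### Right exactness -/

section RightExact

variable (J : FGModuleCat.{u} k ⥤ S) [J.Additive] [J.Linear k]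

omit [Fintype G]

/-- Additive functors out of vector spaces or out of `S` are exact, since all morphisms there have
generalized inverses. In the first variable this is applied after forgetting the action, which
reflects colimits. -/
lemma deligneTensor_isBilinearRightExact
    (hS : ∀ {X Y : S} (f : X ⟶ Y), ∃ g : Y ⟶ X, f ≫ g ≫ f = f) :
    IsBilinearRightExact k (deligneTensor J G) where
  left Y :=
    { additive := ⟨fun {V V'} f g => Action.Hom.ext (by
        change J.map (f.hom + g.hom) ⊗ₘ 𝟙 Y = (J.map f.hom ⊗ₘ 𝟙 Y) + (J.map g.hom ⊗ₘ 𝟙 Y)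
        rw [J.map_add, tensorHom_id, tensorHom_id, tensorHom_id,
          MonoidalPreadditive.add_whiskerRight])⟩
      linear := ⟨fun {V V'} f a => Action.Hom.ext (by
        change J.map (a • f.hom) ⊗ₘ 𝟙 Y = a • (J.map f.hom ⊗ₘ 𝟙 Y)
        rw [J.map_smul, tensorHom_id, tensorHom_id, MonoidalLinear.smul_whiskerRight])⟩
      preservesFiniteColimits := by
        have h1 : PreservesFiniteColimits (J ⋙ tensorRight Y) :=
          (Functor.preservesFiniteLimits_and_colimits_of_regular
            FGModuleCat.exists_comp_comp_eq _).2
        let e : (Prod.sectL (FDRep k G) Y ⋙ deligneTensor J G) ⋙ Action.forget S G ≅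
            Action.forget (FGModuleCat k) G ⋙ J ⋙ tensorRight Y :=
          NatIso.ofComponents (fun V => Iso.refl (J.obj V.V ⊗ Y)) fun {V V'} f => by
            refine (Category.comp_id _).trans (Eq.trans ?_ (Category.id_comp _).symm)
            exact tensorHom_id _ _
        refine ⟨fun D _ _ => ?_⟩
        have h2 : PreservesColimitsOfShape D (Action.forget (FGModuleCat k) G ⋙ J ⋙ tensorRight Y) :=
          inferInstance
        have h3 := preservesColimitsOfShape_of_natIso (J := D) e.symm
        exact preservesColimitsOfShape_of_reflects_of_preserves _ (Action.forget S G) }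
  right V := by
    have h1 : (Prod.sectR V S ⋙ deligneTensor J G).Additive := ⟨fun {Y Y'} f g => Action.Hom.ext (by
        change J.map (𝟙 V.V) ⊗ₘ (f + g) = (J.map (𝟙 V.V) ⊗ₘ f) + (J.map (𝟙 V.V) ⊗ₘ g)
        rw [J.map_id, id_tensorHom, id_tensorHom, id_tensorHom,
          MonoidalPreadditive.whiskerLeft_add])⟩
    exact
      { additive := h1
        linear := ⟨fun {Y Y'} f a => Action.Hom.ext (by
          change J.map (𝟙 V.V) ⊗ₘ (a • f) = a • (J.map (𝟙 V.V) ⊗ₘ f)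
          rw [J.map_id, id_tensorHom, id_tensorHom, MonoidalLinear.whiskerLeft_smul])⟩
        preservesFiniteColimits :=
          (Functor.preservesFiniteLimits_and_colimits_of_regular hS _).2 }

end RightExact

variable (J : FGModuleCat.{u} k ⥤ S) [J.Monoidal] [J.Additive] [J.Linear k]

/-- The presentation of `J V ⊗ Y` as an equivariant object is the bifunctor presentation for `B =
deligneTensor`. Both maps have the identity as component at the neutral element. -/
lemma inducedπ_deligneTensor (hT : IsBilinearRightExact k (deligneTensor J G)) (V : FDRep k G)
    (Y : S) : inducedπ J ((deligneTensor J G).obj (V, Y)) = bifunctorπ J hT V Y := by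
  have h1 : ∑ i, J.map ((FGModuleCat.exists_resolution V.V).choose_spec.choose_spec.choose i ≫
      (FGModuleCat.exists_resolution V.V).choose_spec.choose i) ▷ Y = 𝟙 (J.obj V.V ⊗ Y) := by
    rw [← sum_whiskerRight, ← Functor.map_sum,
      (FGModuleCat.exists_resolution V.V).choose_spec.choose_spec.choose_spec, J.map_id,
      id_whiskerRight]
  have h2 : inducedι J G (J.obj V.V ⊗ Y) ≫ (bifunctorπ J hT V Y).hom = 𝟙 (J.obj V.V ⊗ Y) := by
    rw [bifunctorπ_eq, Action.sum_hom, Preadditive.comp_sum]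
    refine Eq.trans (Finset.sum_congr rfl fun i _ => ?_) h1
    rw [inducedι_bimap, regularElt_freeπ]
    exact coeltTensor_eltTensor J _ _ Y
  exact inducedι_hom_ext J ((inducedι_inducedπ J _).trans h2.symm)

/-! ### Uniqueness of the factorization -/

section Unique

variable {J} {E : Type u₃} [Category.{v₃} E] [Abelian E] [Linear k E] {H H' : Action S G ⥤ E}
  (hH : IsRightExactLinear k H) (hH' : IsRightExactLinear k H')
  (hT : IsBilinearRightExact k (deligneTensor J G))
  {s : G} (hs : ∀ g : G, ∃ N : ℕ, s ^ N = g)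

omit [MonoidalLinear k S] [Functor.Linear k J] in
include hH hs in
lemma isCokernelPair_map_inducedπ (X : Action S G) :
    IsCokernelPair (H.map (inducedDiff J s X)) (H.map (inducedπ J X)) :=
  have := hH.additive
  have := hH.preservesFiniteColimits
  (isCokernelPair_inducedπ J hs X).map H

-- `H` keeps the presentation of `X` a cokernel, and `α` is natural for both terms of `inducedDiff`,
-- so its component at the induced object descends.
omit [MonoidalLinear k S] [Functor.Linear k J] in
include hH hH' hs in
lemma exists_extension_app (α : deligneTensor J G ⋙ H ⟶ deligneTensor J G ⋙ H')
    (X : Action S G) : ∃ b : H.obj X ⟶ H'.obj X, H.map (inducedπ J X) ≫ b =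
      α.app ((free k G).obj (𝟙_ _), X.V) ≫ H'.map (inducedπ J X) := by
  have := hH.additive
  have := hH'.additive
  refine (isCokernelPair_map_inducedπ (J := J) hH hs X).exists_desc _ ?_
  have h1 := α.naturality (Prod.mkHom ((freeShift s).app (𝟙_ _)) (𝟙 X.V))
  have h2 := α.naturality (Prod.mkHom (𝟙 ((free k G).obj (𝟙_ _))) (X.ρ s : X.V ⟶ X.V))
  have h3 : H.map (inducedDiff J s X) ≫ α.app ((free k G).obj (𝟙_ _), X.V) =
      α.app ((free k G).obj (𝟙_ _), X.V) ≫ H'.map (inducedDiff J s X) := by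
    rw [inducedDiff, H.map_sub, H'.map_sub, Preadditive.sub_comp, Preadditive.comp_sub]
    exact congrArg₂ (· - ·) h1 h2
  rw [reassoc_of% h3, ← H'.map_comp, (isCokernelPair_inducedπ J hs X).condition, H'.map_zero,
    comp_zero]

include hH hH' hT hs in
lemma whiskerLeft_deligneTensor_bijective :
    Function.Bijective (fun β : H ⟶ H' => Functor.whiskerLeft (deligneTensor J G) β) := by
  have := hH.additive
  have := hH'.additive
  have hepi : ∀ X, Epi (H.map (inducedπ J X)) := fun X =>
    (isCokernelPair_map_inducedπ hH hs X).epi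
  refine ⟨fun β β' h => NatTrans.ext (funext fun X => ?_), fun α => ?_⟩
  · have h1 := congrArg (fun γ => NatTrans.app γ ((free k G).obj (𝟙_ _), X.V)) h
    simp only [Functor.whiskerLeft_app] at h1
    rw [← cancel_epi (H.map (inducedπ J X)), β.naturality, β'.naturality, h1]
  · choose b hb using exists_extension_app hH hH' hs α
    have hnat : ∀ {X X' : Action S G} (f : X ⟶ X'), H.map f ≫ b X' = b X ≫ H'.map f := by
      intro X X' f
      rw [← cancel_epi (H.map (inducedπ J X)), ← H.map_comp_assoc, ← inducedπ_naturality,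
        H.map_comp, Category.assoc, hb, reassoc_of% (hb X), ← H'.map_comp, ← inducedπ_naturality,
        H'.map_comp]
      have := α.naturality (Prod.mkHom (𝟙 ((free k G).obj (𝟙_ _))) f.hom)
      exact (Category.assoc _ _ _).symm.trans
        ((congrArg (· ≫ H'.map (inducedπ J X')) this).trans (Category.assoc _ _ _))
    refine ⟨{ app := b, naturality := fun _ _ f => hnat f }, NatTrans.ext (funext fun ⟨V, Y⟩ => ?_)⟩
    rw [← cancel_epi (H.map (inducedπ J ((deligneTensor J G).obj (V, Y))))]
    have h1 : H.map (bifunctorπ J hT V Y) ≫ α.app (V, Y) =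
        α.app ((free k G).obj (𝟙_ _), J.obj V.V ⊗ Y) ≫ H'.map (bifunctorπ J hT V Y) := by
      rw [bifunctorπ_eq, Functor.map_sum, Functor.map_sum, Preadditive.comp_sum,
        Preadditive.sum_comp]
      exact Finset.sum_congr rfl fun i _ => α.naturality (Prod.mkHom _ _)
    refine (hb _).trans ?_
    rw [inducedπ_deligneTensor J hT]
    exact h1.symm

end Unique

/-! ### Existence of the factorization -/

section Exists

variable {E : Type u₃} [Category.{v₃} E] [Abelian E] [Linear k E] {B : FDRep k G × S ⥤ E}
  (hB : IsBilinearRightExact k B) (s : G)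

/-- The difference of the right translation by `s` and the action of `s`. -/
abbrev liftDiff (B : FDRep k G × S ⥤ E) (s : G) (X : Action S G) :
    B.obj ((free k G).obj (𝟙_ _), X.V) ⟶ B.obj ((free k G).obj (𝟙_ _), X.V) :=
  bimap B ((freeShift s).app (𝟙_ _)) (𝟙 X.V) - bimap B (𝟙 _) (X.ρ s : X.V ⟶ X.V)

omit [Abelian S] [Linear k S] [MonoidalCategory S] [MonoidalPreadditive S]
  [MonoidalLinear k S] [Linear k E] in
lemma liftDiff_naturality (B : FDRep k G × S ⥤ E) (s : G) {X X' : Action S G} (f : X ⟶ X') :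
    liftDiff B s X ≫ bimap B (𝟙 _) f.hom = bimap B (𝟙 _) f.hom ≫ liftDiff B s X' := by
  rw [Preadditive.sub_comp, Preadditive.comp_sub, bimap_comp, bimap_comp, bimap_comp, bimap_comp,
    Category.id_comp, Category.id_comp, Category.comp_id, Category.comp_id, Category.id_comp,
    f.comm]

/-- The functor on equivariant objects induced by a bifunctor. -/
def deligneLift (B : FDRep k G × S ⥤ E) (s : G) : Action S G ⥤ E where
  obj X := cokernel (liftDiff B s X)
  map {X X'} f := cokernel.map _ _ (bimap B (𝟙 _) f.hom) (bimap B (𝟙 _) f.hom)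
    (liftDiff_naturality B s f)
  map_id X := by
    rw [← cancel_epi (cokernel.π _), cokernel.π_desc, Action.id_hom, bimap_id]
    exact (Category.id_comp _).trans (Category.comp_id _).symm
  map_comp f g := by
    rw [← cancel_epi (cokernel.π _), cokernel.π_desc, cokernel.π_desc_assoc, Category.assoc,
      cokernel.π_desc, ← Category.assoc, bimap_comp, Action.comp_hom, Category.comp_id]

/-- The projection onto the value of the induced functor. -/
def deligneLiftπ (B : FDRep k G × S ⥤ E) (s : G) (X : Action S G) :
    B.obj ((free k G).obj (𝟙_ _), X.V) ⟶ (deligneLift B s).obj X :=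
  cokernel.π (liftDiff B s X)

instance (B : FDRep k G × S ⥤ E) (X : Action S G) : Epi (deligneLiftπ B s X) :=
  inferInstanceAs (Epi (cokernel.π _))

omit [Abelian S] [Linear k S] [MonoidalCategory S] [MonoidalPreadditive S]
  [MonoidalLinear k S] [Linear k E] in
lemma isCokernelPair_deligneLiftπ (B : FDRep k G × S ⥤ E) (X : Action S G) :
    IsCokernelPair (liftDiff B s X) (deligneLiftπ B s X) := .cokernel_π _

omit [Abelian S] [Linear k S] [MonoidalCategory S] [MonoidalPreadditive S]
  [MonoidalLinear k S] [Linear k E] in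
lemma deligneLiftπ_naturality (B : FDRep k G × S ⥤ E) {X X' : Action S G} (f : X ⟶ X') :
    deligneLiftπ B s X ≫ (deligneLift B s).map f =
      bimap B (𝟙 _) f.hom ≫ deligneLiftπ B s X' :=
  cokernel.π_desc _ _ _

-- Forgetting the action is exact and `B` is right exact in `S`, so right exactness reduces to the
-- fact that cokernels commute with cokernels.
omit [MonoidalCategory S] [MonoidalPreadditive S] [MonoidalLinear k S] in
include hB in
lemma deligneLift_isRightExactLinear : IsRightExactLinear k (deligneLift B s) := by
  have hadd : (deligneLift B s).Additive := ⟨fun {X X'} f g => by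
    rw [← cancel_epi (deligneLiftπ B s X), Preadditive.comp_add, deligneLiftπ_naturality,
      deligneLiftπ_naturality, deligneLiftπ_naturality, Action.add_hom, bimap_add_right hB,
      Preadditive.add_comp]⟩
  refine ⟨hadd, ⟨fun {X X'} f a => ?_⟩,
    IsCokernelPair.preservesFiniteColimits _ fun {X Y Z f g} h => ?_⟩
  · rw [← cancel_epi (deligneLiftπ B s X), Linear.comp_smul, deligneLiftπ_naturality,
      deligneLiftπ_naturality, Action.smul_hom, bimap_smul_right hB, Linear.smul_comp]
  · have h1 : IsCokernelPair (bimap B (𝟙 ((free k G).obj (𝟙_ _))) f.hom) (bimap B (𝟙 _) g.hom) := by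
      have := (hB.right ((free k G).obj (𝟙_ _))).additive
      have := (hB.right ((free k G).obj (𝟙_ _))).preservesFiniteColimits
      exact (h.map (Action.forget S G)).map (Prod.sectR ((free k G).obj (𝟙_ _)) S ⋙ B)
    have := h1.epi
    refine ⟨by rw [← Functor.map_comp, h.condition, Functor.map_zero], ?_, fun {W} t ht => ?_⟩
    · have : Epi (deligneLiftπ B s Y ≫ (deligneLift B s).map g) := by
        rw [deligneLiftπ_naturality]
        exact epi_comp _ _
      exact epi_of_epi (deligneLiftπ B s Y) _
    · obtain ⟨t', ht'⟩ := h1.exists_desc (deligneLiftπ B s Y ≫ t) (by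
        rw [← Category.assoc, ← deligneLiftπ_naturality, Category.assoc, ht, comp_zero])
      -- The morphism `t'` kills the difference operator at `Z`: this is tested on the epimorphism
      -- induced by `g`, where naturality moves the operator to `Y`.
      obtain ⟨t'', ht''⟩ := (isCokernelPair_deligneLiftπ s B Z).exists_desc t' (by
        rw [← cancel_epi (bimap B (𝟙 _) g.hom), ← Category.assoc, ← liftDiff_naturality,
          Category.assoc, ht', ← Category.assoc, (isCokernelPair_deligneLiftπ s B Y).condition,
          zero_comp, comp_zero])
      refine ⟨t'', ?_⟩
      rw [← cancel_epi (deligneLiftπ B s Y), ← Category.assoc, deligneLiftπ_naturality,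
        Category.assoc, ht'', ht']

-- `deligneLift` and `B` present the same cokernel at `(V, Y)`: the value at `J V ⊗ Y` is the
-- cokernel of `isCokernelPair_bifunctorπ`.
include hB in
lemma exists_deligneTensor_comp_iso {s : G} (hs : ∀ g : G, ∃ N : ℕ, s ^ N = g) :
    Nonempty (deligneTensor J G ⋙ deligneLift B s ≅ B) := by
  have h1 : ∀ V Y, IsCokernelPair (liftDiff B s ((deligneTensor J G).obj (V, Y)))
      (bifunctorπ J hB V Y) := fun V Y => by
    have := isCokernelPair_bifunctorπ J hB hs V Y
    rw [← deligneTensor_ρ] at this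
    exact this
  have h2 : ∀ V Y, ∃ e : (deligneLift B s).obj ((deligneTensor J G).obj (V, Y)) ≅ B.obj (V, Y),
      deligneLiftπ B s _ ≫ e.hom = bifunctorπ J hB V Y := fun V Y =>
    (isCokernelPair_deligneLiftπ s B _).exists_iso (h1 V Y)
  choose e he using h2
  refine ⟨NatIso.ofComponents (fun X => e X.1 X.2) fun {X X'} f => ?_⟩
  rw [← cancel_epi (deligneLiftπ B s ((deligneTensor J G).obj (X.1, X.2)))]
  refine (Category.assoc _ _ _).symm.trans ((congrArg (· ≫ (e X'.1 X'.2).hom)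
    (deligneLiftπ_naturality s B ((deligneTensor J G).map f))).trans ?_)
  refine (Category.assoc _ _ _).trans ((congrArg (_ ≫ ·) (he X'.1 X'.2)).trans ?_)
  refine (bifunctorπ_naturality J hB f.1 f.2).trans ?_
  refine (congrArg (· ≫ bimap B f.1 f.2) (he X.1 X.2)).symm.trans (Category.assoc _ _ _)

end Exists

/-- The bifunctor `(V, Y) ↦ J V ⊗ Y` exhibits the category of objects of a semisimple category `S`
with an action of a finite cyclic group as a Deligne tensor product. -/
theorem isDeligneProduct_deligneTensor
    (hS : ∀ {X Y : S} (f : X ⟶ Y), ∃ g : Y ⟶ X, f ≫ g ≫ f = f)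
    (hG : ∃ s : G, ∀ g : G, ∃ N : ℕ, s ^ N = g) :
    IsDeligneProduct.{u, v, w} k (deligneTensor J G) := by
  obtain ⟨s, hs⟩ := hG
  have hT := deligneTensor_isBilinearRightExact (G := G) J hS
  exact
    { isBilinearRightExact := hT
      factors := fun E _ _ _ B hB =>
        ⟨deligneLift B s, deligneLift_isRightExactLinear hB s, exists_deligneTensor_comp_iso J hB hs⟩
      unique := fun E _ _ _ H H' hH hH' => whiskerLeft_deligneTensor_bijective hH hH' hT hs }

end Deligne

end

noncomputable section

/-! ### Morphisms of representations as invariant elements -/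

namespace FDRep

section Hat

variable {k : Type u} [Field k] {G : Type v} [Group G]

/-- The representation on the space of linear maps between two representations. -/
abbrev homRep (X Y : FDRep k G) : FDRep k G := FDRep.of (Representation.linHom X.ρ Y.ρ)

/-- The evaluation morphism. -/
def homEval (X Y : FDRep k G) : homRep X Y ⊗ X ⟶ Y :=
  homMk (TensorProduct.lift (LinearMap.id : (X →ₗ[k] Y) →ₗ[k] (X →ₗ[k] Y))) fun g t => by
    refine LinearMap.congr_fun (f := TensorProduct.lift _ ∘ₗ (homRep X Y ⊗ X : FDRep k G).ρ g)
      (g := Y.ρ g ∘ₗ TensorProduct.lift _) (TensorProduct.ext' fun φ x => ?_) t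
    change Y.ρ g (φ (X.ρ g⁻¹ (X.ρ g x))) = Y.ρ g (φ x)
    rw [← Module.End.mul_apply (X.ρ g⁻¹), ← map_mul, inv_mul_cancel, map_one, Module.End.one_apply]

/-- Composition with a morphism, on spaces of linear maps. -/
def homPost (X : FDRep k G) {Y Y' : FDRep k G} (f : Y ⟶ Y') : homRep X Y ⟶ homRep X Y' :=
  homMk (X := homRep X Y) (Y := homRep X Y') (LinearMap.llcomp k X Y Y' (toLin f)) fun g φ =>
    LinearMap.ext fun x => toLin_ρ f g (φ (X.ρ g⁻¹ x))

/-- The morphism from the unit given by an invariant element. -/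
def unitHom (V : FDRep k G) (v : V) (hv : ∀ g, V.ρ g v = v) : 𝟙_ (FDRep k G) ⟶ V :=
  homMk (X := 𝟙_ (FDRep k G)) (LinearMap.toSpanSingleton k V v) fun g x => by
    change (x : k) • v = V.ρ g ((x : k) • v)
    rw [map_smul, hv]

lemma unitHom_comp {V W : FDRep k G} (v : V) (hv : ∀ g, V.ρ g v = v) (f : V ⟶ W)
    (hw : ∀ g, W.ρ g (toLin f v) = toLin f v) :
    unitHom V v hv ≫ f = unitHom W (toLin f v) hw :=
  toLin_injective (LinearMap.ext fun (c : k) => (toLin f).map_smul c v)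

lemma ρ_toLin (X Y : FDRep k G) (f : X ⟶ Y) (g : G) :
    (homRep X Y).ρ g (toLin f) = toLin f := by
  refine LinearMap.ext fun x => ?_
  change Y.ρ g (toLin f (X.ρ g⁻¹ x)) = toLin f x
  rw [← toLin_ρ, ← Module.End.mul_apply (X.ρ g), ← map_mul, mul_inv_cancel, map_one,
    Module.End.one_apply]

/-- A morphism of representations as a morphism from the unit. -/
def hat {X Y : FDRep k G} (f : X ⟶ Y) : 𝟙_ (FDRep k G) ⟶ homRep X Y :=
  unitHom (homRep X Y) (toLin f) (ρ_toLin X Y f)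

lemma hat_comp_homPost (X : FDRep k G) {Y Y' : FDRep k G} (f : X ⟶ Y) (g : Y ⟶ Y') :
    hat f ≫ homPost X g = hat (f ≫ g) :=
  toLin_injective (LinearMap.ext fun (c : k) => LinearMap.ext fun x =>
    (toLin g).map_smul c (toLin f x))

lemma leftUnitor_inv_hat_homEval {X Y : FDRep k G} (f : X ⟶ Y) :
    (λ_ X).inv ≫ hat f ▷ X ≫ homEval X Y = f := by
  refine toLin_injective (LinearMap.ext fun x => ?_)
  change (1 : k) • toLin f x = toLin f x
  rw [one_smul]

lemma whiskerLeft_dualTensorIsoLinHom {X Y Y' : FDRep k G} (f : Y ⟶ Y') :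
    FDRep.of (Representation.dual X.ρ) ◁ f ≫ (dualTensorIsoLinHom X.ρ Y').hom =
      (dualTensorIsoLinHom X.ρ Y).hom ≫ homPost X f := by
  refine toLin_injective (TensorProduct.ext' fun φ y => LinearMap.ext fun x => ?_)
  exact ((toLin f).map_smul (φ x) y).symm

/-- A tensor ideal is determined by its morphisms out of the unit. Evaluation recovers `f` from `hat
f`, and `hat f` is obtained from `f` tensored with the dual of `X`. -/
lemma hat_mem_iff (I : TensorIdeal k (FDRep k G)) {X Y : FDRep k G} (f : X ⟶ Y) :
    hat f ∈ I.hom _ _ ↔ f ∈ I.hom X Y := by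
  refine ⟨fun h => ?_, fun h => ?_⟩
  · rw [← leftUnitor_inv_hat_homEval f]
    exact I.comp_left_mem _ (I.comp_right_mem _ (I.whiskerRight_mem X h))
  · have h1 : hat (𝟙 X) ≫ (dualTensorIsoLinHom X.ρ X).inv ≫ FDRep.of (Representation.dual X.ρ) ◁ f ≫
        (dualTensorIsoLinHom X.ρ Y).hom = hat f := by
      rw [whiskerLeft_dualTensorIsoLinHom, Iso.inv_hom_id_assoc, hat_comp_homPost,
        Category.id_comp]
    rw [← h1]
    exact I.comp_left_mem _ (I.comp_left_mem _ (I.comp_right_mem _ (I.whiskerLeft_mem _ h)))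

end Hat

/-! ### The nilpotent operator of a representation of a cyclic `p`-group -/

section Cyclic

variable {k : Type u} [Field k] {p n : ℕ} [Fact p.Prime]

/-- The standard generator of the cyclic group. -/
abbrev cyclicGen (p n : ℕ) : CyclicPGroup p n := Multiplicative.ofAdd 1

lemma cyclicGen_pow_val (g : CyclicPGroup p n) : cyclicGen p n ^ (Multiplicative.toAdd g).val = g := by
  rw [← ofAdd_nsmul, nsmul_one, ZMod.natCast_zmod_val]
  rfl

/-- The operator `σ - 1` on a representation. -/
def nil (V : RepCyclic k p n) : Module.End k V := V.ρ (cyclicGen p n) - 1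

omit [Fact (Nat.Prime p)] in
lemma nil_apply (V : RepCyclic k p n) (v : V) : nil V v = V.ρ (cyclicGen p n) v - v := rfl

omit [Fact (Nat.Prime p)] in
lemma toLin_nil {X Y : RepCyclic k p n} (f : X ⟶ Y) (x : X) :
    toLin f (nil X x) = nil Y (toLin f x) := by
  rw [nil_apply, nil_apply, map_sub, toLin_ρ]

lemma ρ_eq_of_nil_eq_zero {V : RepCyclic k p n} {v : V} (hv : nil V v = 0)
    (g : CyclicPGroup p n) : V.ρ g v = v := by
  have h1 : V.ρ (cyclicGen p n) v = v := sub_eq_zero.1 hv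
  rw [← cyclicGen_pow_val g, map_pow]
  induction (Multiplicative.toAdd g).val with
  | zero => rfl
  | succ N ih => rw [pow_succ, Module.End.mul_apply, h1, ih]

/-- A linear map commuting with the nilpotent operators is a morphism of representations. -/
def homOfNil {X Y : RepCyclic k p n} (f : X →ₗ[k] Y) (hf : ∀ x, f (nil X x) = nil Y (f x)) :
    X ⟶ Y :=
  homMk f fun g x => by
    have h1 : ∀ x, f (X.ρ (cyclicGen p n) x) = Y.ρ (cyclicGen p n) (f x) := fun x => by
      have := hf x
      rwa [nil_apply, nil_apply, map_sub, sub_left_inj] at this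
    rw [← cyclicGen_pow_val g, map_pow, map_pow]
    induction (Multiplicative.toAdd g).val generalizing x with
    | zero => rfl
    | succ N ih => rw [pow_succ, pow_succ, Module.End.mul_apply, Module.End.mul_apply, ih, h1]

lemma nil_pow_char_pow [CharP k p] (V : RepCyclic k p n) (m : ℕ) :
    nil V ^ p ^ m = V.ρ (cyclicGen p n ^ p ^ m) - 1 := by
  rcases subsingleton_or_nontrivial (Module.End k V) with h | h
  · exact Subsingleton.elim _ _
  · have := charP_of_injective_algebraMap (algebraMap k (Module.End k V)).injective p
    rw [nil, sub_pow_char_pow_of_commute _ _ (Commute.one_right _), one_pow, ← map_pow]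

lemma nil_pow_eq_zero [CharP k p] (V : RepCyclic k p n) : nil V ^ p ^ n = 0 := by
  rw [nil_pow_char_pow, ← ofAdd_nsmul, nsmul_one, ZMod.natCast_self, ofAdd_zero, map_one, sub_self]

/-- The morphism from the unit given by an element killed by the nilpotent operator. -/
abbrev nilHom (V : RepCyclic k p n) (v : V) (hv : nil V v = 0) : 𝟙_ (RepCyclic k p n) ⟶ V :=
  unitHom V v (ρ_eq_of_nil_eq_zero hv)

lemma nilHom_comp {V W : RepCyclic k p n} (v : V) (hv : nil V v = 0) (f : V ⟶ W) (w : W)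
    (hw : nil W w = 0) (h : toLin f v = w) : nilHom V v hv ≫ f = nilHom W w hw := by
  subst h
  exact unitHom_comp v _ f _

/-! ### The representations `J_i` -/

/-- The projection of the group algebra to `J_i`. -/
def cyclicMk (k : Type u) [Field k] (p n i : ℕ) [Fact p.Prime] :
    MonoidAlgebra k (CyclicPGroup p n) →ₗ[k] cyclicJ k p n i :=
  (Ideal.Quotient.mkₐ k (Ideal.span {cyclicX k p n ^ i})).toLinearMap

lemma cyclicMk_surjective (i : ℕ) : Function.Surjective (cyclicMk k p n i) :=
  Ideal.Quotient.mk_surjective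

lemma cyclicMk_eq_zero_iff {i : ℕ} {a : MonoidAlgebra k (CyclicPGroup p n)} :
    cyclicMk k p n i a = 0 ↔ ∃ b, a = b * cyclicX k p n ^ i := by
  refine (Ideal.Quotient.eq_zero_iff_mem (I := Ideal.span {cyclicX k p n ^ i})).trans ?_
  rw [Ideal.mem_span_singleton']
  exact exists_congr fun b => eq_comm

lemma nil_cyclicMk (i : ℕ) (a : MonoidAlgebra k (CyclicPGroup p n)) :
    nil (cyclicJ k p n i) (cyclicMk k p n i a) = cyclicMk k p n i (cyclicX k p n * a) := by
  rw [cyclicX, sub_mul, one_mul, map_sub]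
  rfl

lemma nil_pow_cyclicMk (i j : ℕ) (a : MonoidAlgebra k (CyclicPGroup p n)) :
    (nil (cyclicJ k p n i) ^ j) (cyclicMk k p n i a) =
      cyclicMk k p n i (cyclicX k p n ^ j * a) := by
  induction j with
  | zero => rw [pow_zero, pow_zero, one_mul]; rfl
  | succ j ih => rw [pow_succ', Module.End.mul_apply, ih, nil_cyclicMk, pow_succ', mul_assoc]

omit [Fact (Nat.Prime p)] in
lemma asAlgebraHom_cyclicX (V : RepCyclic k p n) :
    Representation.asAlgebraHom V.ρ (cyclicX k p n) = nil V := by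
  refine (map_sub (Representation.asAlgebraHom V.ρ) _ 1).trans ?_
  rw [Representation.asAlgebraHom_of, map_one (Representation.asAlgebraHom V.ρ)]
  rfl

/-- The morphism from `J_i` given by an element killed by the `i`-th power of the nilpotent
operator. -/
lemma exists_hom_cyclicJ {V : RepCyclic k p n} {v : V} {i : ℕ} (hv : (nil V ^ i) v = 0) :
    ∃ f : cyclicJ k p n i ⟶ V, ∀ a,
      toLin f (cyclicMk k p n i a) = Representation.asAlgebraHom V.ρ a v := by
  let e : MonoidAlgebra k (CyclicPGroup p n) →ₗ[k] V :=
    (LinearMap.applyₗ v) ∘ₗ (Representation.asAlgebraHom V.ρ).toLinearMap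
  have he : ∀ a, cyclicMk k p n i a = 0 → e a = 0 := fun a ha => by
    obtain ⟨b, rfl⟩ := cyclicMk_eq_zero_iff.1 ha
    change Representation.asAlgebraHom V.ρ (b * cyclicX k p n ^ i) v = 0
    rw [map_mul, map_pow, asAlgebraHom_cyclicX, Module.End.mul_apply, hv, map_zero]
  obtain ⟨s, hs⟩ := LinearMap.exists_rightInverse_of_surjective (cyclicMk k p n i)
    (LinearMap.range_eq_top.2 (cyclicMk_surjective i))
  have hes : ∀ a, e (s (cyclicMk k p n i a)) = e a := fun a => by
    rw [← sub_eq_zero, ← map_sub]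
    refine he _ ?_
    rw [map_sub, sub_eq_zero]
    exact LinearMap.congr_fun hs _
  refine ⟨homOfNil (e ∘ₗ s) fun x => ?_, hes⟩
  obtain ⟨a, rfl⟩ := cyclicMk_surjective i x
  rw [nil_cyclicMk]
  refine (hes _).trans (Eq.trans ?_ (congrArg (nil V) (hes a)).symm)
  change Representation.asAlgebraHom V.ρ (cyclicX k p n * a) v = _
  rw [map_mul, asAlgebraHom_cyclicX]
  rfl

lemma nil_socle (d : ℕ) :
    nil (cyclicJ k p n (d + 1)) (cyclicMk k p n (d + 1) (cyclicX k p n ^ d)) = 0 := by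
  rw [nil_cyclicMk, ← pow_succ']
  exact cyclicMk_eq_zero_iff.2 ⟨1, (one_mul _).symm⟩

/-- The inclusion of the socle of `J_{d+1}`. -/
def socleHom (k : Type u) [Field k] (p n d : ℕ) [Fact p.Prime] :
    𝟙_ (RepCyclic k p n) ⟶ cyclicJ k p n (d + 1) :=
  nilHom _ (cyclicMk k p n (d + 1) (cyclicX k p n ^ d)) (nil_socle d)

/-- If `v = x^d w` is killed by `x`, then `x^(d+1) w = 0`, and the map `J_{d+1} ⟶ V` with `1 ↦ w`
carries the socle generator to `v`. -/
lemma nilHom_mem_of_mem_range (I : TensorIdeal k (RepCyclic k p n)) {d : ℕ}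
    (hd : socleHom k p n d ∈ I.hom _ _) {V : RepCyclic k p n} {v : V} (hv : nil V v = 0)
    (h : v ∈ LinearMap.range (nil V ^ d)) : nilHom V v hv ∈ I.hom _ _ := by
  obtain ⟨w, rfl⟩ := h
  obtain ⟨f, hf⟩ := exists_hom_cyclicJ (V := V) (v := w) (i := d + 1) (by
    rw [pow_succ', Module.End.mul_apply, hv])
  have h1 : socleHom k p n d ≫ f = nilHom V _ hv := by
    refine nilHom_comp _ (nil_socle d) _ _ _ ?_
    rw [hf, map_pow, asAlgebraHom_cyclicX]
  rw [← h1]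
  exact I.comp_right_mem _ hd

/-- A functional `ψ` vanishing on `x^(d+1) V` with `ψ v ≠ 0` gives the equivariant map `w ↦ Σ ψ(x^t
w) x^(d-t)` to `J_{d+1}`. It sends `v` to a nonzero multiple of the socle generator. -/
lemma socleHom_mem_of_not_mem_range (I : TensorIdeal k (RepCyclic k p n)) {d : ℕ}
    {V : RepCyclic k p n} {v : V} (hv : nil V v = 0) (hI : nilHom V v hv ∈ I.hom _ _)
    (h : v ∉ LinearMap.range (nil V ^ (d + 1))) : socleHom k p n d ∈ I.hom _ _ := by
  obtain ⟨ψ, hψ1, hψ2⟩ := Submodule.exists_le_ker_of_notMem h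
  let F : V →ₗ[k] cyclicJ k p n (d + 1) := ∑ t ∈ Finset.range (d + 1),
    LinearMap.smulRight (ψ ∘ₗ (nil V ^ t)) (cyclicMk k p n (d + 1) (cyclicX k p n ^ (d - t)))
  have hF : ∀ w, F w = ∑ t ∈ Finset.range (d + 1), ψ ((nil V ^ t) w) •
      cyclicMk k p n (d + 1) (cyclicX k p n ^ (d - t)) := fun w => LinearMap.sum_apply _ _ _
  have hF1 : ∀ w, F (nil V w) = nil _ (F w) := fun w => by
    rw [hF, hF, map_sum, Finset.sum_range_succ, Finset.sum_range_succ' (n := d)]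
    have h1 : ψ ((nil V ^ d) (nil V w)) = 0 := by
      rw [← Module.End.mul_apply, ← pow_succ]
      exact hψ2 ⟨w, rfl⟩
    rw [h1, zero_smul, add_zero, map_smul, Nat.sub_zero, nil_socle, smul_zero, add_zero]
    refine Finset.sum_congr rfl fun t ht => ?_
    rw [map_smul, nil_cyclicMk, ← pow_succ', ← Module.End.mul_apply, ← pow_succ]
    congr 4
    have := Finset.mem_range.1 ht
    omega
  have hFv : F v = ψ v • cyclicMk k p n (d + 1) (cyclicX k p n ^ d) := by
    rw [hF, Finset.sum_range_succ', Finset.sum_eq_zero, zero_add]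
    · rfl
    · intro t _
      rw [pow_succ, Module.End.mul_apply, hv, map_zero, map_zero, zero_smul]
  have h2 : (ψ v)⁻¹ • (nilHom V v hv ≫ homOfNil F hF1) = socleHom k p n d := by
    refine toLin_injective (LinearMap.ext fun (c : k) => ?_)
    change (ψ v)⁻¹ • F (c • v) = c • cyclicMk k p n (d + 1) (cyclicX k p n ^ d)
    rw [map_smul, hFv, smul_comm c, inv_smul_smul₀ hψ1]
  rw [← h2]
  exact Submodule.smul_mem _ _ (I.comp_right_mem _ hI)

/-! ### Tensor ideals are determined by a threshold -/

omit [Fact (Nat.Prime p)] in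
lemma nil_toLin {X Y : RepCyclic k p n} (f : X ⟶ Y) : nil (homRep X Y) (toLin f) = 0 :=
  sub_eq_zero.2 (ρ_toLin X Y f _)

lemma hat_eq {X Y : RepCyclic k p n} (f : X ⟶ Y) :
    hat f = nilHom (homRep X Y) (toLin f) (nil_toLin f) := rfl

/-- The `d`-th step of the filtration of the morphisms of representations. -/
def IsDeep (d : ℕ) {X Y : RepCyclic k p n} (f : X ⟶ Y) : Prop :=
  toLin f ∈ LinearMap.range (nil (homRep X Y) ^ d)

lemma isDeep_nilHom_iff {d : ℕ} {V : RepCyclic k p n} {v : V} (hv : nil V v = 0) :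
    IsDeep d (nilHom V v hv) ↔ v ∈ LinearMap.range (nil V ^ d) := by
  have h1 : ∀ (φ : (homRep (𝟙_ _) V : RepCyclic k p n)) (c : k),
      (show k →ₗ[k] V from (nil (homRep (𝟙_ _) V) ^ d) φ) c =
        (nil V ^ d) ((show k →ₗ[k] V from φ) c) := by
    induction d with
    | zero => exact fun _ _ => rfl
    | succ d ih =>
      intro φ c
      rw [pow_succ, pow_succ, Module.End.mul_apply, ih]
      rfl
  constructor
  · rintro ⟨φ, hφ⟩
    refine ⟨(show k →ₗ[k] V from φ) 1, ?_⟩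
    rw [← h1, hφ]
    exact one_smul k v
  · rintro ⟨w, rfl⟩
    refine ⟨LinearMap.toSpanSingleton k V w, LinearMap.ext fun (c : k) => (h1 _ c).trans ?_⟩
    exact (nil V ^ d).map_smul c w

omit [Fact (Nat.Prime p)] in
lemma IsDeep.mono {d d' : ℕ} (hd : d ≤ d') {X Y : RepCyclic k p n} {f : X ⟶ Y}
    (hf : IsDeep d' f) : IsDeep d f := by
  obtain ⟨φ, hφ⟩ := hf
  refine ⟨(nil (homRep X Y) ^ (d' - d)) φ, ?_⟩
  rw [← Module.End.mul_apply, ← pow_add, Nat.add_sub_cancel' hd, hφ]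

omit [Fact (Nat.Prime p)] in
lemma isDeep_zero {X Y : RepCyclic k p n} (f : X ⟶ Y) : IsDeep 0 f := ⟨toLin f, rfl⟩

/-- The tensor ideal is the `j`-th step of the filtration of the morphisms. -/
def _root_.TensorIdeal.HasThreshold (I : TensorIdeal k (RepCyclic k p n)) (j : ℕ) : Prop :=
  ∀ {X Y : RepCyclic k p n} (f : X ⟶ Y), f ∈ I.hom X Y ↔ IsDeep j f

/-- Morphisms are turned into invariant vectors by `hat`. Depth `j` suffices because the `j`-th
socle inclusion is in the ideal; a shallower vector would put the preceding socle inclusion into it.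
-/
lemma hasThreshold_of (I : TensorIdeal k (RepCyclic k p n)) (j : ℕ)
    (h1 : socleHom k p n j ∈ I.hom _ _)
    (h2 : ∀ d, d + 1 = j → socleHom k p n d ∉ I.hom _ _) : I.HasThreshold j := by
  intro X Y f
  rw [← hat_mem_iff, hat_eq]
  refine ⟨fun h => ?_, fun h => nilHom_mem_of_mem_range I h1 _ h⟩
  rcases j with _ | d
  · exact isDeep_zero f
  · by_contra h'
    exact h2 d rfl (socleHom_mem_of_not_mem_range I (nil_toLin f) h h')

lemma socleHom_mem_of_le [CharP k p] (I : TensorIdeal k (RepCyclic k p n)) {d : ℕ}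
    (hd : p ^ n ≤ d) : socleHom k p n d ∈ I.hom _ _ := by
  have h : socleHom k p n d = 0 := by
    refine toLin_injective (LinearMap.ext fun (c : k) => ?_)
    change c • cyclicMk k p n (d + 1) (cyclicX k p n ^ d) = 0
    have := nil_pow_cyclicMk (k := k) (p := p) (n := n) (d + 1) d 1
    rw [mul_one] at this
    rw [← this, ← Nat.sub_add_cancel hd, pow_add, Module.End.mul_apply, nil_pow_eq_zero,
      LinearMap.zero_apply, map_zero, smul_zero]
  rw [h]
  exact zero_mem _

/-- The threshold is the least `j` whose socle inclusion lies in the ideal; it is at most `p^n`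
because the inclusion for `p^n` is the zero map. -/
theorem exists_hasThreshold [CharP k p] (I : TensorIdeal k (RepCyclic k p n)) :
    ∃ j ≤ p ^ n, I.HasThreshold j ∧ socleHom k p n j ∈ I.hom _ _ ∧
      ∀ d < j, socleHom k p n d ∉ I.hom _ _ := by
  classical
  have h : ∃ j, socleHom k p n j ∈ I.hom _ _ := ⟨p ^ n, socleHom_mem_of_le I le_rfl⟩
  refine ⟨Nat.find h, Nat.find_le (socleHom_mem_of_le I le_rfl),
    hasThreshold_of I _ (Nat.find_spec h) fun d hd => ?_, Nat.find_spec h,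
    fun d hd => Nat.find_min h hd⟩
  exact Nat.find_min h (by omega)

omit [Fact (Nat.Prime p)] in
lemma _root_.TensorIdeal.HasThreshold.ext {I I' : TensorIdeal k (RepCyclic k p n)} {j : ℕ}
    (h : I.HasThreshold j) (h' : I'.HasThreshold j) : I = I' := by
  have : I.hom = I'.hom := by
    funext X Y
    ext f
    rw [h f, h' f]
  cases I
  cases I'
  congr

end Cyclic

end FDRep

end

noncomputable section

/-! ### The filtration and tensor products -/

/-- Write the sum as `x + y (1 + x)`. Against `x^(a-r) y^(r-1)`, the terms of the binomial expansion
with index below `r` contain `y^(a+1)` and those above contain `x^(a+1)`. In the term of index `r`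
the factor `1 + x` acts as `1`, because `x^a` is already present. -/
lemma add_add_mul_pow_smul {R : Type*} [CommRing R] {N : Type*} [AddCommGroup N] [Module R N]
    {x y : R} {t : N} {a r : ℕ} (hx : x ^ (a + 1) • t = 0) (hy : y ^ (a + 1) • t = 0) (h1 : 1 ≤ r)
    (h2 : r ≤ a) :
    (x + y + x * y) ^ (a + 1) • (x ^ (a - r) * y ^ (r - 1)) • t =
      ((a + 1).choose r : R) • (x ^ a * y ^ a) • t := by
  have hx' : ∀ i (c : R), a + 1 ≤ i → (c * x ^ i) • t = 0 := fun i c hi => by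
    rw [← Nat.sub_add_cancel hi, pow_add, ← mul_assoc, mul_smul, hx, smul_zero]
  have hy' : ∀ i (c : R), a + 1 ≤ i → (c * y ^ i) • t = 0 := fun i c hi => by
    rw [← Nat.sub_add_cancel hi, pow_add, ← mul_assoc, mul_smul, hy, smul_zero]
  rw [show x + y + x * y = x + y * (1 + x) by ring, add_pow, ← mul_smul, Finset.sum_mul,
    Finset.sum_smul, Finset.sum_eq_single r]
  · have e1 : x ^ r * x ^ (a - r) = x ^ a := by rw [← pow_add]; congr 1; omega
    have e2 : y ^ (a + 1 - r) * y ^ (r - 1) = y ^ a := by rw [← pow_add]; congr 1; omega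
    have e3 : ∀ N : ℕ, ∃ c : R, (1 + x) ^ N = 1 + x * c := fun N => by
      obtain ⟨c, hc⟩ := (sub_dvd_pow_sub_pow (1 + x) 1 N)
      refine ⟨c, ?_⟩
      rw [one_pow, add_sub_cancel_left] at hc
      rw [← hc]
      ring
    obtain ⟨c, hc⟩ := e3 (a + 1 - r)
    have e4 : x ^ r * (y * (1 + x)) ^ (a + 1 - r) * ((a + 1).choose r : R) *
        (x ^ (a - r) * y ^ (r - 1)) = ((a + 1).choose r : R) * (x ^ a * y ^ a) +
        (((a + 1).choose r : R) * y ^ a * c) * x ^ (a + 1) := by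
      rw [mul_pow, hc, ← e1, ← e2, pow_succ, ← e1]
      ring
    rw [e4, add_smul, hx' _ _ le_rfl, add_zero, mul_smul]
  · intro i hi hir
    rcases lt_or_gt_of_ne hir with h | h
    · have : x ^ i * (y * (1 + x)) ^ (a + 1 - i) * ((a + 1).choose i : R) *
          (x ^ (a - r) * y ^ (r - 1)) = (x ^ i * (1 + x) ^ (a + 1 - i) * ((a + 1).choose i : R) *
          x ^ (a - r)) * y ^ (a + 1 - i + (r - 1)) := by
        rw [mul_pow, pow_add]
        ring
      rw [this]
      exact hy' _ _ (by omega)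
    · have : x ^ i * (y * (1 + x)) ^ (a + 1 - i) * ((a + 1).choose i : R) *
          (x ^ (a - r) * y ^ (r - 1)) = ((y * (1 + x)) ^ (a + 1 - i) * ((a + 1).choose i : R) *
          y ^ (r - 1)) * x ^ (i + (a - r)) := by
        rw [pow_add]
        ring
      rw [this]
      exact hx' _ _ (by omega)
  · intro h
    exact absurd (Finset.mem_range.2 (by omega)) h

lemma Module.End.add_add_mul_pow_apply {k : Type*} [Field k] {N : Type*} [AddCommGroup N]
    [Module k N] {x y : Module.End k N} (hxy : Commute x y) {t : N} {a r : ℕ}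
    (hx : (x ^ (a + 1)) t = 0) (hy : (y ^ (a + 1)) t = 0) (h1 : 1 ≤ r) (h2 : r ≤ a) :
    ((x + y + x * y) ^ (a + 1)) ((x ^ (a - r) * y ^ (r - 1)) t) =
      ((a + 1).choose r : k) • (x ^ a * y ^ a) t := by
  have := Algebra.isMulCommutative_adjoin k (s := ({x, y} : Set (Module.End k N))) (by
    rintro a (rfl | rfl) b (rfl | rfl)
    exacts [rfl, hxy, hxy.symm, rfl])
  let : CommRing (Algebra.adjoin k ({x, y} : Set (Module.End k N))) :=
    { (inferInstance : Ring (Algebra.adjoin k ({x, y} : Set (Module.End k N)))) with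
      mul_comm := this.is_comm.comm }
  let x' : Algebra.adjoin k ({x, y} : Set (Module.End k N)) :=
    ⟨x, Algebra.subset_adjoin (Set.mem_insert _ _)⟩
  let y' : Algebra.adjoin k ({x, y} : Set (Module.End k N)) :=
    ⟨y, Algebra.subset_adjoin (Set.mem_insert_of_mem _ rfl)⟩
  have h := add_add_mul_pow_smul (x := x') (y := y') (t := t) (a := a) (r := r) hx hy h1 h2
  refine h.trans ?_
  rw [Nat.cast_smul_eq_nsmul, Nat.cast_smul_eq_nsmul]
  rfl

namespace FDRep

variable {k : Type u} [Field k] {p n : ℕ} [Fact p.Prime]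

/-- The tensor product of linear maps between representations. -/
def homTensor (X Y U V : RepCyclic k p n) :
    TensorProduct k (homRep X Y : RepCyclic k p n) (homRep U V : RepCyclic k p n) →ₗ[k]
      (homRep (X ⊗ U) (Y ⊗ V) : RepCyclic k p n) :=
  TensorProduct.homTensorHomMap (RingHom.id k) X U Y V

-- `σ ⊗ σ - 1 = x ⊗ 1 + 1 ⊗ x + x ⊗ x` with `x = σ - 1`, on spaces of linear maps.
omit [Fact (Nat.Prime p)] in
lemma homTensor_nil (X Y U V : RepCyclic k p n)
    (t : TensorProduct k (homRep X Y : RepCyclic k p n) (homRep U V : RepCyclic k p n)) :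
    homTensor X Y U V ((TensorProduct.map (nil (homRep X Y)) LinearMap.id +
      TensorProduct.map LinearMap.id (nil (homRep U V)) +
      TensorProduct.map (nil (homRep X Y)) LinearMap.id *
        TensorProduct.map LinearMap.id (nil (homRep U V)) : Module.End k _) t) =
      nil (homRep (X ⊗ U) (Y ⊗ V)) (homTensor X Y U V t) := by
  induction t using TensorProduct.induction_on with
  | zero => simp only [map_zero]
  | add s t hs ht => simp only [map_add, hs, ht]
  | tmul φ ψ =>
    have h1 : (homRep (X ⊗ U) (Y ⊗ V)).ρ (cyclicGen p n) (homTensor X Y U V (φ ⊗ₜ[k] ψ)) =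
        homTensor X Y U V (((homRep X Y).ρ (cyclicGen p n) φ) ⊗ₜ[k]
          ((homRep U V).ρ (cyclicGen p n) ψ)) :=
      TensorProduct.ext' fun x u => rfl
    rw [nil_apply, h1, ← map_sub]
    congr 1
    have h2 : (homRep X Y).ρ (cyclicGen p n) φ = nil (homRep X Y) φ + φ := by
      rw [nil_apply, sub_add_cancel]
    have h3 : (homRep U V).ρ (cyclicGen p n) ψ = nil (homRep U V) ψ + ψ := by
      rw [nil_apply, sub_add_cancel]
    rw [h2, h3]
    simp only [LinearMap.add_apply, Module.End.mul_apply, TensorProduct.map_tmul,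
      LinearMap.id_apply, TensorProduct.add_tmul, TensorProduct.tmul_add]
    abel

/-- As `a + 1` is not a power of `p`, some `(a + 1).choose r` with `1 ≤ r ≤ a` is nonzero in `k`.
With `f = x^a φ`, the binomial computation on `φ ⊗ φ` writes this multiple of `f ⊗ f` as an `(a +
1)`-st power of the operator applied to a map. -/
lemma isDeep_tensor_self [CharP k p] {X Y : RepCyclic k p n} {f : X ⟶ Y} {a : ℕ} (ha : 1 ≤ a)
    (hap : ∀ m : ℕ, a + 1 ≠ p ^ m) (hf : IsDeep a f) : IsDeep (a + 1) (f ⊗ₘ f) := by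
  obtain ⟨φ, hφ⟩ := hf
  obtain ⟨r, hr1, hr2, hr⟩ : ∃ r, 1 ≤ r ∧ r ≤ a ∧ ((a + 1).choose r : k) ≠ 0 := by
    by_contra! h
    refine hap _ (Choose.eq_pow_multiplicity_of_choose_modEq_zero_nat (p := p) (Nat.succ_pos a)
      fun i hi => ?_)
    rw [Finset.mem_Icc] at hi
    exact (Nat.modEq_zero_iff_dvd).2 ((CharP.cast_eq_zero_iff k p _).1 (h i hi.1 (by omega)))
  let x : Module.End k (TensorProduct k (homRep X Y : RepCyclic k p n)
    (homRep X Y : RepCyclic k p n)) := TensorProduct.map (nil (homRep X Y)) LinearMap.id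
  let y : Module.End k (TensorProduct k (homRep X Y : RepCyclic k p n)
    (homRep X Y : RepCyclic k p n)) := TensorProduct.map LinearMap.id (nil (homRep X Y))
  have hx : ∀ i (α β : (homRep X Y : RepCyclic k p n)), (x ^ i) (α ⊗ₜ[k] β) =
      ((nil (homRep X Y) ^ i) α) ⊗ₜ[k] β := fun i => by
    induction i with
    | zero => exact fun _ _ => rfl
    | succ i ih => intro α β; rw [pow_succ', pow_succ', Module.End.mul_apply, ih]; rfl
  have hy : ∀ i (α β : (homRep X Y : RepCyclic k p n)), (y ^ i) (α ⊗ₜ[k] β) =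
      α ⊗ₜ[k] ((nil (homRep X Y) ^ i) β) := fun i => by
    induction i with
    | zero => exact fun _ _ => rfl
    | succ i ih => intro α β; rw [pow_succ', pow_succ', Module.End.mul_apply, ih]; rfl
  have h0 : (nil (homRep X Y) ^ (a + 1)) φ = 0 := by
    rw [pow_succ', Module.End.mul_apply, hφ, nil_toLin]
  have hxy : Commute x y := TensorProduct.ext' fun α β => rfl
  have h1 := Module.End.add_add_mul_pow_apply hxy (t := φ ⊗ₜ[k] φ) (a := a) (r := r)
    (by rw [hx, h0, TensorProduct.zero_tmul]) (by rw [hy, h0, TensorProduct.tmul_zero]) hr1 hr2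
  rw [Module.End.mul_apply (x ^ a), hy, hx, hφ] at h1
  have h2 : ∀ i t, homTensor X Y X Y (((x + y + x * y) ^ i) t) =
      (nil (homRep (X ⊗ X) (Y ⊗ Y)) ^ i) (homTensor X Y X Y t) := fun i => by
    induction i with
    | zero => exact fun _ => rfl
    | succ i ih =>
      intro t
      rw [pow_succ', pow_succ', Module.End.mul_apply, Module.End.mul_apply, ← ih]
      exact homTensor_nil X Y X Y _
  have h3 := congrArg (homTensor X Y X Y) h1
  rw [h2, map_smul] at h3
  have h4 : homTensor X Y X Y (toLin f ⊗ₜ[k] toLin f) = toLin (f ⊗ₘ f) :=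
    TensorProduct.ext' fun x u => rfl
  rw [h4] at h3
  refine ⟨((a + 1).choose r : k)⁻¹ • homTensor X Y X Y ((x ^ (a - r) * y ^ (r - 1)) (φ ⊗ₜ[k] φ)), ?_⟩
  rw [map_smul, h3, inv_smul_smul₀ hr]

lemma isDeep_socleHom (d : ℕ) : IsDeep d (socleHom k p n d) :=
  (isDeep_nilHom_iff (nil_socle d)).2 ⟨cyclicMk k p n (d + 1) 1, by rw [nil_pow_cyclicMk, mul_one]⟩

/-- The threshold of a prime tensor ideal is a power of `p`. -/
lemma exists_hasThreshold_pow [CharP k p] {I : TensorIdeal k (RepCyclic k p n)} (hI : I.IsPrime) :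
    ∃ m ≤ n, I.HasThreshold (p ^ m) := by
  obtain ⟨j, hjn, hj, -, hj'⟩ := exists_hasThreshold I
  suffices h : ∃ m, j = p ^ m by
    obtain ⟨m, rfl⟩ := h
    exact ⟨m, (Nat.pow_le_pow_iff_right (Fact.out : p.Prime).one_lt).1 hjn, hj⟩
  by_contra! h
  have hj0 : j ≠ 0 := fun h0 => hI.1 ((hj _).2 (h0 ▸ isDeep_zero _))
  have hj1 : j ≠ 1 := fun h1 => h 0 (by rw [h1, pow_zero])
  obtain ⟨a, rfl⟩ : ∃ a, j = a + 1 := ⟨j - 1, by omega⟩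
  -- The socle inclusion of depth `a` is not in the ideal, but its tensor square has depth `a + 1`
  -- and is.
  exact hj' a (Nat.lt_succ_self a) ((hI.2 _ _
    ((hj _).2 (isDeep_tensor_self (by omega) h (isDeep_socleHom a)))).elim id id)

end FDRep

end

noncomputable section

open FDRep

/-! ### The group algebra of a cyclic `p`-group -/

section GroupAlgebra

variable {k : Type u} [Field k] {p n : ℕ} [Fact p.Prime]

omit [Fact (Nat.Prime p)] in
lemma coeff_cyclicX_mul (a : MonoidAlgebra k (CyclicPGroup p n)) (g : CyclicPGroup p n) :
    (cyclicX k p n * a).coeff (cyclicGen p n * g) = a.coeff g - a.coeff (cyclicGen p n * g) := by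
  rw [cyclicX, sub_mul, one_mul, MonoidAlgebra.of_apply, MonoidAlgebra.coeff_sub,
    Finsupp.sub_apply, MonoidAlgebra.coeff_single_mul_apply, one_mul, inv_mul_cancel_left]

omit [Fact (Nat.Prime p)] in
lemma cyclicGen_pow_ne_one {j : ℕ} (hj : j ≠ 0) (hjn : j < p ^ n) : cyclicGen p n ^ j ≠ 1 := by
  intro h
  rw [← ofAdd_nsmul, nsmul_one, ← ofAdd_zero, Equiv.apply_eq_iff_eq,
    ZMod.natCast_eq_zero_iff] at h
  exact hj (Nat.eq_zero_of_dvd_of_lt h hjn)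

-- As a polynomial in `σ`, `(σ - 1)^i` is monic of degree `i`; below `p^n` the powers of `σ` are
-- distinct group elements.
omit [Fact (Nat.Prime p)] in
lemma coeff_cyclicX_pow (i : ℕ) (hi : i < p ^ n) :
    (∀ j, i < j → j < p ^ n → (cyclicX k p n ^ i).coeff (cyclicGen p n ^ j) = 0) ∧
      (cyclicX k p n ^ i).coeff (cyclicGen p n ^ i) = 1 := by
  induction i with
  | zero =>
    refine ⟨fun j hj hjn => ?_, ?_⟩
    · rw [pow_zero, MonoidAlgebra.one_def, MonoidAlgebra.coeff_single]
      exact Finsupp.single_eq_of_ne (cyclicGen_pow_ne_one hj.ne' hjn)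
    · rw [pow_zero, pow_zero, MonoidAlgebra.one_def, MonoidAlgebra.coeff_single]
      exact Finsupp.single_eq_same
  | succ i ih =>
    obtain ⟨h1, h2⟩ := ih (by omega)
    refine ⟨fun j hj hjn => ?_, ?_⟩
    · obtain ⟨j, rfl⟩ : ∃ j', j = j' + 1 := ⟨j - 1, by omega⟩
      rw [pow_succ', pow_succ' (cyclicGen p n), coeff_cyclicX_mul, ← pow_succ',
        h1 j (by omega) (by omega), h1 (j + 1) (by omega) hjn, sub_zero]
    · rw [pow_succ', pow_succ' (cyclicGen p n), coeff_cyclicX_mul, ← pow_succ', h2,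
        h1 (i + 1) (by omega) hi, sub_zero]

omit [Fact (Nat.Prime p)] in
lemma cyclicX_pow_ne_zero {i : ℕ} (hi : i < p ^ n) : cyclicX k p n ^ i ≠ 0 := fun h => by
  have := (coeff_cyclicX_pow (k := k) i hi).2
  rw [h, MonoidAlgebra.coeff_zero, Finsupp.zero_apply] at this
  exact zero_ne_one this

lemma cyclicX_pow_card [CharP k p] : cyclicX k p n ^ p ^ n = 0 := by
  have := charP_of_injective_algebraMap
    (algebraMap k (MonoidAlgebra k (CyclicPGroup p n))).injective p
  rw [cyclicX, sub_pow_char_pow, one_pow, ← map_pow, ← ofAdd_nsmul, nsmul_one, ZMod.natCast_self,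
    ofAdd_zero, map_one, sub_self]

lemma coeff_eq_of_cyclicX_mul_eq_zero {a : MonoidAlgebra k (CyclicPGroup p n)}
    (ha : cyclicX k p n * a = 0) (g : CyclicPGroup p n) : a.coeff g = a.coeff 1 := by
  have h : ∀ g, a.coeff (cyclicGen p n * g) = a.coeff g := fun g => by
    have := coeff_cyclicX_mul a g
    rw [ha, MonoidAlgebra.coeff_zero, Finsupp.zero_apply] at this
    exact (sub_eq_zero.1 this.symm).symm
  rw [← cyclicGen_pow_val g]
  induction (Multiplicative.toAdd g).val with
  | zero => rw [pow_zero]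
  | succ N ih => rw [pow_succ', h, ih]

/-- Elements killed by `σ - 1` have constant coefficients, and `x^(p^n - 1)` is such an element with
all coefficients `1`. -/
lemma exists_eq_smul_of_cyclicX_mul_eq_zero [CharP k p] {a : MonoidAlgebra k (CyclicPGroup p n)}
    (ha : cyclicX k p n * a = 0) : ∃ c : k, a = c • cyclicX k p n ^ (p ^ n - 1) := by
  have hpos : 0 < p ^ n := pow_pos (Fact.out : p.Prime).pos n
  have h0 : cyclicX k p n * cyclicX k p n ^ (p ^ n - 1) = 0 := by
    rw [← pow_succ', Nat.sub_add_cancel hpos, cyclicX_pow_card]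
  have h1 : ∀ g, (cyclicX k p n ^ (p ^ n - 1)).coeff g = 1 := fun g => by
    rw [coeff_eq_of_cyclicX_mul_eq_zero h0,
      ← coeff_eq_of_cyclicX_mul_eq_zero h0 (cyclicGen p n ^ (p ^ n - 1))]
    exact (coeff_cyclicX_pow _ (by omega)).2
  refine ⟨a.coeff 1, ?_⟩
  ext g
  rw [MonoidAlgebra.coeff_smul, Finsupp.smul_apply, h1, coeff_eq_of_cyclicX_mul_eq_zero ha,
    smul_eq_mul, mul_one]

/-- If `x^d = b x^(d+1)`, iteration gives `x^d = b^i x^(d+i)`, which vanishes for `i = p^n`. -/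
lemma cyclicMk_pow_ne_zero [CharP k p] {d : ℕ} (hd : d < p ^ n) :
    cyclicMk k p n (d + 1) (cyclicX k p n ^ d) ≠ 0 := by
  intro h
  obtain ⟨b, hb⟩ := cyclicMk_eq_zero_iff.1 h
  have h1 : ∀ i, cyclicX k p n ^ d = b ^ i * cyclicX k p n ^ (d + i) := fun i => by
    induction i with
    | zero => rw [pow_zero, one_mul, add_zero]
    | succ i ih =>
      rw [pow_succ, mul_assoc, ← add_assoc, add_right_comm, pow_add _ (d + 1), ← mul_assoc b, ← hb,
        ← pow_add, ← ih]
  refine cyclicX_pow_ne_zero (k := k) hd ?_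
  rw [h1 (p ^ n), pow_add, cyclicX_pow_card, mul_zero, mul_zero]

/-- The socle of `J_{d+1}` is generated by `x^d`: from `x a = b x^(d+1)` the element `a - b x^d` is
killed by `x`, hence is a multiple of `x^(p^n - 1)`. -/
lemma mem_range_nil_pow_of_nil_eq_zero [CharP k p] {d : ℕ} (hd : d < p ^ n)
    {v : cyclicJ k p n (d + 1)} (hv : nil (cyclicJ k p n (d + 1)) v = 0) :
    v ∈ LinearMap.range (nil (cyclicJ k p n (d + 1)) ^ d) := by
  obtain ⟨a, rfl⟩ := cyclicMk_surjective _ v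
  rw [nil_cyclicMk] at hv
  obtain ⟨b, hb⟩ := cyclicMk_eq_zero_iff.1 hv
  obtain ⟨c, hc⟩ := exists_eq_smul_of_cyclicX_mul_eq_zero (k := k) (p := p) (n := n)
    (a := a - b * cyclicX k p n ^ d) (by rw [mul_sub, hb, pow_succ]; ring)
  refine ⟨cyclicMk k p n (d + 1) (b + c • cyclicX k p n ^ (p ^ n - 1 - d)), ?_⟩
  rw [nil_pow_cyclicMk, mul_add, mul_smul_comm, ← pow_add, Nat.add_sub_cancel' (by omega), ← hc]
  congr 1
  ring

end GroupAlgebra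

/-! ### Extensions of cyclic `p`-groups -/

section Extension

variable (p : ℕ) [Fact p.Prime] {m n : ℕ} (hm : m ≤ n)

omit [Fact (Nat.Prime p)] in
include hm in
lemma pow_sub_mul_pow_cancel : p ^ (n - m) * p ^ m = p ^ n := by
  rw [← pow_add, Nat.sub_add_cancel hm]

/-- Multiplication by `p ^ m` as a homomorphism `ZMod (p ^ (n - m)) → ZMod (p ^ n)`. -/
def mulPow : ZMod (p ^ (n - m)) →+ ZMod (p ^ n) :=
  ZMod.lift (p ^ (n - m)) ⟨zmultiplesHom (ZMod (p ^ n)) ((p ^ m : ℕ) : ZMod (p ^ n)), by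
    rw [zmultiplesHom_apply, natCast_zsmul, nsmul_eq_mul, ← Nat.cast_mul, pow_sub_mul_pow_cancel p hm,
      ZMod.natCast_self]⟩

omit [Fact (Nat.Prime p)] in
lemma mulPow_intCast (i : ℤ) : mulPow p hm (i : ZMod (p ^ (n - m))) =
    ((i * (p ^ m : ℕ) : ℤ) : ZMod (p ^ n)) := by
  refine (ZMod.lift_coe _ _ _).trans ?_
  rw [zmultiplesHom_apply, zsmul_eq_mul, Int.cast_mul, Int.cast_natCast]

lemma mulPow_injective : Function.Injective (mulPow p hm) := by
  refine (injective_iff_map_eq_zero _).2 fun z hz => ?_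
  obtain ⟨i, rfl⟩ := ZMod.intCast_surjective z
  rw [mulPow_intCast, ZMod.intCast_zmod_eq_zero_iff_dvd, ← pow_sub_mul_pow_cancel p hm, Nat.cast_mul] at hz
  rw [ZMod.intCast_zmod_eq_zero_iff_dvd]
  exact Int.dvd_of_mul_dvd_mul_right
    (by exact_mod_cast (pow_pos (Fact.out : p.Prime).pos m).ne') hz

omit [Fact (Nat.Prime p)] in
lemma castHom_eq_zero_iff (z : ZMod (p ^ n)) :
    ZMod.castHom (pow_dvd_pow p hm) (ZMod (p ^ m)) z = 0 ↔ ∃ y, mulPow p hm y = z := by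
  constructor
  · intro h
    obtain ⟨i, rfl⟩ := ZMod.intCast_surjective z
    rw [map_intCast, ZMod.intCast_zmod_eq_zero_iff_dvd] at h
    obtain ⟨q, rfl⟩ := h
    exact ⟨q, by rw [mulPow_intCast, mul_comm]⟩
  · rintro ⟨y, rfl⟩
    obtain ⟨i, rfl⟩ := ZMod.intCast_surjective y
    rw [mulPow_intCast, map_intCast, Int.cast_mul, Int.cast_natCast, ZMod.natCast_self, mul_zero]

/-- The extension `C_{p^(n-m)} → C_{p^n} → C_{p^m}`. -/
def cyclicExtension : PExtension p (CyclicPGroup p (n - m)) (CyclicPGroup p n)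
    (CyclicPGroup p m) where
  incl := AddMonoidHom.toMultiplicative (mulPow p hm)
  proj := AddMonoidHom.toMultiplicative
    (ZMod.castHom (pow_dvd_pow p hm) (ZMod (p ^ m))).toAddMonoidHom
  incl_injective := mulPow_injective p hm
  proj_surjective := ZMod.castHom_surjective (pow_dvd_pow p hm)
  proj_eq_one_iff := castHom_eq_zero_iff p hm
  isPGroup x := ⟨n - m, by
    rw [← ofAdd_toAdd x, ← ofAdd_nsmul, nsmul_eq_mul, ZMod.natCast_self, zero_mul, ofAdd_zero]⟩

lemma cyclicExtension_incl_gen :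
    (cyclicExtension p hm).incl (cyclicGen p (n - m)) = cyclicGen p n ^ p ^ m := by
  have h := mulPow_intCast p hm 1
  rw [Int.cast_one, one_mul, Int.cast_natCast] at h
  rw [← ofAdd_nsmul, nsmul_one]
  exact congrArg Multiplicative.ofAdd h

lemma cyclicExtension_incl (h : CyclicPGroup p (n - m)) :
    ∃ N : ℕ, (cyclicExtension p hm).incl h = (cyclicGen p n ^ p ^ m) ^ N :=
  ⟨_, by rw [← cyclicExtension_incl_gen p hm, ← map_pow, cyclicGen_pow_val h]⟩

end Extension

/-! ### The ideals defined by the extensions -/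

section Ideals

variable (k : Type u) [Field k] {p : ℕ} [Fact p.Prime] [CharP k p] {m n : ℕ} (hm : m ≤ n)

/-- Here `v = (σ^(p^m) - 1) w`, and `σ^(p^m)` generates the image of the subgroup. Every functional
invariant under the subgroup kills such a vector, so the restricted morphism is negligible. -/
lemma nilHom_mem_ideal {V : RepCyclic k p n} {v : V} (hv : nil V v = 0)
    (h : v ∈ LinearMap.range (nil V ^ p ^ m)) :
    nilHom V v hv ∈ ((cyclicExtension p hm).ideal k).hom _ _ := by
  obtain ⟨w, rfl⟩ := h
  rw [PExtension.mem_ideal_iff]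
  intro g
  have h1 : toLin g ((nil V ^ p ^ m) w) = 0 := by
    have h2 := toLin_ρ g (cyclicGen p (n - m)) w
    have h3 : (((cyclicExtension p hm).res k).obj V).ρ (cyclicGen p (n - m)) w =
        V.ρ (cyclicGen p n ^ p ^ m) w := by
      rw [← cyclicExtension_incl_gen p hm]
      rfl
    rw [nil_pow_char_pow]
    refine ((toLin g).map_sub (V.ρ (cyclicGen p n ^ p ^ m) w) w).trans ?_
    rw [← h3, h2]
    exact sub_self _
  have h4 : toLin (((cyclicExtension p hm).res k).map (nilHom V _ hv) ≫ g) = 0 :=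
    LinearMap.ext fun (c : k) => ((toLin g).map_smul c _).trans (by rw [h1, smul_zero]; rfl)
  rw [h4, map_zero]

/-- The subgroup acts trivially on `V`, so every functional is a morphism of the restrictions; one
with `ψ v ≠ 0` gives a composite of nonzero trace. -/
lemma nilHom_not_mem_ideal {V : RepCyclic k p n} {v : V} (hv : nil V v = 0) (hv0 : v ≠ 0)
    (h : nil V ^ p ^ m = 0) :
    nilHom V v hv ∉ ((cyclicExtension p hm).ideal k).hom _ _ := by
  rw [PExtension.mem_ideal_iff]
  intro hneg
  obtain ⟨ψ, hψ⟩ : ∃ ψ : Module.Dual k V, ψ v ≠ 0 := by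
    by_contra! h0
    exact hv0 ((Module.forall_dual_apply_eq_zero_iff k v).1 h0)
  have h1 : V.ρ (cyclicGen p n ^ p ^ m) = 1 := by
    rw [nil_pow_char_pow] at h
    exact sub_eq_zero.1 h
  let g : ((cyclicExtension p hm).res k).obj V ⟶ ((cyclicExtension p hm).res k).obj (𝟙_ _) :=
    homMk (X := ((cyclicExtension p hm).res k).obj V)
      (Y := ((cyclicExtension p hm).res k).obj (𝟙_ _)) ψ fun x w => by
      obtain ⟨N, hN⟩ := cyclicExtension_incl p hm x
      change ψ (V.ρ ((cyclicExtension p hm).incl x) w) = ψ w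
      rw [hN, map_pow, h1, one_pow]
      rfl
  have h2 : toLin (((cyclicExtension p hm).res k).map (nilHom V v hv) ≫ g) =
      ψ v • (LinearMap.id : k →ₗ[k] k) :=
    LinearMap.ext fun (c : k) => (ψ.map_smul c v).trans (mul_comm _ _)
  have h3 := hneg g
  rw [h2] at h3
  refine hψ ?_
  have h4 : LinearMap.trace k k (ψ v • (LinearMap.id : k →ₗ[k] k)) = ψ v := by
    rw [map_smul, LinearMap.trace_id, Module.finrank_self, Nat.cast_one, smul_eq_mul, mul_one]
  exact h4.symm.trans h3

lemma socleHom_not_mem_ideal {d : ℕ} (hd : d + 1 = p ^ m) :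
    socleHom k p n d ∉ ((cyclicExtension p hm).ideal k).hom _ _ := by
  have hmn : p ^ m ≤ p ^ n := Nat.pow_le_pow_right (Fact.out : p.Prime).pos hm
  refine nilHom_not_mem_ideal k hm (nil_socle d) (cyclicMk_pow_ne_zero (by omega)) ?_
  refine LinearMap.ext fun v => ?_
  obtain ⟨a, rfl⟩ := cyclicMk_surjective _ v
  rw [nil_pow_cyclicMk, ← hd, mul_comm]
  exact cyclicMk_eq_zero_iff.2 ⟨a, rfl⟩

lemma ideal_hasThreshold : ((cyclicExtension p hm).ideal k).HasThreshold (p ^ m) :=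
  hasThreshold_of _ _ (nilHom_mem_ideal k hm (nil_socle _)
    ⟨_, (nil_pow_cyclicMk _ _ 1).trans (by rw [mul_one])⟩) fun _ hd => socleHom_not_mem_ideal k hm hd

omit [CharP k p] in
lemma cyclicIdeal_le {I : TensorIdeal k (RepCyclic k p n)} {j : ℕ}
    (h : ∀ (U V : RepCyclic k p n) (f : U ⟶ V), SocleInclusion k p n j f → f ∈ I.hom U V)
    {X Y : RepCyclic k p n} {f : X ⟶ Y} (hf : f ∈ (cyclicIdeal k p n j).hom X Y) : f ∈ I.hom X Y := by
  refine (Submodule.mem_iInf _).1 ((Submodule.mem_iInf _).1 hf I) h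

-- The ideal contains the socle inclusion of depth `p^m`, trivially so when `p^m = p^n`. It cannot
-- contain the preceding one, since its generators lie in the kernel attached to the extension,
-- which does not.
include hm in
lemma cyclicIdeal_hasThreshold : (cyclicIdeal k p n (p ^ m)).HasThreshold (p ^ m) := by
  refine hasThreshold_of _ _ ?_ fun d hd hd' => ?_
  · rcases Nat.lt_or_ge (p ^ m) (p ^ n) with hlt | hge
    · refine (Submodule.mem_iInf _).2 fun I => (Submodule.mem_iInf _).2 fun hI => ?_
      refine hI _ _ _ (.intro hlt _ ((FDRep.mono_iff_injective _).2 ?_))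
      refine (injective_iff_map_eq_zero _).2 fun (c : k) hc => ?_
      exact (smul_eq_zero.1 hc).resolve_right (cyclicMk_pow_ne_zero hlt)
    · exact socleHom_mem_of_le _ hge
  -- A monomorphism `𝟙 ⟶ J_{p^m+1}` hits the socle, which is the range of `x^(p^m)`.
  · have h1 : socleHom k p n d ∈ ((cyclicExtension p hm).ideal k).hom _ _ := by
      refine cyclicIdeal_le k (fun U V f hf => ?_) hd'
      obtain ⟨hlt, f, -⟩ := hf
      have h2 : nil (cyclicJ k p n (p ^ m + 1)) (toLin f (1 : k)) = 0 := by
        rw [← toLin_nil f (1 : k)]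
        exact (congrArg (toLin f) (sub_self (1 : k))).trans (map_zero _)
      have h3 : f = nilHom _ _ h2 := toLin_injective (LinearMap.ext fun (c : k) => by
        refine Eq.trans ?_ ((toLin f).map_smul c (1 : k))
        exact congrArg (toLin f) (mul_one c).symm)
      rw [h3]
      exact nilHom_mem_ideal k hm h2 (mem_range_nil_pow_of_nil_eq_zero hlt h2)
    exact socleHom_not_mem_ideal k hm hd h1

include hm in
lemma cyclicIdeal_eq_ideal : cyclicIdeal k p n (p ^ m) = (cyclicExtension p hm).ideal k :=
  TensorIdeal.HasThreshold.ext (cyclicIdeal_hasThreshold k hm) (ideal_hasThreshold k hm)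

/-- The prime tensor ideals are the ideals `𝓘_{p ^ m}`. -/
theorem isPrime_iff_exists_eq_cyclicIdeal (I : TensorIdeal k (RepCyclic k p n)) :
    I.IsPrime ↔ ∃ m ≤ n, I = cyclicIdeal k p n (p ^ m) := by
  constructor
  · intro hI
    obtain ⟨m, hm, hj⟩ := exists_hasThreshold_pow hI
    exact ⟨m, hm, TensorIdeal.HasThreshold.ext hj (cyclicIdeal_hasThreshold k hm)⟩
  · rintro ⟨m, hm, rfl⟩
    rw [cyclicIdeal_eq_ideal k hm]
    exact ((cyclicExtension p hm).ideal_isAbelianType k).isFaithfullyPrime.isPrime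

/-- The tensor ideals of abelian type are the ideals `𝓘_{p ^ m}`. -/
theorem isAbelianType_iff_exists_eq_cyclicIdeal (I : TensorIdeal k (RepCyclic k p n)) :
    I.IsAbelianType ↔ ∃ m ≤ n, I = cyclicIdeal k p n (p ^ m) := by
  refine ⟨fun hI => (isPrime_iff_exists_eq_cyclicIdeal k I).1 hI.isFaithfullyPrime.isPrime, ?_⟩
  rintro ⟨m, hm, rfl⟩
  rw [cyclicIdeal_eq_ideal k hm]
  exact (cyclicExtension p hm).ideal_isAbelianType k

end Ideals

end

noncomputable section

/-! ### Thick tensor ideals -/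

lemma TensorIdeal.IsPrime.ob {k : Type u} [Field k] {A : Type u₁} [Category.{v₁} A]
    [Preadditive A] [Linear k A] [MonoidalCategory A] [HasBinaryBiproducts A]
    {I : TensorIdeal k A} (hI : I.IsPrime) : I.ob.IsPrime :=
  ⟨hI.1, fun X Y h => hI.2 (𝟙 X) (𝟙 Y) (by rw [id_tensorHom_id]; exact h)⟩

namespace ThickTensorIdeal

section Preadditive

variable {A : Type u₁} [Category.{v₁} A] [Abelian A] [MonoidalCategory A]
  (J : ThickTensorIdeal A)

lemma mem_of_retract {X Z : A} (hZ : Z ∈ J.carrier) (a : X ⟶ Z) (b : Z ⟶ X) (h : a ≫ b = 𝟙 X) :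
    X ∈ J.carrier := by
  have : IsSplitMono a := ⟨⟨⟨b, h⟩⟩⟩
  let e := biprod.uniqueUpToIso _ _
    (isBilimitBinaryBiconeOfIsSplitMonoOfCokernel (cokernelIsCokernel a))
  exact ((J.biprod_mem_iff _ _).1 (J.mem_of_iso e hZ)).1

variable (k : Type u) [Field k] [Linear k A] [MonoidalPreadditive A]

/-- The tensor ideal of all morphisms that factor through an object of a thick tensor ideal. -/
def toTensorIdeal : TensorIdeal k A where
  hom X Y :=
    { carrier := {f | ∃ Z ∈ J.carrier, ∃ (a : X ⟶ Z) (b : Z ⟶ Y), a ≫ b = f}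
      zero_mem' := (HasZeroObject.zero (C := A)).elim fun Z hZ => ⟨Z, J.zero_mem hZ, 0, 0, comp_zero⟩
      add_mem' := by
        rintro _ _ ⟨Z, hZ, a, b, rfl⟩ ⟨Z', hZ', a', b', rfl⟩
        exact ⟨Z ⊞ Z', (J.biprod_mem_iff _ _).2 ⟨hZ, hZ'⟩, biprod.lift a a', biprod.desc b b',
          biprod.lift_desc⟩
      smul_mem' := by
        rintro c _ ⟨Z, hZ, a, b, rfl⟩
        exact ⟨Z, hZ, c • a, b, Linear.smul_comp _ _ _ _ _ _⟩ }
  comp_left_mem := by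
    rintro _ _ _ f _ ⟨Z, hZ, a, b, rfl⟩
    exact ⟨Z, hZ, f ≫ a, b, Category.assoc _ _ _⟩
  comp_right_mem := by
    rintro _ _ _ _ g ⟨Z, hZ, a, b, rfl⟩
    exact ⟨Z, hZ, a, b ≫ g, (Category.assoc _ _ _).symm⟩
  whiskerLeft_mem := by
    rintro W _ _ _ ⟨Z, hZ, a, b, rfl⟩
    exact ⟨W ⊗ Z, J.tensor_left_mem W hZ, W ◁ a, W ◁ b, (whiskerLeft_comp _ _ _).symm⟩
  whiskerRight_mem := by
    rintro _ _ _ W ⟨Z, hZ, a, b, rfl⟩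
    exact ⟨Z ⊗ W, J.tensor_right_mem W hZ, a ▷ W, b ▷ W, (comp_whiskerRight _ _ _).symm⟩

omit [MonoidalPreadditive A] in
lemma id_mem_toTensorIdeal_iff {X : A} :
    𝟙 X ∈ (J.toTensorIdeal k).hom X X ↔ X ∈ J.carrier :=
  ⟨fun ⟨_, hZ, a, b, h⟩ => J.mem_of_retract hZ a b h,
    fun h => ⟨X, h, 𝟙 X, 𝟙 X, Category.comp_id _⟩⟩

end Preadditive

end ThickTensorIdeal

/-! ### Prime thick tensor ideals of representations of the cyclic group. -/

namespace FDRep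

variable {k : Type u} [Field k] {p n : ℕ} [Fact p.Prime] [CharP k p]

/-- While the depth `a` is below `j`, `a + 1` lies strictly between `p^m` and `p^(m+1)`, so the
identity of `X ⊗ X` has depth `a + 1`. Repeated squaring reaches `j`, and primeness of `J` brings
membership back to `X`. -/
lemma mem_of_isDeep_id {J : ThickTensorIdeal (RepCyclic k p n)} (hJ : J.IsPrime) {j m : ℕ}
    (hj : (J.toTensorIdeal k).HasThreshold j) (hm : j < p ^ (m + 1)) {a : ℕ} (ha : p ^ m ≤ a)
    {X : RepCyclic k p n} (hX : IsDeep a (𝟙 X)) : X ∈ J.carrier := by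
  obtain h | h := Nat.lt_or_ge a j
  · have h1 : IsDeep (a + 1) (𝟙 (X ⊗ X)) := by
      rw [← id_tensorHom_id]
      refine isDeep_tensor_self ((Nat.one_le_pow _ _ (Fact.out : p.Prime).pos).trans ha)
        (fun m' hm' => ?_) hX
      have h2 : m < m' := (Nat.pow_lt_pow_iff_right (Fact.out : p.Prime).one_lt).1 (by omega)
      have h3 : m' < m + 1 := (Nat.pow_lt_pow_iff_right (Fact.out : p.Prime).one_lt).1
        (hm'.symm.trans_lt ((Nat.succ_le_of_lt h).trans_lt hm))
      omega
    exact (hJ.2 X X (mem_of_isDeep_id hJ hj hm (ha.trans (Nat.le_succ a)) h1)).elim id id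
  · exact (J.id_mem_toTensorIdeal_iff k).1 ((hj _).2 (hX.mono h))
termination_by j - a

/-- Every prime thick tensor ideal comes from a tensor ideal `𝓘_{p ^ m}`. -/
lemma exists_ob_cyclicIdeal_eq {J : ThickTensorIdeal (RepCyclic k p n)} (hJ : J.IsPrime) :
    ∃ m ≤ n, (cyclicIdeal k p n (p ^ m)).ob = J := by
  obtain ⟨j, hjn, hj, -, -⟩ := exists_hasThreshold (J.toTensorIdeal k)
  have hp := (Fact.out : p.Prime).one_lt
  have hj0 : j ≠ 0 := fun h0 =>
    hJ.1 ((J.id_mem_toTensorIdeal_iff k).1 ((hj _).2 (h0 ▸ isDeep_zero _)))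
  have h1 : p ^ Nat.log p j ≤ j := Nat.pow_log_le_self p hj0
  have h2 : Nat.log p j ≤ n := (Nat.pow_le_pow_iff_right hp).1 (h1.trans hjn)
  -- The exponent is that of the largest power of `p` not exceeding the threshold of the ideal of
  -- morphisms factoring through `J`.
  refine ⟨Nat.log p j, h2, ThickTensorIdeal.ext (Set.ext fun X => ?_)⟩
  refine (cyclicIdeal_hasThreshold k h2 (𝟙 X)).trans ⟨fun hX => ?_, fun hX => ?_⟩
  · exact mem_of_isDeep_id hJ hj (Nat.lt_pow_succ_log_self hp j) le_rfl hX
  · exact ((hj _).1 ((J.id_mem_toTensorIdeal_iff k).2 hX)).mono h1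

omit [CharP k p] in
/-- The functions on a cyclic quotient of the cyclic group. -/
def cyclicFun (k : Type u) [Field k] (p : ℕ) [Fact p.Prime] {m n : ℕ} (hm : m ≤ n) :
    RepCyclic k p n :=
  FDRep.of (V := ZMod (p ^ m) → k)
    { toFun := fun g => LinearMap.funLeft k k fun z =>
        z + ZMod.castHom (pow_dvd_pow p hm) (ZMod (p ^ m)) (Multiplicative.toAdd g)
      map_one' := LinearMap.ext fun f => funext fun z => by
        rw [LinearMap.funLeft_apply, toAdd_one, map_zero, add_zero, Module.End.one_apply]
      map_mul' := fun g h => LinearMap.ext fun f => funext fun z => by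
        rw [Module.End.mul_apply, LinearMap.funLeft_apply, LinearMap.funLeft_apply,
          LinearMap.funLeft_apply, toAdd_mul, map_add, add_assoc] }

omit [CharP k p] in
lemma cyclicFun_ρ_pow_apply {m : ℕ} (hm : m ≤ n) (q : ℕ) (f : ZMod (p ^ m) → k) (z : ZMod (p ^ m)) :
    (show ZMod (p ^ m) → k from (cyclicFun k p hm).ρ (cyclicGen p n ^ q) f) z = f (z + q) := by
  refine (LinearMap.funLeft_apply k k _ f z).trans ?_
  rw [← ofAdd_nsmul, nsmul_one, toAdd_ofAdd, map_natCast]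

/-- The digit function `z ↦ ⌊z / p^m⌋` increases by one under translation by `p^m`, also on wrapping
around: the error `p^(m'-m)` vanishes in `k`. -/
lemma natCast_val_add_div {m m' : ℕ} (h : m < m') (z : ZMod (p ^ m')) :
    (((z + (p ^ m : ℕ)).val / p ^ m : ℕ) : k) = ((z.val / p ^ m : ℕ) : k) + 1 := by
  have hp := (Fact.out : p.Prime).one_lt
  have hq : 0 < p ^ m := pow_pos (Fact.out : p.Prime).pos m
  have h1 : p ^ m < p ^ m' := Nat.pow_lt_pow_right hp h
  have h2 : ((p ^ m : ℕ) : ZMod (p ^ m')).val = p ^ m := ZMod.val_cast_of_lt h1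
  have h3 : (z.val + p ^ m) / p ^ m = z.val / p ^ m + 1 := Nat.add_div_right _ hq
  rcases Nat.lt_or_ge (z.val + p ^ m) (p ^ m') with h4 | h4
  · rw [ZMod.val_add_of_lt (by rw [h2]; exact h4), h2, h3, Nat.cast_add, Nat.cast_one]
  · have h5 := ZMod.val_add_val_of_le (a := z) (b := ((p ^ m : ℕ) : ZMod (p ^ m')))
      (by rw [h2]; exact h4)
    rw [h2] at h5
    have h6 : p ^ m' = p ^ (m' - m) * p ^ m := by rw [← pow_add, Nat.sub_add_cancel h.le]
    rw [← Nat.cast_one (R := k), ← Nat.cast_add, ← h3, h5]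
    have h7 : ∀ a, (a + p ^ m') / p ^ m = a / p ^ m + p ^ (m' - m) := fun a => by
      rw [h6, Nat.add_mul_div_right _ _ hq]
    have h8 : ((p ^ (m' - m) : ℕ) : k) = 0 := by
      rw [Nat.cast_pow, CharP.cast_eq_zero k p, zero_pow (by omega)]
    rw [h7, Nat.cast_add _ (p ^ (m' - m)), h8, add_zero]

/-- Multiplication by the digit function changes by the identity when conjugated by translation by
`p^m`, so `x^(p^m)` sends it to the identity. -/
lemma isDeep_id_cyclicFun {m m' : ℕ} (h : m < m') (hm' : m' ≤ n) :
    IsDeep (p ^ m) (𝟙 (cyclicFun k p hm')) := by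
  let φ : (ZMod (p ^ m') → k) →ₗ[k] (ZMod (p ^ m') → k) :=
    LinearMap.mulLeft k fun z => ((z.val / p ^ m : ℕ) : k)
  refine ⟨φ, ?_⟩
  rw [nil_pow_char_pow]
  refine LinearMap.ext fun f => funext fun z => ?_
  have h1 : (show ZMod (p ^ m') → k from (cyclicFun k p hm').ρ (cyclicGen p n ^ p ^ m)
      (φ ((cyclicFun k p hm').ρ (cyclicGen p n ^ p ^ m)⁻¹ f))) z =
      (((z + (p ^ m : ℕ)).val / p ^ m : ℕ) : k) * f z := by
    rw [cyclicFun_ρ_pow_apply]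
    refine congrArg ((((z + (p ^ m : ℕ)).val / p ^ m : ℕ) : k) * ·) ?_
    refine (cyclicFun_ρ_pow_apply hm' (p ^ m) _ z).symm.trans ?_
    rw [← Module.End.mul_apply, ← map_mul, mul_inv_cancel, map_one]
    rfl
  have h2 : φ f z = ((z.val / p ^ m : ℕ) : k) * f z := rfl
  refine (congrArg₂ (· - ·) h1 h2).trans ?_
  rw [natCast_val_add_div h, add_mul, add_sub_cancel_left, one_mul]
  rfl

/-- On functions on `ZMod (p^m)` the element `σ^(p^m)` acts trivially, so `x^(p^m)` annihilates all
endomorphisms and cannot reach the nonzero identity. -/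
lemma not_isDeep_id_cyclicFun {m : ℕ} (hm : m ≤ n) :
    ¬ IsDeep (p ^ m) (𝟙 (cyclicFun k p hm)) := by
  rintro ⟨φ, hφ⟩
  rw [nil_pow_char_pow] at hφ
  have h1 : (cyclicFun k p hm).ρ (cyclicGen p n ^ p ^ m) = 1 :=
    LinearMap.ext fun f => funext fun z => by
      refine (cyclicFun_ρ_pow_apply hm (p ^ m) f z).trans ?_
      rw [ZMod.natCast_self, add_zero]
      rfl
  have h2 : (cyclicFun k p hm).ρ (cyclicGen p n ^ p ^ m)⁻¹ = 1 := by
    have := map_mul (cyclicFun k p hm).ρ (cyclicGen p n ^ p ^ m) (cyclicGen p n ^ p ^ m)⁻¹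
    rwa [mul_inv_cancel, map_one, h1, one_mul, eq_comm] at this
  have h3 : (homRep (cyclicFun k p hm) (cyclicFun k p hm)).ρ (cyclicGen p n ^ p ^ m) φ = φ := by
    change (cyclicFun k p hm).ρ (cyclicGen p n ^ p ^ m) ∘ₗ φ ∘ₗ
      (cyclicFun k p hm).ρ (cyclicGen p n ^ p ^ m)⁻¹ = φ
    rw [h1, h2]
    rfl
  have h4 : toLin (𝟙 (cyclicFun k p hm)) = 0 := hφ.symm.trans (sub_eq_zero.2 h3)
  have h5 : (1 : k) = 0 := congrFun (LinearMap.congr_fun h4 (fun _ : ZMod (p ^ m) => (1 : k))) 0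
  exact one_ne_zero h5

lemma ob_cyclicIdeal_ne {m m' : ℕ} (h : m < m') (hm' : m' ≤ n) :
    (cyclicIdeal k p n (p ^ m)).ob ≠ (cyclicIdeal k p n (p ^ m')).ob := by
  intro he
  have h1 : cyclicFun k p hm' ∈ (cyclicIdeal k p n (p ^ m)).ob.carrier :=
    (cyclicIdeal_hasThreshold k (h.le.trans hm') _).2 (isDeep_id_cyclicFun h hm')
  rw [he] at h1
  exact not_isDeep_id_cyclicFun hm' ((cyclicIdeal_hasThreshold k hm' _).1 h1)

lemma bijOn_ob : Set.BijOn (TensorIdeal.ob (k := k) (A := RepCyclic k p n))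
    {I | I.IsPrime} {J | J.IsPrime} := by
  refine ⟨fun I hI => hI.ob, fun I hI I' hI' h => ?_, fun J hJ => ?_⟩
  · obtain ⟨m, hm, rfl⟩ := (isPrime_iff_exists_eq_cyclicIdeal k I).1 hI
    obtain ⟨m', hm', rfl⟩ := (isPrime_iff_exists_eq_cyclicIdeal k I').1 hI'
    rcases lt_trichotomy m m' with h1 | rfl | h1
    · exact absurd h (ob_cyclicIdeal_ne h1 hm')
    · rfl
    · exact absurd h.symm (ob_cyclicIdeal_ne h1 hm)
  · obtain ⟨m, hm, h⟩ := exists_ob_cyclicIdeal_eq hJ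
    exact ⟨_, (isPrime_iff_exists_eq_cyclicIdeal k _).2 ⟨m, hm, rfl⟩, h⟩

end FDRep

end

/-! ### The abelian envelopes as Deligne products. -/

noncomputable section

namespace FDRep

variable (k : Type u) [Field k] {p : ℕ} [Fact p.Prime] [CharP k p] {m n : ℕ} (hm : m ≤ n)

variable (H : Type) [Group H] in
/-- The functor from vector spaces to the semisimplification of a category of representations. -/
abbrev vecToSemisimple : FGModuleCat.{u} k ⥤ (negligible k H).Quot :=
  trivialAction (FGModuleCat.{u} k) H ⋙ (negligible k H).toQuot

include hm in
/-- The quotient by `𝓘_{p ^ m}` has an abelian envelope whose target is a Deligne tensor product. -/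
theorem exists_isDeligneProduct_isAbelianEnvelope :
    ∃ (P : TensorCat.{u, u, u + 1} k)
      (T : RepCyclic k p m × SemisimpleRepCyclic k p (n - m) ⥤ P.carrier) (_ : T.Monoidal)
      (F : (cyclicIdeal k p n (p ^ m)).Quot ⥤ P.carrier) (_ : F.Monoidal),
        IsDeligneProduct.{u, v, w, u, u + 1, u, u + 1, u, u + 1} k T ∧
          IsAbelianEnvelope.{u, v, w, u, u + 1, u, u + 1} k F := by
  rw [cyclicIdeal_eq_ideal k hm]
  have h := isDeligneProduct_deligneTensor.{u, v, w} (k := k) (G := CyclicPGroup p m)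
    (vecToSemisimple k (CyclicPGroup p (n - m)))
    (negligible_isSplit k (CyclicPGroup p (n - m))).exists_comp_comp_eq
    ⟨cyclicGen p m, fun g => ⟨_, cyclicGen_pow_val g⟩⟩
  exact ⟨equivariantTensorCat k (CyclicPGroup p (n - m)) (CyclicPGroup p m),
    deligneTensor (vecToSemisimple k (CyclicPGroup p (n - m))) (CyclicPGroup p m),
    inferInstanceAs (deligneTensor (vecToSemisimple k (CyclicPGroup p (n - m)))
      (CyclicPGroup p m)).Monoidal,
    (cyclicExtension p hm).envelope k, inferInstanceAs ((cyclicExtension p hm).envelope k).Monoidal,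
    h, (cyclicExtension p hm).isAbelianEnvelope k⟩

end FDRep

end

theorem mainTheorem9 (k : Type u) [Field k] (p : ℕ) [Fact p.Prime] [CharP k p]
    (n : ℕ) (hn : 0 < n) :
    -- the inclusions and the maps `Ob` between abelian-type, faithfully prime, prime tensor ideals
    -- and prime thick tensor ideals are well defined and bijective
    ({I : TensorIdeal k (RepCyclic k p n) | I.IsAbelianType} = {I | I.IsFaithfullyPrime} ∧
      {I : TensorIdeal k (RepCyclic k p n) | I.IsFaithfullyPrime} = {I | I.IsPrime} ∧
      Set.BijOn (TensorIdeal.ob (k := k) (A := RepCyclic k p n))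
        {I | I.IsAbelianType} {J | J.IsPrime} ∧
      Set.BijOn (TensorIdeal.ob (k := k) (A := RepCyclic k p n))
        {I | I.IsFaithfullyPrime} {J | J.IsPrime} ∧
      Set.BijOn (TensorIdeal.ob (k := k) (A := RepCyclic k p n))
        {I | I.IsPrime} {J | J.IsPrime}) ∧
    -- the prime, equivalently abelian-type, ideals are exactly the `𝓘_{p ^ m}` for `0 ≤ m ≤ n`
    (∀ I : TensorIdeal k (RepCyclic k p n),
      I.IsPrime ↔ ∃ m ≤ n, I = cyclicIdeal k p n (p ^ m)) ∧
    (∀ I : TensorIdeal k (RepCyclic k p n),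
      I.IsAbelianType ↔ ∃ m ≤ n, I = cyclicIdeal k p n (p ^ m)) ∧
    -- every quotient by a tensor ideal of abelian type has an abelian envelope
    (∀ I : TensorIdeal k (RepCyclic k p n), I.IsAbelianType →
      ∃ (P : TensorCat.{u, u, u + 1} k) (F : I.Quot ⥤ P.carrier) (_ : F.Monoidal),
        IsAbelianEnvelope.{u, v, w, u, u + 1, u, u + 1} k F) ∧
    -- the envelope of the quotient by `𝓘_{p ^ m}` is the Deligne product of `Rep C_{p ^ m}` and the
    -- semisimplification of `Rep C_{p ^ (n - m)}`, with its tensor structure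
    (∀ m ≤ n, ∃ (P : TensorCat.{u, u, u + 1} k)
      (T : RepCyclic k p m × SemisimpleRepCyclic k p (n - m) ⥤ P.carrier) (_ : T.Monoidal)
      (F : (cyclicIdeal k p n (p ^ m)).Quot ⥤ P.carrier) (_ : F.Monoidal),
        IsDeligneProduct.{u, v, w, u, u + 1, u, u + 1, u, u + 1} k T ∧ IsAbelianEnvelope.{u, v, w, u, u + 1, u, u + 1} k F) := by
  have h1 : ∀ I : TensorIdeal k (RepCyclic k p n), I.IsAbelianType ↔ I.IsPrime := fun I =>
    (isAbelianType_iff_exists_eq_cyclicIdeal k I).trans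
      (isPrime_iff_exists_eq_cyclicIdeal k I).symm
  have h2 : {I : TensorIdeal k (RepCyclic k p n) | I.IsAbelianType} = {I | I.IsFaithfullyPrime} :=
    Set.ext fun I => ⟨fun h => h.isFaithfullyPrime, fun h => (h1 I).2 h.isPrime⟩
  have h3 : {I : TensorIdeal k (RepCyclic k p n) | I.IsFaithfullyPrime} = {I | I.IsPrime} :=
    h2.symm.trans (Set.ext h1)
  refine ⟨⟨h2, h3, ?_, ?_, FDRep.bijOn_ob⟩, isPrime_iff_exists_eq_cyclicIdeal k,
    isAbelianType_iff_exists_eq_cyclicIdeal k, fun I hI => ?_,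
    fun m hm => FDRep.exists_isDeligneProduct_isAbelianEnvelope k hm⟩
  · rw [h2, h3]
    exact FDRep.bijOn_ob
  · rw [h3]
    exact FDRep.bijOn_ob
  · obtain ⟨m, hm, rfl⟩ := (isAbelianType_iff_exists_eq_cyclicIdeal k I).1 hI
    obtain ⟨P, -, -, F, hF, -, h⟩ :=
      FDRep.exists_isDeligneProduct_isAbelianEnvelope.{u, v, w} k hm
    exact ⟨P, F, hF, h⟩
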